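/- Let $k$ be a field of characteristic zero, let $A = k\langle x,y\rangle/(x^2,\ y^2x-xy^2-xyx)$ be the super Jordan plane, and let $HH_n(A,A)$ be its Hochschild homology, i.e. the homology of the Hochschild complex $(A\otimes A^{\otimes n}, b)$. Let $V_0=k$, $V_1 = k\{x,y\}$ and $V_n = k\{x^n, y^2x^{n-1}\}$ for $n\ge 2$ (vector spaces on the displayed symbols), let $P_n = A\otimes V_n\otimes A$ (so $P_0=A\otimes A$, augmented to $A$ by multiplication), and let $d:P_{n+1}\to P_n$ be the maps of $A$-bimodules with $$1\otimes x\otimes 1\mapsto x\otimes 1-1\otimes x,\qquad 1\otimes y\otimes 1\mapsto y\otimes 1-1\otimes y,\qquad 1\otimes x^2\otimes 1\mapsto x\otimes x\otimes 1+1\otimes x\otimes x,$$ $$1\otimes y^2x\otimes 1\mapsto y^2\otimes x\otimes 1+y\otimes y\otimes x+1\otimes y\otimes yx-(xy\otimes y\otimes 1+x\otimes y\otimes y+1\otimes x\otimes y^2)-(xy\otimes x\otimes 1+x\otimes y\otimes x+1\otimes x\otimes yx),$$ and, for $n\ge 2$, $$1\otimes x^{n+1}\otimes 1\mapsto x\otimes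 x^n\otimes 1+(-1)^{n+1}\,1\otimes x^n\otimes x,$$ $$1\otimes y^2x^n\otimes 1\mapsto y^2\otimes x^n\otimes 1+(-1)^{n+1}\,1\otimes y^2x^{n-1}\otimes x-(x\otimes y^2x^{n-1}\otimes 1+xy\otimes x^n\otimes 1+1\otimes x^n\otimes y^2+1\otimes x^n\otimes yx).$$ Let $K_n = A\otimes_{A^e}P_n\cong A\otimes V_n$ (identified by $a\otimes(u\otimes w\otimes v)\mapsto vau\otimes w$), with the induced differential. Thus $K_0=A$, and elements of $K_n$, $n\geq 1$, are written as pairs $(a,b)\in A\oplus A$, the first component belonging to $x$ (if $n=1$) or $x^n$ (if $n\ge2$), and the second one to $y$ or $y^2x^{n-1}$. Put $w_n=\sum_{i=0}^n\frac{n!}{i!}(yx)^{n-i}y^{2i}$. Then there are bimodule chain maps from $P_\bullet$ to the bar resolution of $A$ lifting the identity of $A$, and every such chain map induces isomorphisms $H_n(K_\bullet)\cong HH_n(A,A)$ for all $n\ge 0$. The following elements are cycles, and under these isomorphisms their classes form $k$-bases: * of $HH_0(A,A)$: $xy^n$ and $y^n$, for $n\ge0$; * of $HH_1(A,A)$: for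 $n\ge0$, the elements $(w_n,0)$, $(0,y^n)$, $(-yxy^{2n},\ xy^{2n+1}+yxy^{2n})$ and $$\Big(y^{2n+1},\ \sum_{i=0}^n\frac{n!}{i!}\,\frac{n+1}{n-i+1}\,x(yx)^{n-i}y^{2i}+\sum_{i=0}^{n-1}\frac{n!}{i!}\,\frac1{n-i}\,(yx)^{n-i}y^{2i+1}\Big);$$ * of $HH_2(A,A)$, and of $HH_{2p+2}(A,A)$ for every $p\ge1$: for $n\ge0$, the elements $(xy^{2n},0)$ and $\big(\sum_{i=0}^n\frac{n!}{i!}(yx)^{n-i}y^{2i+1},\ w_n\big)$; * of $HH_{2p+1}(A,A)$ for every $p\ge1$: for $n\ge0$, the elements $(w_n,0)$ and $(-yxy^{2n},\ xy^{2n})$. In particular, $HH_n(A,A)$ is infinite-dimensional for every $n\ge0$. Moreover, Hochschild homology is $2$-periodic from degree $3$ on: for every $n\ge3$ there is an isomorphism $HH_n(A,A)\cong HH_{n+2}(A,A)$ that sends the class of each cycle $(a,b)\in K_n$ to the class of $(a,b)\in K_{n+2}$. -/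

import Mathlib

open scoped TensorProduct Nat

noncomputable section

/-! ## Homology of a sequence of linear maps -/

namespace Cpx

variable {k : Type*} [CommRing k] {X : ℕ → Type*} [∀ n, AddCommGroup (X n)]
  [∀ n, Module k (X n)] (d : ∀ n, X (n + 1) →ₗ[k] X n)

/-- The cycles of `⋯ → X 2 → X 1 → X 0 → 0`. -/
def cycles : ∀ n, Submodule k (X n)
  | 0 => ⊤
  | n + 1 => LinearMap.ker (d n)

/-- The boundaries of `⋯ → X 2 → X 1 → X 0 → 0`. -/
def boundaries (n : ℕ) : Submodule k (X n) := LinearMap.range (d n)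

/-- The homology in degree `n` of `⋯ → X 2 → X 1 → X 0 → 0`: cycles modulo boundaries. -/
abbrev Homology (n : ℕ) : Type _ := cycles d n ⧸ (boundaries d n).submoduleOf (cycles d n)

/-- `c` is a cycle, and `h` is its homology class. -/
def IsClassOf (n : ℕ) (c : X n) (h : Homology d n) : Prop :=
  ∃ hc : c ∈ cycles d n, Submodule.Quotient.mk ⟨c, hc⟩ = h

end Cpx

/-! ## The Hochschild complex and the bar resolution -/

namespace Hochschild

section Face

variable (k : Type*) [CommRing k] (A : Type*) [Ring A] [Algebra k A]

/-- `Fin.contractNth j` multiplies the entries with indices `j` and `j + 1`; multiplying two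
adjacent entries is compatible with updating one entry, up to a linear map of the new value. -/
theorem contractNth_update (n : ℕ) (j : Fin n) (a : Fin (n + 1) → A) (i : Fin (n + 1)) :
    ∃ (i' : Fin n) (f : A →ₗ[k] A), ∀ v : A,
      Fin.contractNth j.castSucc (· * ·) (Function.update a i v) =
        Function.update (Fin.contractNth j.castSucc (· * ·) a) i' (f v) := by
  obtain ⟨j, hj⟩ := j
  obtain ⟨i, hi⟩ := i
  rcases lt_trichotomy i j with h | h | h
  · refine ⟨⟨i, by omega⟩, LinearMap.id, fun v => ?_⟩
    funext ⟨l, hl⟩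
    simp only [Fin.contractNth, Function.update_apply, Fin.ext_iff,
      Fin.castSucc_mk, Fin.succ_mk, LinearMap.id_apply]
    grind
  · refine ⟨⟨i, by omega⟩, LinearMap.mulRight k (a ⟨i + 1, by omega⟩), fun v => ?_⟩
    funext ⟨l, hl⟩
    simp only [Fin.contractNth, Function.update_apply, Fin.ext_iff,
      Fin.castSucc_mk, Fin.succ_mk, LinearMap.mulRight_apply]
    grind
  · by_cases h' : i = j + 1
    · refine ⟨⟨j, by omega⟩, LinearMap.mulLeft k (a ⟨j, by omega⟩), fun v => ?_⟩
      funext ⟨l, hl⟩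
      simp only [Fin.contractNth, Function.update_apply, Fin.ext_iff,
        Fin.castSucc_mk, Fin.succ_mk, LinearMap.mulLeft_apply]
      grind
    · refine ⟨⟨i - 1, by omega⟩, LinearMap.id, fun v => ?_⟩
      funext ⟨l, hl⟩
      simp only [Fin.contractNth, Function.update_apply, Fin.ext_iff,
        Fin.castSucc_mk, Fin.succ_mk, LinearMap.id_apply]
      grind

/-- The inner face map `(a₁, …, aₙ₊₁) ↦ a₁ ⊗ ⋯ ⊗ aⱼ₊₁ aⱼ₊₂ ⊗ ⋯ ⊗ aₙ₊₁`, for `0 ≤ j < n`. -/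
def innerFace (n : ℕ) (j : Fin n) :
    MultilinearMap k (fun _ : Fin (n + 1) => A) (⨂[k]^n A) where
  toFun a := PiTensorProduct.tprod k (Fin.contractNth j.castSucc (· * ·) a)
  map_update_add' {inst} a i u v := by
    obtain rfl : inst = instDecidableEqFin _ := Subsingleton.elim _ _
    obtain ⟨i', f, hf⟩ := contractNth_update k A n j a i
    simp only [hf, map_add, MultilinearMap.map_update_add]
  map_update_smul' {inst} a i c v := by
    obtain rfl : inst = instDecidableEqFin _ := Subsingleton.elim _ _
    obtain ⟨i', f, hf⟩ := contractNth_update k A n j a i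
    simp only [hf, map_smul, MultilinearMap.map_update_smul]

end Face

section Boundary

variable {k : Type*} [CommRing k] {A : Type*} [Ring A] [Algebra k A]
  {M : Type*} [AddCommGroup M] [Module k M]

/-- The boundary formula, as a multilinear map in the entries `a₁, …, aₙ₊₁`: with
`ρ a m = m · a` and `lam a m = a · m`,
`m · a₁ ⊗ a₂ ⊗ ⋯ ⊗ aₙ₊₁ + ∑ⱼ (-1)ʲ m ⊗ a₁ ⊗ ⋯ ⊗ aⱼ aⱼ₊₁ ⊗ ⋯ ⊗ aₙ₊₁
  + (-1)ⁿ⁺¹ aₙ₊₁ · m ⊗ a₁ ⊗ ⋯ ⊗ aₙ`. -/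
def boundaryMultilinear (ρ lam : A →ₗ[k] Module.End k M) (n : ℕ) (m : M) :
    MultilinearMap k (fun _ : Fin (n + 1) => A) (M ⊗[k] (⨂[k]^n A)) where
  toFun a :=
    ρ (a 0) m ⊗ₜ PiTensorProduct.tprod k (Fin.tail a)
      + ∑ j : Fin n, (-1 : k) ^ (j.val + 1) • (m ⊗ₜ innerFace k A n j a)
      + (-1 : k) ^ (n + 1) • (lam (a (Fin.last n)) m ⊗ₜ PiTensorProduct.tprod k (Fin.init a))
  map_update_add' {inst} a i u v := by
    obtain rfl : inst = instDecidableEqFin _ := Subsingleton.elim _ _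
    have h1 : ∀ u v : A,
        ρ (Function.update a i (u + v) 0) m ⊗ₜ[k]
            PiTensorProduct.tprod k (Fin.tail (Function.update a i (u + v))) =
          ρ (Function.update a i u 0) m ⊗ₜ[k]
            PiTensorProduct.tprod k (Fin.tail (Function.update a i u)) +
          ρ (Function.update a i v 0) m ⊗ₜ[k]
            PiTensorProduct.tprod k (Fin.tail (Function.update a i v)) := by
      intro u v
      refine Fin.cases ?_ (fun i => ?_) i
      · simp [Fin.tail_update_zero, TensorProduct.add_tmul]
      · simp [Fin.tail_update_succ, TensorProduct.tmul_add,
          Function.update_of_ne (Fin.succ_ne_zero i).symm]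
    have h2 : ∀ u v : A,
        lam (Function.update a i (u + v) (Fin.last n)) m ⊗ₜ[k]
            PiTensorProduct.tprod k (Fin.init (Function.update a i (u + v))) =
          lam (Function.update a i u (Fin.last n)) m ⊗ₜ[k]
            PiTensorProduct.tprod k (Fin.init (Function.update a i u)) +
          lam (Function.update a i v (Fin.last n)) m ⊗ₜ[k]
            PiTensorProduct.tprod k (Fin.init (Function.update a i v)) := by
      intro u v
      refine Fin.lastCases ?_ (fun i => ?_) i
      · simp [Fin.init_update_last, TensorProduct.add_tmul]
      · simp [Fin.init_update_castSucc, TensorProduct.tmul_add,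
          Function.update_of_ne (Fin.castSucc_lt_last i).ne']
    rw [h1, h2]
    simp only [MultilinearMap.map_update_add, TensorProduct.tmul_add, smul_add,
      Finset.sum_add_distrib]
    abel
  map_update_smul' {inst} a i c v := by
    obtain rfl : inst = instDecidableEqFin _ := Subsingleton.elim _ _
    have h1 : ρ (Function.update a i (c • v) 0) m ⊗ₜ[k]
            PiTensorProduct.tprod k (Fin.tail (Function.update a i (c • v))) =
          c • (ρ (Function.update a i v 0) m ⊗ₜ[k]
            PiTensorProduct.tprod k (Fin.tail (Function.update a i v))) := by
      refine Fin.cases ?_ (fun i => ?_) i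
      · simp [Fin.tail_update_zero, TensorProduct.smul_tmul']
      · simp [Fin.tail_update_succ,
          Function.update_of_ne (Fin.succ_ne_zero i).symm]
    have h2 : lam (Function.update a i (c • v) (Fin.last n)) m ⊗ₜ[k]
            PiTensorProduct.tprod k (Fin.init (Function.update a i (c • v))) =
          c • (lam (Function.update a i v (Fin.last n)) m ⊗ₜ[k]
            PiTensorProduct.tprod k (Fin.init (Function.update a i v))) := by
      refine Fin.lastCases ?_ (fun i => ?_) i
      · simp [Fin.init_update_last, TensorProduct.smul_tmul']
      · simp [Fin.init_update_castSucc,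
          Function.update_of_ne (Fin.castSucc_lt_last i).ne']
    rw [h1, h2]
    simp only [MultilinearMap.map_update_smul, TensorProduct.tmul_smul, smul_add,
      Finset.smul_sum, smul_comm c]

/-- The Hochschild boundary `M ⊗ A^{⊗ (n+1)} → M ⊗ A^{⊗ n}`, where the bimodule structure of `M`
is given by `ρ a m = m · a` and `lam a m = a · m`. -/
def boundary (ρ lam : A →ₗ[k] Module.End k M) (n : ℕ) :
    M ⊗[k] (⨂[k]^(n + 1) A) →ₗ[k] M ⊗[k] (⨂[k]^n A) :=
  TensorProduct.lift
    { toFun := fun m => PiTensorProduct.lift (boundaryMultilinear ρ lam n m)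
      map_add' := fun m m' => by
        ext a
        simp only [LinearMap.compMultilinearMap_apply, PiTensorProduct.lift.tprod,
          LinearMap.add_apply, boundaryMultilinear, MultilinearMap.coe_mk, map_add,
          TensorProduct.add_tmul, smul_add, Finset.sum_add_distrib]
        abel
      map_smul' := fun c m => by
        ext a
        simp only [LinearMap.compMultilinearMap_apply, PiTensorProduct.lift.tprod,
          LinearMap.smul_apply, boundaryMultilinear, MultilinearMap.coe_mk, map_smul,
          ← TensorProduct.smul_tmul', smul_add, Finset.smul_sum, smul_comm c,
          RingHom.id_apply] }

end Boundary

section Complexes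

variable (k : Type*) [CommRing k] (A : Type*) [Ring A] [Algebra k A]

/-- The Hochschild chains `A ⊗ A^{⊗ n}`. -/
abbrev Chains (n : ℕ) : Type _ := A ⊗[k] (⨂[k]^n A)

/-- The Hochschild boundary
`a₀ ⊗ ⋯ ⊗ aₙ₊₁ ↦ ∑ⱼ (-1)ʲ a₀ ⊗ ⋯ ⊗ aⱼ aⱼ₊₁ ⊗ ⋯ ⊗ aₙ₊₁ + (-1)ⁿ⁺¹ aₙ₊₁ a₀ ⊗ a₁ ⊗ ⋯ ⊗ aₙ`. -/
def chainsD (n : ℕ) : Chains k A (n + 1) →ₗ[k] Chains k A n :=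
  boundary (LinearMap.mul k A).flip (LinearMap.mul k A) n

/-- The Hochschild homology `HH_n(A, A)`. -/
abbrev HH (n : ℕ) : Type _ := Cpx.Homology (chainsD k A) n

/-- The enveloping algebra `A ⊗ Aᵒᵖ`; left modules over it are `A`-bimodules, with
`(u ⊗ v) · m = u m v`. -/
abbrev Env : Type _ := A ⊗[k] Aᵐᵒᵖ

/-- The bimodules of the bar resolution, `A ⊗ A^{⊗ n} ⊗ A`, written as the left module
`Env ⊗ A^{⊗ n}`: the element `(u ⊗ v) ⊗ (a₁ ⊗ ⋯ ⊗ aₙ)` stands for `u ⊗ a₁ ⊗ ⋯ ⊗ aₙ ⊗ v`. -/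
abbrev Bar (n : ℕ) : Type _ := Env k A ⊗[k] (⨂[k]^n A)

/-- The differential of the bar resolution,
`u ⊗ a₁ ⊗ ⋯ ⊗ aₙ₊₁ ⊗ v ↦ u a₁ ⊗ a₂ ⊗ ⋯ ⊗ v + ∑ⱼ (-1)ʲ u ⊗ ⋯ ⊗ aⱼ aⱼ₊₁ ⊗ ⋯ ⊗ v
  + (-1)ⁿ⁺¹ u ⊗ a₁ ⊗ ⋯ ⊗ aₙ ⊗ aₙ₊₁ v`. -/
def barD (n : ℕ) : Bar k A (n + 1) →ₗ[k] Bar k A n :=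
  boundary
    ((LinearMap.mul k (Env k A)).flip ∘ₗ (Algebra.TensorProduct.includeLeft : A →ₐ[k] Env k A))
    ((LinearMap.mul k (Env k A)).flip ∘ₗ
      (Algebra.TensorProduct.includeRight : Aᵐᵒᵖ →ₐ[k] Env k A).toLinearMap ∘ₗ
      (MulOpposite.opLinearEquiv k : A ≃ₗ[k] Aᵐᵒᵖ).toLinearMap) n

/-- The multiplication `A ⊗ A → A`, `u ⊗ v ↦ u v`. -/
def envMul : Env k A →ₗ[k] A :=
  LinearMap.mul' k A ∘ₗ TensorProduct.map LinearMap.id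
    (MulOpposite.opLinearEquiv k : A ≃ₗ[k] Aᵐᵒᵖ).symm.toLinearMap

/-- The augmentation of the bar resolution. -/
def barAug : Bar k A 0 →ₗ[k] A :=
  (TensorProduct.rid k A).toLinearMap ∘ₗ TensorProduct.map (envMul k A)
    (PiTensorProduct.isEmptyEquiv (Fin 0)).toLinearMap

/-- The right action of `Env` on `A`: the element `u ⊗ v` acts by `a ↦ v a u`. It gives the
identification `A ⊗_{Env} (A ⊗ W ⊗ A) = A ⊗ W`, `a ⊗ (u ⊗ w ⊗ v) ↦ v a u ⊗ w`. -/
def envRightAct : Env k A →ₗ[k] Module.End k A :=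
  (AlgHom.mulLeftRight k A).toLinearMap ∘ₗ
    TensorProduct.map (MulOpposite.opLinearEquiv k : A ≃ₗ[k] Aᵐᵒᵖ).symm.toLinearMap
      (MulOpposite.opLinearEquiv k : A ≃ₗ[k] Aᵐᵒᵖ).toLinearMap ∘ₗ
    (TensorProduct.comm k A Aᵐᵒᵖ).toLinearMap

end Complexes

end Hochschild

/-! ## The super Jordan plane and its resolution -/

namespace SuperJordan

open Hochschild

variable (k : Type*) [Field k]

/-- The relations `x² = 0` and `y²x = xy² + xyx`, where `x`, `y` are the free generators
with indices `0`, `1`. -/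
inductive Rel : FreeAlgebra k (Fin 2) → FreeAlgebra k (Fin 2) → Prop
  | xx : Rel (FreeAlgebra.ι k 0 * FreeAlgebra.ι k 0) 0
  | yyx : Rel (FreeAlgebra.ι k 1 * FreeAlgebra.ι k 1 * FreeAlgebra.ι k 0)
      (FreeAlgebra.ι k 0 * FreeAlgebra.ι k 1 * FreeAlgebra.ι k 1 +
        FreeAlgebra.ι k 0 * FreeAlgebra.ι k 1 * FreeAlgebra.ι k 0)

/-- The super Jordan plane `k⟨x, y⟩ / (x², y²x - xy² - xyx)`. -/
def Plane : Type _ := RingQuot (Rel k)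

instance : Ring (Plane k) := inferInstanceAs (Ring (RingQuot (Rel k)))

instance : Algebra k (Plane k) := inferInstanceAs (Algebra k (RingQuot (Rel k)))

/-- The generator `x`. -/
def x : Plane k := RingQuot.mkAlgHom k (Rel k) (FreeAlgebra.ι k 0)

/-- The generator `y`. -/
def y : Plane k := RingQuot.mkAlgHom k (Rel k) (FreeAlgebra.ι k 1)

/-- The generators of the bimodules of the resolution: one generator in degree `0`; in degree
`1`, the indices `0`, `1` stand for `x`, `y`; in degree `n + 2`, they stand for
`xⁿ⁺²`, `y²xⁿ⁺¹`. -/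
abbrev Gen : ℕ → Type
  | 0 => Unit
  | _ + 1 => Fin 2

instance genFintype : ∀ n, Fintype (Gen n)
  | 0 => inferInstanceAs (Fintype Unit)
  | _ + 1 => inferInstanceAs (Fintype (Fin 2))

instance genDecidableEq : ∀ n, DecidableEq (Gen n)
  | 0 => inferInstanceAs (DecidableEq Unit)
  | _ + 1 => inferInstanceAs (DecidableEq (Fin 2))

variable {k} in
/-- The element `u ⊗ v` of `A ⊗ Aᵒᵖ`. -/
def el (u v : Plane k) : Env k (Plane k) := u ⊗ₜ MulOpposite.op v

/-- The free bimodule `A ⊗ k(Gen n) ⊗ A`, written as a free left module over `A ⊗ Aᵒᵖ`. -/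
abbrev Res (n : ℕ) : Type _ := Gen n → Env k (Plane k)

/-- `coeff n g h` is the coefficient of the generator `h` in the image of the generator `g`
under the differential of the resolution; `u ⊗ h ⊗ v` has the coefficient `el u v`. -/
def coeff : ∀ n, Gen (n + 1) → Gen n → Env k (Plane k)
  | 0 => fun g _ => ![el (x k) 1 - el 1 (x k), el (y k) 1 - el 1 (y k)] g
  | 1 => ![![el (x k) 1 + el 1 (x k), 0],
      ![el (y k * y k) 1 - el 1 (y k * y k) - el (x k * y k) 1 - el 1 (y k * x k),
        el (y k) (x k) + el 1 (y k * x k) - el (x k * y k) 1 - el (x k) (y k)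
          - el (x k) (x k)]]
  | n + 2 => ![![el (x k) 1 + (-1 : k) ^ (n + 3) • el 1 (x k), 0],
      ![el (y k * y k) 1 - el (x k * y k) 1 - el 1 (y k * y k) - el 1 (y k * x k),
        (-1 : k) ^ (n + 3) • el 1 (x k) - el (x k) 1]]

/-- The differential of the resolution. -/
def resD (n : ℕ) : Res k (n + 1) →ₗ[Env k (Plane k)] Res k n :=
  LinearMap.pi fun h => ∑ g,
    (LinearMap.toSpanSingleton (Env k (Plane k)) (Env k (Plane k)) (coeff k n g h)) ∘ₗ
      LinearMap.proj g

/-- The spaces `A ⊗_{A ⊗ Aᵒᵖ} (A ⊗ k(Gen n) ⊗ A) = A ⊗ k(Gen n)`. -/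
abbrev Small (n : ℕ) : Type _ := Gen n → Plane k

/-- The differential obtained by applying `A ⊗_{A ⊗ Aᵒᵖ} -` to the differential of the
resolution. -/
def smallD (n : ℕ) : Small k (n + 1) →ₗ[k] Small k n :=
  LinearMap.pi fun h => ∑ g, envRightAct k (Plane k) (coeff k n g h) ∘ₗ LinearMap.proj g

/-- A comparison map from the resolution to the bar resolution: bimodule maps that commute with
the differentials and with the augmentations to `A`. -/
structure IsComparison
    (Φ : ∀ n, Res k n →ₗ[Env k (Plane k)] Bar k (Plane k) n) : Prop where
  aug : ∀ v, barAug k (Plane k) (Φ 0 v) = envMul k (Plane k) (v ())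
  comm : ∀ n v, barD k (Plane k) n (Φ (n + 1) v) = Φ n (resD k n v)

variable {k}

/-- The map `A ⊗ k(Gen n) → A ⊗ A^{⊗ n}` obtained by applying `A ⊗_{A ⊗ Aᵒᵖ} -` to `Φ n`. -/
def induced (Φ : ∀ n, Res k n →ₗ[Env k (Plane k)] Bar k (Plane k) n) (n : ℕ)
    (v : Small k n) : Chains k (Plane k) n :=
  ∑ g, TensorProduct.map ((envRightAct k (Plane k)).flip (v g)) LinearMap.id
    (Φ n (Pi.single g 1))

/-- The elements `z i` are cycles, and their classes, transported by `Φ`, form a basis of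
`HH_n(A, A)`. -/
def ClassesFormBasis (Φ : ∀ n, Res k n →ₗ[Env k (Plane k)] Bar k (Plane k) n) (n : ℕ)
    {ι : Type} (z : ι → Small k n) : Prop :=
  (∀ i, z i ∈ Cpx.cycles (smallD k) n) ∧
    ∃ B : Module.Basis ι k (HH k (Plane k) n),
      ∀ i, Cpx.IsClassOf (chainsD k (Plane k)) n (induced Φ n (z i)) (B i)

/-! ### The cycles -/

variable (k)

/-- `∑_{0 ≤ i ≤ n} (n! / i!) (yx)ⁿ⁻ⁱ y²ⁱ`. -/
def w (n : ℕ) : Plane k :=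
  ∑ i ∈ Finset.range (n + 1), ((n ! : k) / (i ! : k)) • ((y k * x k) ^ (n - i) * y k ^ (2 * i))

/-- The representatives in degree `0`. -/
def cycle₀ : ℕ ⊕ ℕ → Small k 0 :=
  Sum.elim (fun n _ => x k * y k ^ n) (fun n _ => y k ^ n)

/-- The second component of the first family in degree `1`. The term with `1 / (n - i)` occurs
for `i < n` only. -/
def cycle₁Aux (n : ℕ) : Plane k :=
  ∑ i ∈ Finset.range (n + 1), ((n ! : k) / (i ! : k) * ((n + 1 : k) / ((n : k) - i + 1))) •
      (x k * (y k * x k) ^ (n - i) * y k ^ (2 * i)) +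
    ∑ i ∈ Finset.range n, ((n ! : k) / (i ! : k) * (1 / ((n : k) - i))) •
      ((y k * x k) ^ (n - i) * y k ^ (2 * i + 1))

/-- The representatives in degree `1`. -/
def cycle₁ : (ℕ ⊕ ℕ) ⊕ (ℕ ⊕ ℕ) → Small k 1 :=
  Sum.elim
    (Sum.elim (fun n => ![y k ^ (2 * n + 1), cycle₁Aux k n]) (fun n => ![w k n, 0]))
    (Sum.elim (fun n => ![0, y k ^ n])
      (fun n => ![-(y k * x k * y k ^ (2 * n)),
        x k * y k ^ (2 * n + 1) + y k * x k * y k ^ (2 * n)]))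

/-- The representatives in the even degrees `n = 2, 4, 6, …`. -/
def cycleEven : ℕ ⊕ ℕ → Fin 2 → Plane k :=
  Sum.elim (fun n => ![x k * y k ^ (2 * n), 0])
    (fun n => ![∑ i ∈ Finset.range (n + 1),
        ((n ! : k) / (i ! : k)) • ((y k * x k) ^ (n - i) * y k ^ (2 * i + 1)), w k n])

/-- The representatives in the odd degrees `n = 3, 5, 7, …`. -/
def cycleOdd : ℕ ⊕ ℕ → Fin 2 → Plane k :=
  Sum.elim (fun n => ![w k n, 0])
    (fun n => ![-(y k * x k * y k ^ (2 * n)), x k * y k ^ (2 * n)])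

end SuperJordan

end

open scoped TensorProduct Nat

set_option linter.unusedSimpArgs false

noncomputable section

/-! Write `t = yx`. The proof has two halves: a comparison of resolutions, and the homology of the
small complex `K`.

Comparison. The relations give `A` the PBW basis `tⁱ yᶜ`, `x tⁱ yᶜ` (`linearIndependent_monomial`,
`span_monomial`). Under left multiplication by `x`, `A` is therefore free over `k[x]/(x²)`, and
division by `x` is a contracting homotopy. It makes `P` exact in high degrees; in degrees 1 and 2
one adds a downward recursion on coefficients, which stops because supports are finite
(`ker_resD_le`, `ker_envMul_le`). The bar resolution has its usual contracting homotopy. Two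
projective resolutions of `A` are homotopy equivalent, and the functor `A ⊗_{Aᵉ} -`, used through
its universal property, carries the equivalence to `K` and the Hochschild complex
(`exists_homology_equiv_of_isComparison`).

Homology of `K`. Put `D_ε a = a x + ε x a`, and let `c`, `f` be the operators `cAct`, `fAct`. From
degree 3 on the differential is `(a, b) ↦ (D_ε a + c b, -D_{-ε} b)`, with `ε` alternating; hence the
periodicity. Everything rests on `q = y² + yx`: it commutes with `x`, `wₙ = qⁿ`, and `y²ⁿ x = x wₙ`.
This makes `D_ε` explicit on monomials and yields `ker D_{-1} = span(wₙ) + im D_1` and `ker D_1 =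
span(x y²ⁿ) + im D_{-1}`. Since `c wₙ = -D_1(wₙ y)` and `c(x y²ⁿ) = D_{-1}(t y²ⁿ)`, each of these
classes, placed in the second component, lifts to a cycle; coefficient functionals that vanish on
boundaries show independence (`exists_basis_of_filtration`).

In low degrees `f` replaces `D_{-1}`. It has the same kernel (`fAct_eq_zero_iff`), which settles
degree 2. Degree 1 requires the `b` with `b y - y b ∈ im D_{-1}`, modulo `im f` (`mem_of_adY_mem`);
degree 0 is `A` modulo commutators. Characteristic zero enters through divisions by `2`, by `i + 1`
and by `m + i + 2`. -/

namespace SuperJordan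

/-! ### The PBW basis. -/

section PBW

variable (k : Type*) [Field k]

/-- The quotient map from the free algebra. -/
def ofFree : FreeAlgebra k (Fin 2) →ₐ[k] Plane k := RingQuot.mkAlgHom k (Rel k)

theorem ofFree_surjective : Function.Surjective (ofFree k) :=
  RingQuot.mkAlgHom_surjective k (Rel k)

theorem ofFree_ι_zero : ofFree k (FreeAlgebra.ι k 0) = x k := rfl

theorem ofFree_ι_one : ofFree k (FreeAlgebra.ι k 1) = y k := rfl

theorem x_mul_x : x k * x k = 0 := by
  have : ofFree k _ = ofFree k _ := RingQuot.mkAlgHom_rel k (Rel.xx (k := k))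
  simpa only [map_mul, map_zero, ofFree_ι_zero] using this

theorem y_mul_y_mul_x :
    y k * y k * x k = x k * y k * y k + x k * y k * x k := by
  have : ofFree k _ = ofFree k _ := RingQuot.mkAlgHom_rel k (Rel.yyx (k := k))
  simpa only [map_mul, map_add, ofFree_ι_zero, ofFree_ι_one] using this

/-- The monomials `(yx)ⁱ yᶜ`. -/
def mon (i c : ℕ) : Plane k := (y k * x k) ^ i * y k ^ c

theorem mon_zero_zero : mon k 0 0 = 1 := by simp [mon]

theorem mon_mul_y_pow (i c d : ℕ) : mon k i c * y k ^ d = mon k i (c + d) := by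
  rw [mon, mon, mul_assoc, ← pow_add]

theorem mon_mul_y (i c : ℕ) : mon k i c * y k = mon k i (c + 1) := by
  simpa using mon_mul_y_pow k i c 1

theorem x_mul_x_mul (a : Plane k) : x k * (x k * a) = 0 := by
  rw [← mul_assoc, x_mul_x, zero_mul]

theorem y_mul_x_mul_mon (i c : ℕ) : y k * (x k * mon k i c) = mon k (i + 1) c := by
  rw [mon, mon, pow_succ']; simp only [mul_assoc]

theorem y_mul_mon_zero (c : ℕ) : y k * mon k 0 c = mon k 0 (c + 1) := by
  simp [mon, pow_succ']

/-- Multiplied by `y` on the left, the second relation reads `y² t = t y² + t²`. So the commutator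
with `y²` acts on powers of `t` as the derivation `t² d/dt`. -/
theorem y_sq_mul_t_pow (i : ℕ) : y k * (y k * (y k * x k) ^ i) =
    (y k * x k) ^ i * y k ^ 2 + (i : k) • (y k * x k) ^ (i + 1) := by
  induction i with
  | zero => simp [pow_two]
  | succ i ih =>
    have h : y k * (y k * (y k * x k)) =
        (y k * x k) * (y k * y k) + (y k * x k) * (y k * x k) := by
      have := congrArg (y k * ·) (y_mul_y_mul_x k)
      simpa only [mul_add, mul_assoc] using this
    calc y k * (y k * (y k * x k) ^ (i + 1))
        = (y k * (y k * (y k * x k))) * (y k * x k) ^ i := by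
          simp only [pow_succ', mul_assoc]
      _ = (y k * x k) * (y k * (y k * (y k * x k) ^ i)) + (y k * x k) ^ (i + 2) := by
          rw [h, add_mul, pow_succ', pow_succ']; simp only [mul_assoc]
      _ = _ := by
          rw [ih, mul_add, mul_smul_comm, ← pow_succ', ← mul_assoc, ← pow_succ', add_assoc]
          push_cast
          rw [add_smul, one_smul]

/-- This is the only nontrivial straightening rule for left multiplication by a generator; `yOpFun`
copies it in coordinates. -/
theorem y_mul_mon_succ (i c : ℕ) : y k * mon k (i + 1) c =
    x k * mon k i (c + 2) + ((i : k) + 1) • (x k * mon k (i + 1) c) := by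
  have h : y k * (y k * x k) ^ (i + 1) =
      x k * (y k * (y k * (y k * x k) ^ i)) + x k * (y k * x k) ^ (i + 1) := by
    rw [pow_succ', ← mul_assoc, ← mul_assoc, y_mul_y_mul_x, add_mul]
    simp only [mul_assoc]
  rw [mon, ← mul_assoc, h, y_sq_mul_t_pow, mul_add, add_assoc, mul_smul_comm, add_mul]
  simp only [mon]
  rw [add_comm c 2, pow_add (y k) 2 c]
  simp only [mul_assoc, add_mul, smul_mul_assoc, add_smul, one_smul]

/-- The PBW monomials: `(yx)ⁱ yᶜ` and `x (yx)ⁱ yᶜ`. -/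
def monomial : (ℕ × ℕ) ⊕ (ℕ × ℕ) → Plane k :=
  Sum.elim (fun p => mon k p.1 p.2) (fun p => x k * mon k p.1 p.2)

/-- Left multiplication by `x` in the coordinates of the PBW basis. -/
def xOp : ((ℕ × ℕ) ⊕ (ℕ × ℕ) →₀ k) →ₗ[k] ((ℕ × ℕ) ⊕ (ℕ × ℕ) →₀ k) :=
  Finsupp.linearCombination k
    (Sum.elim (fun p => Finsupp.single (Sum.inr p) 1) (fun _ => 0))

/-- The images of the PBW basis under left multiplication by `y`. -/
def yOpFun : (ℕ × ℕ) ⊕ (ℕ × ℕ) → ((ℕ × ℕ) ⊕ (ℕ × ℕ) →₀ k)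
  | Sum.inl (0, c) => Finsupp.single (Sum.inl (0, c + 1)) 1
  | Sum.inl (i + 1, c) => Finsupp.single (Sum.inr (i, c + 2)) 1 +
      ((i : k) + 1) • Finsupp.single (Sum.inr (i + 1, c)) 1
  | Sum.inr (i, c) => Finsupp.single (Sum.inl (i + 1, c)) 1

/-- Left multiplication by `y` in the coordinates of the PBW basis. -/
def yOp : ((ℕ × ℕ) ⊕ (ℕ × ℕ) →₀ k) →ₗ[k] ((ℕ × ℕ) ⊕ (ℕ × ℕ) →₀ k) :=
  Finsupp.linearCombination k (yOpFun k)

theorem xOp_xOp : xOp k * xOp k = 0 := by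
  refine Finsupp.lhom_ext' fun j => LinearMap.ext_ring ?_
  rcases j with p | p <;> simp [xOp]

theorem yOp_yOp_xOp :
    yOp k * yOp k * xOp k = xOp k * yOp k * yOp k + xOp k * yOp k * xOp k := by
  refine Finsupp.lhom_ext' fun j => LinearMap.ext_ring ?_
  rcases j with ⟨_ | i, c⟩ | ⟨i, c⟩ <;> simp [xOp, yOp, yOpFun, add_smul, add_assoc]

/-- The regular representation in the coordinates of the PBW basis. -/
def regular : Plane k →ₐ[k] Module.End k ((ℕ × ℕ) ⊕ (ℕ × ℕ) →₀ k) :=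
  RingQuot.liftAlgHom k ⟨FreeAlgebra.lift k ![xOp k, yOp k], by
    intro a b h
    cases h with
    | xx => simpa using xOp_xOp k
    | yyx => simpa using yOp_yOp_xOp k⟩

theorem regular_ofFree (f : FreeAlgebra k (Fin 2)) :
    regular k (ofFree k f) = FreeAlgebra.lift k ![xOp k, yOp k] f :=
  RingQuot.liftAlgHom_mkAlgHom_apply k _ _ _

theorem regular_x : regular k (x k) = xOp k := by
  rw [← ofFree_ι_zero, regular_ofFree]
  simp

theorem regular_y : regular k (y k) = yOp k := by
  rw [← ofFree_ι_one, regular_ofFree]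
  simp

theorem regular_mon (i c : ℕ) :
    regular k (mon k i c) (Finsupp.single (Sum.inl (0, 0)) 1) =
      Finsupp.single (Sum.inl (i, c)) 1 := by
  have h : ∀ c, regular k (y k ^ c) (Finsupp.single (Sum.inl (0, 0)) 1) =
      Finsupp.single (Sum.inl (0, c)) 1 := by
    intro c
    induction c with
    | zero => simp
    | succ c ih => rw [pow_succ', map_mul, Module.End.mul_apply, ih, regular_y]; simp [yOp, yOpFun]
  induction i with
  | zero => simpa [mon] using h c
  | succ i ih =>
    rw [← y_mul_x_mul_mon, map_mul, map_mul, Module.End.mul_apply, Module.End.mul_apply, ih,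
      regular_x, regular_y]
    simp [yOp, yOpFun, xOp]

theorem regular_monomial (j : (ℕ × ℕ) ⊕ (ℕ × ℕ)) :
    regular k (monomial k j) (Finsupp.single (Sum.inl (0, 0)) 1) = Finsupp.single j 1 := by
  rcases j with ⟨i, c⟩ | ⟨i, c⟩
  · exact regular_mon k i c
  · rw [monomial, Sum.elim_inr, map_mul, Module.End.mul_apply, regular_mon, regular_x]
    simp [xOp]

/-- The regular representation, evaluated at the coordinate vector of `1`, sends each monomial to
its own coordinate vector. -/
theorem linearIndependent_monomial : LinearIndependent k (monomial k) := by
  let f : Plane k →ₗ[k] ((ℕ × ℕ) ⊕ (ℕ × ℕ) →₀ k) :=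
    (LinearMap.applyₗ (Finsupp.single (Sum.inl (0, 0)) 1)) ∘ₗ (regular k).toLinearMap
  refine LinearIndependent.of_comp f ?_
  have : f ∘ monomial k = fun j => Finsupp.single j (1 : k) := by
    funext j
    exact regular_monomial k j
  rw [this]
  exact Finsupp.linearIndependent_single_one k _

/-- A subspace stable under left multiplication by the generators is a left ideal. -/
theorem mul_mem_of_generators (S : Submodule k (Plane k)) (hx : ∀ a ∈ S, x k * a ∈ S)
    (hy : ∀ a ∈ S, y k * a ∈ S) (u a : Plane k) (ha : a ∈ S) : u * a ∈ S := by
  obtain ⟨f, rfl⟩ := ofFree_surjective k u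
  induction f using FreeAlgebra.induction generalizing a with
  | grade0 r =>
    rw [AlgHom.commutes, ← Algebra.smul_def]
    exact S.smul_mem r ha
  | grade1 i =>
    fin_cases i
    · exact hx a ha
    · exact hy a ha
  | mul f g hf hg =>
    rw [map_mul, mul_assoc]
    exact hf _ (hg _ ha)
  | add f g hf hg =>
    rw [map_add, add_mul]
    exact S.add_mem (hf _ ha) (hg _ ha)

/-- The span contains `1` and is stable under left multiplication by `x` and `y`, hence is all of
`A`. -/
theorem span_monomial : Submodule.span k (Set.range (monomial k)) = ⊤ := by
  have h0 : ∀ i c, mon k i c ∈ Submodule.span k (Set.range (monomial k)) := fun i c =>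
    Submodule.subset_span ⟨Sum.inl (i, c), rfl⟩
  have h1 : ∀ i c, x k * mon k i c ∈ Submodule.span k (Set.range (monomial k)) := fun i c =>
    Submodule.subset_span ⟨Sum.inr (i, c), rfl⟩
  rw [eq_top_iff]
  intro u _
  rw [← mul_one u]
  refine mul_mem_of_generators k _ ?_ ?_ u 1 (mon_zero_zero k ▸ h0 0 0)
  · intro a ha
    induction ha using Submodule.span_induction with
    | mem a ha =>
      obtain ⟨⟨i, c⟩ | ⟨i, c⟩, rfl⟩ := ha
      · exact h1 i c
      · change x k * (x k * _) ∈ _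
        rw [x_mul_x_mul]
        exact Submodule.zero_mem _
    | zero => rw [mul_zero]; exact Submodule.zero_mem _
    | add a b _ _ ha hb => rw [mul_add]; exact Submodule.add_mem _ ha hb
    | smul r a _ ha => rw [mul_smul_comm]; exact Submodule.smul_mem _ r ha
  · intro a ha
    induction ha using Submodule.span_induction with
    | mem a ha =>
      obtain ⟨⟨i, c⟩ | ⟨i, c⟩, rfl⟩ := ha
      · change y k * mon k i c ∈ _
        rcases i with _ | i
        · rw [y_mul_mon_zero]; exact h0 _ _
        · rw [y_mul_mon_succ]
          exact Submodule.add_mem _ (h1 _ _) (Submodule.smul_mem _ _ (h1 _ _))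
      · change y k * (x k * mon k i c) ∈ _
        rw [y_mul_x_mul_mon]; exact h0 _ _
    | zero => rw [mul_zero]; exact Submodule.zero_mem _
    | add a b _ _ ha hb => rw [mul_add]; exact Submodule.add_mem _ ha hb
    | smul r a _ ha => rw [mul_smul_comm]; exact Submodule.smul_mem _ r ha

/-- The PBW basis of the super Jordan plane. -/
def pbw : Module.Basis ((ℕ × ℕ) ⊕ (ℕ × ℕ)) k (Plane k) :=
  Module.Basis.mk (linearIndependent_monomial k) (span_monomial k).ge

theorem pbw_inl (i c : ℕ) : pbw k (Sum.inl (i, c)) = mon k i c := by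
  simp [pbw, monomial]

theorem pbw_inr (i c : ℕ) : pbw k (Sum.inr (i, c)) = x k * mon k i c := by
  simp [pbw, monomial]

variable {k}

theorem mem_of_monomials (S : Submodule k (Plane k)) (h0 : ∀ i c, mon k i c ∈ S)
    (h1 : ∀ i c, x k * mon k i c ∈ S) (a : Plane k) : a ∈ S := by
  have : Submodule.span k (Set.range (monomial k)) ≤ S := by
    rw [Submodule.span_le]
    rintro _ ⟨⟨i, c⟩ | ⟨i, c⟩, rfl⟩
    exacts [h0 i c, h1 i c]
  exact this (span_monomial k ▸ Submodule.mem_top)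

theorem ext_monomials {M : Type*} [AddCommGroup M] [Module k M] {f g : Plane k →ₗ[k] M}
    (h0 : ∀ i c, f (mon k i c) = g (mon k i c))
    (h1 : ∀ i c, f (x k * mon k i c) = g (x k * mon k i c)) : f = g := by
  ext a
  exact mem_of_monomials (LinearMap.eqLocus f g) h0 h1 a

/-- The linear map with prescribed values on the PBW monomials. -/
def onMonomials {M : Type*} [AddCommGroup M] [Module k M] (f g : ℕ → ℕ → M) :
    Plane k →ₗ[k] M :=
  (pbw k).constr k (Sum.elim (fun p => f p.1 p.2) (fun p => g p.1 p.2))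

@[simp] theorem onMonomials_mon {M : Type*} [AddCommGroup M] [Module k M] (f g : ℕ → ℕ → M)
    (i c : ℕ) : onMonomials (k := k) f g (mon k i c) = f i c := by
  rw [onMonomials, ← pbw_inl, Module.Basis.constr_basis]; rfl

@[simp] theorem onMonomials_x_mul_mon {M : Type*} [AddCommGroup M] [Module k M]
    (f g : ℕ → ℕ → M) (i c : ℕ) : onMonomials (k := k) f g (x k * mon k i c) = g i c := by
  rw [onMonomials, ← pbw_inr, Module.Basis.constr_basis]; rfl

end PBW

end SuperJordan

namespace SuperJordan

open Hochschild

/-! ### Computations in the enveloping algebra. -/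

section Env

variable {k : Type*} [Field k]

theorem el_mul_el (u v u' v' : Plane k) : el u v * el u' v' = el (u * u') (v' * v) := by
  simp [el]

theorem el_add (u v v' : Plane k) : el u (v + v') = el u v + el u v' := by
  simp [el, TensorProduct.tmul_add]

theorem add_el (u u' v : Plane k) : el (u + u') v = el u v + el u' v := by
  simp [el, TensorProduct.add_tmul]

theorem el_smul (c : k) (u v : Plane k) : el u (c • v) = c • el u v := by
  simp [el]

theorem smul_el (c : k) (u v : Plane k) : el (c • u) v = c • el u v := by
  simp [el, TensorProduct.smul_tmul']

theorem el_zero (u : Plane k) : el u 0 = 0 := by simp [el]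

theorem zero_el (u : Plane k) : el 0 u = 0 := by simp [el]

theorem env_neg_smul (c : k) (z : Env k (Plane k)) : -c • z = -(c • z) := neg_smul c z

theorem env_neg_mul (w z : Env k (Plane k)) : -w * z = -(w * z) := neg_mul w z

theorem env_mul_neg (w z : Env k (Plane k)) : w * -z = -(w * z) := mul_neg w z

theorem env_smul_neg (c : k) (z : Env k (Plane k)) : c • -z = -(c • z) := smul_neg c z

theorem x_mul_x_mul' (a : Plane k) : x k * (x k * a) = 0 := x_mul_x_mul k a

theorem y_mul_y_mul_x' : y k * (y k * x k) = x k * (y k * y k) + x k * (y k * x k) := by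
  simpa only [mul_assoc] using y_mul_y_mul_x k

theorem mem_of_el (S : Submodule k (Env k (Plane k)))
    (h0 : ∀ u i c, el u (mon k i c) ∈ S) (h1 : ∀ u i c, el u (x k * mon k i c) ∈ S)
    (z : Env k (Plane k)) : z ∈ S := by
  induction z using TensorProduct.induction_on with
  | zero => exact S.zero_mem
  | add a b ha hb => exact S.add_mem ha hb
  | tmul u v =>
    induction v using MulOpposite.rec' with
    | _ v =>
    let f : Plane k →ₗ[k] Env k (Plane k) :=
      (TensorProduct.mk k (Plane k) (Plane k)ᵐᵒᵖ u) ∘ₗ (MulOpposite.opLinearEquiv k).toLinearMap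
    exact mem_of_monomials (S.comap f) (h0 u) (h1 u) v

theorem ext_el {M : Type*} [AddCommGroup M] [Module k M] {f g : Env k (Plane k) →ₗ[k] M}
    (h0 : ∀ u i c, f (el u (mon k i c)) = g (el u (mon k i c)))
    (h1 : ∀ u i c, f (el u (x k * mon k i c)) = g (el u (x k * mon k i c))) : f = g := by
  ext1
  ext u v
  exact mem_of_el (LinearMap.eqLocus f g) h0 h1 (u ⊗ₜ v)

/-- Apply a linear map to the second tensor factor. -/
def onRight {M : Type*} [AddCommGroup M] [Module k M] (f : Plane k →ₗ[k] M) :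
    Env k (Plane k) →ₗ[k] Plane k ⊗[k] M :=
  TensorProduct.map LinearMap.id (f ∘ₗ (MulOpposite.opLinearEquiv k).symm.toLinearMap)

/-- The coefficient, in the first tensor factor, of a monomial of the second one. -/
def coef (j : (ℕ × ℕ) ⊕ (ℕ × ℕ)) : Env k (Plane k) →ₗ[k] Plane k :=
  (TensorProduct.rid k (Plane k)).toLinearMap ∘ₗ onRight ((pbw k).coord j)

theorem coef_el (j : (ℕ × ℕ) ⊕ (ℕ × ℕ)) (u v : Plane k) :
    coef j (el u v) = (pbw k).repr v j • u := by
  simp [coef, onRight, el]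

theorem repr_mon (i c : ℕ) : (pbw k).repr (mon k i c) = Finsupp.single (Sum.inl (i, c)) 1 := by
  rw [← pbw_inl, Module.Basis.repr_self]

theorem repr_x_mul_mon (i c : ℕ) :
    (pbw k).repr (x k * mon k i c) = Finsupp.single (Sum.inr (i, c)) 1 := by
  rw [← pbw_inr, Module.Basis.repr_self]

theorem coef_mul_el_one (j : (ℕ × ℕ) ⊕ (ℕ × ℕ)) (z : Env k (Plane k)) (u : Plane k) :
    coef j (z * el u 1) = coef j z * u := by
  have : coef j ∘ₗ LinearMap.mulRight k (el u 1) = LinearMap.mulRight k u ∘ₗ coef j :=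
    ext_el (by simp [el_mul_el, coef_el]) (by simp [el_mul_el, coef_el])
  exact LinearMap.congr_fun this z

/-- Only finitely many monomials occur in the second tensor factor; the downward recursions in the
exactness proofs terminate because of this. -/
theorem coef_finite (z : Env k (Plane k)) :
    ∃ n, ∀ i c, n ≤ i + c → coef (Sum.inl (i, c)) z = 0 ∧ coef (Sum.inr (i, c)) z = 0 := by
  have key : ∀ u v : Plane k, ∃ n, ∀ i c, n ≤ i + c →
      coef (Sum.inl (i, c)) (el u v) = 0 ∧ coef (Sum.inr (i, c)) (el u v) = 0 := by
    intro u v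
    refine ⟨(((pbw k).repr v).support.sup
      (Sum.elim (fun p => p.1 + p.2) (fun p => p.1 + p.2))) + 1, fun i c h => ?_⟩
    have : ∀ j, Sum.elim (fun p : ℕ × ℕ => p.1 + p.2) (fun p => p.1 + p.2) j = i + c →
        (pbw k).repr v j = 0 := by
      intro j hj
      by_contra hne
      have := Finset.le_sup (f := Sum.elim (fun p : ℕ × ℕ => p.1 + p.2) (fun p => p.1 + p.2))
        (Finsupp.mem_support_iff.2 hne)
      omega
    rw [coef_el, coef_el, this _ rfl, this _ rfl, zero_smul]
    exact ⟨rfl, rfl⟩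
  induction z using TensorProduct.induction_on with
  | zero => exact ⟨0, by simp⟩
  | add a b ha hb =>
    obtain ⟨n, hn⟩ := ha
    obtain ⟨m, hm⟩ := hb
    refine ⟨n + m, fun i c h => ?_⟩
    rw [map_add, map_add, (hn i c (by omega)).1, (hn i c (by omega)).2,
      (hm i c (by omega)).1, (hm i c (by omega)).2, add_zero]
    exact ⟨rfl, rfl⟩
  | tmul u v => exact key u v.unop

theorem eq_zero_of_coef (z : Env k (Plane k)) (h0 : ∀ i c, coef (Sum.inl (i, c)) z = 0)
    (h1 : ∀ i c, coef (Sum.inr (i, c)) z = 0) : z = 0 := by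
  let ℬ : Module.Basis _ k (Plane k)ᵐᵒᵖ := (pbw k).map (MulOpposite.opLinearEquiv k)
  have key : ∀ (j) (z : Env k (Plane k)),
      TensorProduct.equivFinsuppOfBasisRight ℬ z j = coef j z := by
    intro j z
    induction z using TensorProduct.induction_on with
    | zero => simp
    | add a b ha hb => rw [map_add, Finsupp.add_apply, ha, hb, map_add]
    | tmul u v =>
      change _ = coef j (el u v.unop)
      rw [TensorProduct.equivFinsuppOfBasisRight_apply_tmul_apply, coef_el]
      simp [ℬ]
  apply (TensorProduct.equivFinsuppOfBasisRight ℬ).injective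
  ext1 j
  rw [key, map_zero, Finsupp.zero_apply]
  rcases j with ⟨i, c⟩ | ⟨i, c⟩
  exacts [h0 i c, h1 i c]

/-- A sequence that is eventually zero and in which each entry is determined additively by the
next one is zero. -/
theorem eq_zero_of_downward {M : Type*} [Zero M] (f : ℕ → M) (g : M → M) (hg : g 0 = 0)
    (hf : ∀ i, f i = g (f (i + 1))) (n : ℕ) (hn : ∀ i, n ≤ i → f i = 0) (i : ℕ) : f i = 0 := by
  have key : ∀ m i, n ≤ i + m → f i = 0 := by
    intro m
    induction m with
    | zero => exact hn
    | succ m ih => intro i h; rw [hf, ih (i + 1) (by omega), hg]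
  exact key n i (by omega)

variable (k) in
/-- Division by `x` on the left, killing the monomials `(yx)ⁱ yᶜ`. -/
def divX : Plane k →ₗ[k] Plane k := onMonomials (fun _ _ => 0) (mon k)

variable (k) in
/-- Division by `x` on the left in the second tensor factor. -/
def envDivX : Env k (Plane k) →ₗ[k] Env k (Plane k) :=
  TensorProduct.map LinearMap.id ((MulOpposite.opLinearEquiv k).toLinearMap ∘ₗ divX k ∘ₗ
    (MulOpposite.opLinearEquiv k).symm.toLinearMap)

theorem envDivX_el (u v : Plane k) : envDivX k (el u v) = el u (divX k v) := by
  simp [envDivX, el]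

/-- Right multiplication by `1 ⊗ x` multiplies the second factor by `x` on the left. That factor is
free over `k[x]/(x²)` on the monomials `tⁱ yᶜ`, so division by `x` is a contracting homotopy for
this multiplication. -/
theorem envDivX_mul_add (z : Env k (Plane k)) :
    envDivX k (z * el 1 (x k)) + envDivX k z * el 1 (x k) = z := by
  have : envDivX k ∘ₗ LinearMap.mulRight k (el 1 (x k)) +
      LinearMap.mulRight k (el 1 (x k)) ∘ₗ envDivX k = LinearMap.id :=
    ext_el (by simp [el_mul_el, envDivX_el, divX, el_zero])
      (by simp [el_mul_el, envDivX_el, divX, x_mul_x_mul', el_zero])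
  exact LinearMap.congr_fun this z

theorem envDivX_mul_el_one (z : Env k (Plane k)) (u : Plane k) :
    envDivX k (z * el u 1) = envDivX k z * el u 1 := by
  have : envDivX k ∘ₗ LinearMap.mulRight k (el u 1) =
      LinearMap.mulRight k (el u 1) ∘ₗ envDivX k :=
    ext_el (by simp [el_mul_el, envDivX_el]) (by simp [el_mul_el, envDivX_el])
  exact LinearMap.congr_fun this z

theorem coef_inr_sub_envDivX (z : Env k (Plane k)) (i c : ℕ) :
    coef (Sum.inr (i, c)) (z - envDivX k z * el 1 (x k)) = 0 := by
  have : coef (Sum.inr (i, c)) ∘ₗ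
      (LinearMap.id - LinearMap.mulRight k (el 1 (x k)) ∘ₗ envDivX k) = 0 :=
    ext_el (by simp [el_mul_el, envDivX_el, divX, coef_el, repr_mon])
      (by simp [el_mul_el, envDivX_el, divX])
  exact LinearMap.congr_fun this z

variable (k) in
/-- The element `x ⊗ 1 + ε (1 ⊗ x)`. -/
def dEnv (ε : k) : Env k (Plane k) := el (x k) 1 + ε • el 1 (x k)

variable (k) in
/-- The coefficient of the first generator in the differential of the second one. -/
def cEnv : Env k (Plane k) :=
  el (y k * y k) 1 - el 1 (y k * y k) - el (x k * y k) 1 - el 1 (y k * x k)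

variable (k) in
/-- The coefficient of `y` in the differential of `y²x`. -/
def fEnv : Env k (Plane k) :=
  el (y k) (x k) + el 1 (y k * x k) - el (x k * y k) 1 - el (x k) (y k) - el (x k) (x k)

/-- This and the following identities are the matrix entries of `d² = 0` in the resolution.
Transported by `envRightAct`, they become the relations between the operators on `A`. -/
theorem dEnv_mul_dEnv (ε : k) : dEnv k ε * dEnv k (-ε) = 0 := by
  simp only [dEnv, mul_add, add_mul, el_mul_el, x_mul_x, el_zero, zero_el, smul_mul_assoc,
    mul_smul_comm, mul_one, one_mul, smul_zero, env_neg_smul, env_mul_neg]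
  abel

theorem dEnv_neg_mul_dEnv (ε : k) : dEnv k (-ε) * dEnv k ε = 0 := by
  simpa only [neg_neg] using dEnv_mul_dEnv (-ε)

theorem cEnv_mul_dEnv (ε : k) : cEnv k * dEnv k ε = dEnv k ε * cEnv k := by
  simp only [cEnv, dEnv, mul_add, add_mul, mul_sub, sub_mul, el_mul_el, x_mul_x, el_zero, zero_el,
    smul_mul_assoc, mul_smul_comm, mul_one, one_mul, mul_assoc, y_mul_y_mul_x', x_mul_x_mul',
    el_add, add_el, smul_add, smul_sub, mul_zero, smul_zero]
  abel

theorem dEnv_mul_fEnv : dEnv k 1 * fEnv k = 0 := by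
  simp only [fEnv, dEnv, mul_add, add_mul, mul_sub, el_mul_el, x_mul_x, el_zero, zero_el,
    one_smul, mul_one, one_mul, mul_assoc, x_mul_x_mul', mul_zero]
  abel

theorem cEnv_mul_add_fEnv_mul :
    cEnv k * dEnv k (-1) + fEnv k * (el (y k) 1 - el 1 (y k)) = 0 := by
  simp only [cEnv, fEnv, dEnv, mul_add, add_mul, mul_sub, sub_mul, el_mul_el, x_mul_x, el_zero,
    zero_el, env_neg_smul, env_mul_neg, one_smul, mul_one, one_mul, mul_assoc, y_mul_y_mul_x',
    x_mul_x_mul', el_add, add_el, mul_zero]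
  abel

/-- Let `h` be `envDivX`, which commutes with right multiplication by `x ⊗ 1`. Applying it to `z (x
⊗ 1) + ε z (1 ⊗ x) = 0` and using the homotopy identity gives `z = h(z) (1 ⊗ x) - ε h(z) (x ⊗ 1)`,
which is `-ε h(z)` times `x ⊗ 1 - ε (1 ⊗ x)`. -/
theorem exists_eq_mul_dEnv (ε : k) (hε : ε * ε = 1) (z : Env k (Plane k))
    (hz : z * dEnv k ε = 0) : ∃ w, z = w * dEnv k (-ε) := by
  refine ⟨-ε • envDivX k z, ?_⟩
  have h := congrArg (envDivX k) hz
  have h2 := eq_sub_of_add_eq (envDivX_mul_add z)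
  rw [dEnv, mul_add, mul_smul_comm, map_add, map_smul, envDivX_mul_el_one, h2, map_zero] at h
  have h3 := congrArg (ε • ·) h
  simp only [smul_add, smul_smul, hε, smul_zero, one_smul] at h3
  rw [dEnv]
  simp only [mul_add, smul_mul_assoc, mul_smul_comm, smul_smul, env_neg_mul,
    env_mul_neg, hε, one_smul, env_neg_smul, env_smul_neg, neg_neg]
  rw [eq_neg_of_add_eq_zero_left h3]
  abel

theorem coef_inr_envDivX (z : Env k (Plane k)) (i c : ℕ) :
    coef (Sum.inr (i, c)) (envDivX k z) = 0 := by
  have : coef (Sum.inr (i, c)) ∘ₗ envDivX k = 0 :=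
    ext_el (by simp [envDivX_el, divX, el_zero]) (by simp [envDivX_el, divX, coef_el, repr_mon])
  exact LinearMap.congr_fun this z

/-- A normal form modulo multiples of `dEnv k 1`: no monomial divisible by `x` remains in the second
factor. The part `h(z) (x ⊗ 1)` creates none, since `h(z)` itself has none. -/
theorem coef_inr_sub_envDivX_mul (z : Env k (Plane k)) (i c : ℕ) :
    coef (Sum.inr (i, c)) (z - envDivX k z * dEnv k 1) = 0 := by
  have : z - envDivX k z * dEnv k 1 =
      (z - envDivX k z * el 1 (x k)) - envDivX k z * el (x k) 1 := by
    rw [dEnv, one_smul, mul_add]; abel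
  rw [this, map_sub, coef_inr_sub_envDivX, coef_mul_el_one, coef_inr_envDivX, zero_mul, sub_zero]

theorem coef_inl_mul_x (z : Env k (Plane k)) (i c : ℕ) :
    coef (Sum.inl (i, c)) (z * el 1 (x k)) = 0 := by
  have : coef (Sum.inl (i, c)) ∘ₗ LinearMap.mulRight k (el 1 (x k)) = 0 :=
    ext_el (by simp [el_mul_el, coef_el, repr_x_mul_mon])
      (by simp [el_mul_el, x_mul_x_mul', el_zero])
  exact LinearMap.congr_fun this z

theorem coef_inr_mul_x (z : Env k (Plane k)) (i c : ℕ) :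
    coef (Sum.inr (i, c)) (z * el 1 (x k)) = coef (Sum.inl (i, c)) z := by
  have : coef (Sum.inr (i, c)) ∘ₗ LinearMap.mulRight k (el 1 (x k)) = coef (Sum.inl (i, c)) := by
    refine ext_el (fun u j d => ?_)
      (by simp [el_mul_el, x_mul_x_mul', el_zero, coef_el, repr_x_mul_mon])
    by_cases h : j = i ∧ d = c <;>
      simp [el_mul_el, coef_el, repr_x_mul_mon, repr_mon, Finsupp.single_apply, h]
  exact LinearMap.congr_fun this z

theorem coef_inl_zero_succ_mul_y (z : Env k (Plane k)) (c : ℕ) :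
    coef (Sum.inl (0, c + 1)) (z * el 1 (y k)) = coef (Sum.inl (0, c)) z := by
  have : coef (Sum.inl (0, c + 1)) ∘ₗ LinearMap.mulRight k (el 1 (y k)) =
      coef (Sum.inl (0, c)) := by
    refine ext_el (fun u j d => ?_) (fun u j d => ?_)
    · rcases j with _ | j <;>
        simp [el_mul_el, coef_el, repr_mon, repr_x_mul_mon, y_mul_mon_zero, y_mul_mon_succ,
          Finsupp.single_apply]
    · simp [el_mul_el, coef_el, repr_mon, repr_x_mul_mon, y_mul_x_mul_mon]
  exact LinearMap.congr_fun this z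

theorem coef_inl_succ_mul_y (z : Env k (Plane k)) (i c : ℕ) :
    coef (Sum.inl (i + 1, c)) (z * el 1 (y k)) = coef (Sum.inr (i, c)) z := by
  have : coef (Sum.inl (i + 1, c)) ∘ₗ LinearMap.mulRight k (el 1 (y k)) =
      coef (Sum.inr (i, c)) := by
    refine ext_el (fun u j d => ?_) (fun u j d => ?_)
    · rcases j with _ | j <;>
        simp [el_mul_el, coef_el, repr_mon, repr_x_mul_mon, y_mul_mon_zero, y_mul_mon_succ]
    · simp [el_mul_el, coef_el, repr_mon, repr_x_mul_mon, y_mul_x_mul_mon, Finsupp.single_apply]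
  exact LinearMap.congr_fun this z

theorem coef_inr_mul_y (z : Env k (Plane k)) (i c : ℕ) :
    coef (Sum.inr (i, c)) (z * el 1 (y k)) = (i : k) • coef (Sum.inl (i, c)) z +
      if 2 ≤ c then coef (Sum.inl (i + 1, c - 2)) z else 0 := by
  have : coef (Sum.inr (i, c)) ∘ₗ LinearMap.mulRight k (el 1 (y k)) =
      (i : k) • coef (Sum.inl (i, c)) +
        if 2 ≤ c then coef (Sum.inl (i + 1, c - 2)) else 0 := by
    refine ext_el (fun u j d => ?_) (fun u j d => ?_)
    · rcases j with _ | j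
      · by_cases h : i = 0 <;> by_cases hc : 2 ≤ c <;>
        simp [el_mul_el, coef_el, repr_mon, y_mul_mon_zero, Finsupp.single_apply, hc, h, eq_comm]
      · have h3 : (j = i ∧ d + 2 = c) ↔ (2 ≤ c ∧ j = i ∧ d = c - 2) := by omega
        by_cases h1 : j + 1 = i ∧ d = c
        · obtain ⟨rfl, rfl⟩ := h1
          by_cases hc : 2 ≤ d <;>
            simp [el_mul_el, coef_el, repr_mon, repr_x_mul_mon, y_mul_mon_succ,
              Finsupp.single_apply, hc]
        · by_cases hc : 2 ≤ c <;>
            simp [el_mul_el, coef_el, repr_mon, repr_x_mul_mon, y_mul_mon_succ,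
              Finsupp.single_apply, hc, h1, h3]
    · by_cases hc : 2 ≤ c <;>
        simp [el_mul_el, coef_el, repr_mon, repr_x_mul_mon, y_mul_x_mul_mon, hc]
  rw [← LinearMap.mulRight_apply (R := k), ← LinearMap.comp_apply, this]
  split_ifs <;> simp

theorem mul_fEnv_el (u v : Plane k) : el u v * fEnv k = el (u * y k) (x k * v) +
    el u (y k * (x k * v)) - el (u * (x k * y k)) v - el (u * x k) (y k * v)
      - el (u * x k) (x k * v) := by
  simp only [fEnv, mul_add, mul_sub, el_mul_el, mul_one, one_mul, mul_assoc]

theorem coef_inl_succ_mul_fEnv (z : Env k (Plane k)) (i c : ℕ) :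
    coef (Sum.inl (i + 1, c)) (z * fEnv k) = coef (Sum.inl (i, c)) z -
      coef (Sum.inl (i + 1, c)) z * (x k * y k) - coef (Sum.inr (i, c)) z * x k := by
  have : coef (Sum.inl (i + 1, c)) ∘ₗ LinearMap.mulRight k (fEnv k) = coef (Sum.inl (i, c)) -
      LinearMap.mulRight k (x k * y k) ∘ₗ coef (Sum.inl (i + 1, c)) -
        LinearMap.mulRight k (x k) ∘ₗ coef (Sum.inr (i, c)) := by
    refine ext_el (fun u j d => ?_) (fun u j d => ?_)
    · rcases j with _ | j <;>
        simp [mul_fEnv_el, coef_el, repr_mon, repr_x_mul_mon, y_mul_mon_zero, y_mul_mon_succ,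
          y_mul_x_mul_mon, Finsupp.single_apply, mul_assoc, eq_comm]
    · simp [mul_fEnv_el, coef_el, repr_mon, repr_x_mul_mon, y_mul_x_mul_mon, x_mul_x_mul',
        Finsupp.single_apply]
  exact LinearMap.congr_fun this z

/-- After reduction modulo `dEnv k 1` only the coefficients at `tⁱ yᶜ` are left. For them `z * fEnv
k = 0` says that the coefficient at `i` is the one at `i + 1` times `xy`, and the latter vanishes
for large `i`. -/
theorem exists_eq_mul_dEnv_of_mul_fEnv (z : Env k (Plane k)) (hz : z * fEnv k = 0) :
    ∃ w, z = w * dEnv k 1 := by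
  refine ⟨envDivX k z, ?_⟩
  rw [← sub_eq_zero]
  set r := z - envDivX k z * dEnv k 1 with hr
  have h1 : ∀ i c, coef (Sum.inr (i, c)) r = 0 := coef_inr_sub_envDivX_mul z
  have hrF : r * fEnv k = 0 := by
    rw [hr, sub_mul, hz, mul_assoc, dEnv_mul_fEnv, mul_zero, sub_zero]
  refine eq_zero_of_coef r (fun i c => ?_) h1
  obtain ⟨n, hn⟩ := coef_finite r
  refine eq_zero_of_downward (fun i => coef (Sum.inl (i, c)) r) (fun a => a * (x k * y k))
    (zero_mul _) (fun i => ?_) n (fun i hi => (hn i c (by omega)).1) i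
  have := coef_inl_succ_mul_fEnv r i c
  rw [hrF, map_zero, h1, zero_mul, sub_zero] at this
  exact (sub_eq_zero.1 this.symm)

/-- In `(u ⊗ v) * fEnv k` with `v = tⁱ yᶜ` the term `u ⊗ yxv` is `u ⊗ tⁱ⁺¹ yᶜ`, and the other terms
involve lower powers of `t`, pure powers of `y`, or monomials divisible by `x`. Induction on `i`
therefore removes every `tⁱ⁺¹ yᶜ` modulo multiples of `fEnv k`. -/
theorem exists_sub_mul_fEnv (z : Env k (Plane k)) :
    ∃ w, ∀ i c, coef (Sum.inl (i + 1, c)) (z - w * fEnv k) = 0 := by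
  let N : Submodule k (Env k (Plane k)) := ⨅ i, ⨅ c, LinearMap.ker (coef (Sum.inl (i + 1, c)))
  let S := LinearMap.range (LinearMap.mulRight k (fEnv k)) ⊔ N
  have hN : ∀ z, z ∈ N ↔ ∀ i c, coef (Sum.inl (i + 1, c)) z = 0 := by
    simp [N, Submodule.mem_iInf]
  have h1 : ∀ u i c, el u (x k * mon k i c) ∈ S := fun u i c => by
    refine (le_sup_right : N ≤ S) ((hN _).2 fun j d => ?_)
    simp [coef_el, repr_x_mul_mon]
  have h0 : ∀ i u c, el u (mon k i c) ∈ S := by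
    have hy : ∀ u c, el u (mon k 0 c) ∈ S := fun u c => by
      refine (le_sup_right : N ≤ S) ((hN _).2 fun j d => ?_)
      simp [coef_el, repr_mon]
    intro i
    induction i with
    | zero => exact hy
    | succ i ih =>
      intro u c
      have h := mul_fEnv_el u (mon k i c)
      rw [y_mul_x_mul_mon] at h
      have h' : el u (mon k (i + 1) c) = el u (mon k i c) * fEnv k -
          el (u * y k) (x k * mon k i c) + el (u * (x k * y k)) (mon k i c) +
          el (u * x k) (y k * mon k i c) + el (u * x k) (x k * mon k i c) := by
        rw [h]; abel
      rw [h']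
      refine S.add_mem (S.add_mem (S.add_mem (S.sub_mem ?_ (h1 _ _ _)) (ih _ _)) ?_) (h1 _ _ _)
      · exact (le_sup_left : _ ≤ S) ⟨_, rfl⟩
      · rcases i with _ | i
        · rw [y_mul_mon_zero]; exact hy _ _
        · rw [y_mul_mon_succ, el_add, el_smul]
          exact S.add_mem (h1 _ _ _) (S.smul_mem _ (h1 _ _ _))
  obtain ⟨_, ⟨w, rfl⟩, n, hn, h⟩ := Submodule.mem_sup.1 (mem_of_el S (fun u i c => h0 i u c) h1 z)
  refine ⟨w, (hN _).1 ?_⟩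
  rw [← h]
  simpa using hn

/-- Comparing coefficients at `x tⁱ yᶜ` expresses `a` through `b`; at `tⁱ⁺¹ yᶜ` and at `yᶜ⁺¹` it
gives downward recursions for the two remaining kinds of coefficients of `b`. Finite support forces
all of them to vanish. -/
theorem eq_zero_of_reduced (a b : Env k (Plane k))
    (h : a * dEnv k (-1) + b * (el (y k) 1 - el 1 (y k)) = 0)
    (ha : ∀ i c, coef (Sum.inr (i, c)) a = 0) (hb : ∀ i c, coef (Sum.inl (i + 1, c)) b = 0) :
    a = 0 ∧ b = 0 := by
  have hm : ∀ j, coef j a * x k - coef j (a * el 1 (x k)) +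
      (coef j b * y k - coef j (b * el 1 (y k))) = 0 := fun j => by
    have := congrArg (coef j) h
    rwa [dEnv, env_neg_smul, one_smul, ← sub_eq_add_neg, mul_sub, mul_sub, map_add, map_sub,
      map_sub, coef_mul_el_one, coef_mul_el_one, map_zero] at this
  have e1 : ∀ i c, coef (Sum.inl (i, c)) a = coef (Sum.inr (i, c)) b * y k := fun i c => by
    have := hm (Sum.inr (i, c))
    rw [ha, coef_inr_mul_x, coef_inr_mul_y, hb, ite_self, add_zero] at this
    have hi : (i : k) • coef (Sum.inl (i, c)) b = 0 := by
      rcases i with _ | i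
      · simp
      · rw [hb, smul_zero]
    rw [hi, zero_mul, zero_sub, sub_zero, neg_add_eq_zero] at this
    exact this
  have e2 : ∀ i c, coef (Sum.inr (i, c)) b = coef (Sum.inr (i + 1, c)) b * y k * x k :=
    fun i c => by
      have := hm (Sum.inl (i + 1, c))
      rw [coef_inl_mul_x, coef_inl_succ_mul_y, hb, e1, zero_mul, sub_zero, zero_sub,
        ← sub_eq_add_neg] at this
      exact (sub_eq_zero.1 this).symm
  obtain ⟨n, hn⟩ := coef_finite b
  have b1 : ∀ i c, coef (Sum.inr (i, c)) b = 0 := fun i c =>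
    eq_zero_of_downward (fun i => coef (Sum.inr (i, c)) b) (fun z => z * y k * x k)
      (by simp) (fun i => e2 i c) n (fun i hi => (hn i c (by omega)).2) i
  have a0 : ∀ i c, coef (Sum.inl (i, c)) a = 0 := fun i c => by rw [e1, b1, zero_mul]
  have b0 : ∀ c, coef (Sum.inl (0, c)) b = 0 := fun c => by
    refine eq_zero_of_downward (fun c => coef (Sum.inl (0, c)) b) (fun z => z * y k)
      (by simp) (fun c => ?_) n (fun c hc => (hn 0 c (by omega)).1) c
    have := hm (Sum.inl (0, c + 1))
    rw [coef_inl_mul_x, coef_inl_zero_succ_mul_y, a0, zero_mul, sub_zero, zero_add] at this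
    exact (sub_eq_zero.1 this).symm
  refine ⟨eq_zero_of_coef a a0 ha, eq_zero_of_coef b (fun i c => ?_) b1⟩
  rcases i with _ | i
  exacts [b0 c, hb i c]

end Env

/-! ### Exactness of the resolution. -/

section Exactness

variable (k : Type*) [Field k]

theorem resD_zero_apply (v : Res k 1) (g : Gen 0) : resD k 0 v g =
    v 0 * dEnv k (-1) + v 1 * (el (y k) 1 - el 1 (y k)) := by
  have h : resD k 0 v g = ∑ i : Fin 2, v i *
      (![el (x k) 1 - el 1 (x k), el (y k) 1 - el 1 (y k)] : Fin 2 → _) i := by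
    simp [resD, coeff]
  rw [h, Fin.sum_univ_two, dEnv, env_neg_smul, one_smul, ← sub_eq_add_neg]
  rfl

theorem resD_one_apply_zero (v : Res k 2) :
    resD k 1 v (0 : Fin 2) = v 0 * dEnv k 1 + v 1 * cEnv k := by
  simp [resD, coeff, cEnv, dEnv]

theorem resD_one_apply_one (v : Res k 2) :
    resD k 1 v (1 : Fin 2) = v 1 * fEnv k := by
  simp [resD, coeff, fEnv]

theorem resD_apply_zero (n : ℕ) (v : Res k (n + 3)) :
    resD k (n + 2) v (0 : Fin 2) = v 0 * dEnv k ((-1) ^ (n + 3)) + v 1 * cEnv k := by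
  have : cEnv k = el (y k * y k) 1 - el (x k * y k) 1 - el 1 (y k * y k) - el 1 (y k * x k) := by
    rw [cEnv]; abel
  rw [this]
  simp [resD, coeff, dEnv]

theorem resD_apply_one (n : ℕ) (v : Res k (n + 3)) :
    resD k (n + 2) v (1 : Fin 2) = -(v 1 * dEnv k (-(-1) ^ (n + 3))) := by
  have : -dEnv k (-(-1) ^ (n + 3)) = (-1 : k) ^ (n + 3) • el 1 (x k) - el (x k) 1 := by
    rw [dEnv, env_neg_smul]; abel
  rw [← env_mul_neg, this]
  simp [resD, coeff]

theorem neg_one_pow_mul_self (n : ℕ) : (-1 : k) ^ n * (-1) ^ n = 1 := by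
  rw [← mul_pow]; simp

theorem resD_resD (n : ℕ) (v : Res k (n + 2)) : resD k n (resD k (n + 1) v) = 0 := by
  rcases n with _ | _ | n
  · funext g
    rw [resD_zero_apply, resD_one_apply_zero, resD_one_apply_one, add_mul, mul_assoc, mul_assoc,
      mul_assoc, add_assoc, ← mul_add, cEnv_mul_add_fEnv_mul, dEnv_mul_dEnv]
    simp
  · funext g
    fin_cases g
    · refine (resD_one_apply_zero k _).trans ?_
      rw [resD_apply_zero, resD_apply_one, add_mul, mul_assoc, mul_assoc, cEnv_mul_dEnv,
        env_neg_mul, mul_assoc]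
      norm_num
      rw [dEnv_neg_mul_dEnv, mul_zero]
    · refine (resD_one_apply_one k _).trans ?_
      rw [resD_apply_one]
      norm_num [env_neg_mul, mul_assoc, dEnv_mul_fEnv]
  · have h : (-1 : k) ^ (n + 1 + 3) = -(-1) ^ (n + 3) := by rw [pow_succ]; ring
    funext g
    fin_cases g
    · refine (resD_apply_zero k n _).trans ?_
      rw [resD_apply_zero k (n + 1), resD_apply_one k (n + 1), add_mul, mul_assoc, mul_assoc,
        cEnv_mul_dEnv, env_neg_mul, mul_assoc, h, neg_neg]
      rw [dEnv_neg_mul_dEnv, mul_zero, zero_add, add_neg_cancel]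
      rfl
    · refine (resD_apply_one k n _).trans ?_
      rw [resD_apply_one k (n + 1), h, env_neg_mul, mul_assoc, neg_neg, neg_neg ((-1 : k) ^ (n + 3)),
        dEnv_mul_dEnv, mul_zero]
      rfl

/-- The differential is triangular and `cEnv` commutes with `dEnv`. Substituting `v 1 = w d` turns
the first equation into `(v 0 + w c) d = 0`, to which `exists_eq_mul_dEnv` applies. -/
theorem mem_range_resD (n : ℕ) (ε : k) (hε : ε * ε = 1) (h : (-1) ^ (n + 3) = -ε)
    (v : Res k (n + 2)) (w : Env k (Plane k)) (h1 : v 1 = w * dEnv k ε)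
    (h0 : v 0 * dEnv k ε + v 1 * cEnv k = 0) : v ∈ LinearMap.range (resD k (n + 2)) := by
  rw [h1, mul_assoc, ← cEnv_mul_dEnv, ← mul_assoc, ← add_mul] at h0
  obtain ⟨w', hw'⟩ := exists_eq_mul_dEnv ε hε _ h0
  refine ⟨![w', -w], ?_⟩
  funext g
  fin_cases g
  · refine (resD_apply_zero k n _).trans ?_
    rw [h]
    change w' * _ + -w * _ = v 0
    rw [env_neg_mul, ← hw']
    abel
  · refine (resD_apply_one k n _).trans ?_
    rw [h, neg_neg]
    change -(-w * _) = v 1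
    rw [env_neg_mul, neg_neg, h1]

theorem ker_resD_le (n : ℕ) (v : Res k (n + 1)) (hv : resD k n v = 0) :
    v ∈ LinearMap.range (resD k (n + 1)) := by
  rcases n with _ | _ | n
  -- In degree 1, subtract boundaries until both components are in normal form. The boundary of `x²`
  -- has no component at `y`, so the second subtraction preserves the first normalization.
  · obtain ⟨w, hw⟩ := exists_sub_mul_fEnv (v 1)
    set v' : Res k 1 := v - resD k 1 ![0, w] with hv'
    set v'' : Res k 1 := v' - resD k 1 ![envDivX k (v' 0), 0] with hv''
    have hk : resD k 0 v'' = 0 := by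
      rw [hv'', hv', map_sub, map_sub, resD_resD, resD_resD, hv, sub_zero, sub_zero]
    have e1 : v'' 1 = v 1 - w * fEnv k := by
      rw [hv'', Pi.sub_apply, resD_one_apply_one, hv', Pi.sub_apply, resD_one_apply_one]
      simp
    have e0 : v'' 0 = v' 0 - envDivX k (v' 0) * dEnv k 1 := by
      rw [hv'', Pi.sub_apply, resD_one_apply_zero]
      simp
    have := congrFun hk ()
    rw [resD_zero_apply] at this
    obtain ⟨h0, h1⟩ := eq_zero_of_reduced _ _ this
      (by rw [e0]; exact coef_inr_sub_envDivX_mul _) (by rw [e1]; exact hw)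
    have hz : v'' = 0 := by
      funext g
      fin_cases g
      exacts [h0, h1]
    refine ⟨![0, w] + ![envDivX k (v' 0), 0], ?_⟩
    rw [map_add]
    rw [hv'', sub_eq_zero] at hz
    rw [← hz, hv']
    abel
  · have h0 := congrFun hv (0 : Fin 2)
    have h1 := congrFun hv (1 : Fin 2)
    rw [resD_one_apply_zero] at h0
    rw [resD_one_apply_one] at h1
    obtain ⟨w, hw⟩ := exists_eq_mul_dEnv_of_mul_fEnv _ h1
    exact mem_range_resD k 0 1 (by ring) (by ring) v w hw h0
  · have h0 := congrFun hv (0 : Fin 2)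
    have h1 := congrFun hv (1 : Fin 2)
    rw [resD_apply_zero] at h0
    rw [resD_apply_one] at h1
    obtain ⟨w, hw⟩ := exists_eq_mul_dEnv (-(-1) ^ (n + 3))
      (by rw [neg_mul_neg, neg_one_pow_mul_self]) _ (neg_eq_zero.1 h1)
    rw [neg_neg] at hw
    exact mem_range_resD k (n + 1) ((-1) ^ (n + 3)) (neg_one_pow_mul_self k _)
      (by rw [pow_succ]; ring) v w hw h0

theorem envMul_el (u v : Plane k) : envMul k (Plane k) (el u v) = u * v := by
  simp [envMul, el]

/-- Modulo boundaries `u ⊗ v ≡ 1 ⊗ uv`. The `u` with this property for all `v` form a subspace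
containing `1` and stable under left multiplication by the generators. -/
theorem ker_envMul_le (v : Res k 0) (hv : envMul k (Plane k) (v ()) = 0) :
    v ∈ LinearMap.range (resD k 0) := by
  have hx : ∀ z : Env k (Plane k), (fun _ => z * (el (x k) 1 - el 1 (x k))) ∈
      LinearMap.range (resD k 0) := fun z => by
    refine ⟨![z, 0], ?_⟩
    funext g
    rw [resD_zero_apply, dEnv, env_neg_smul, one_smul, ← sub_eq_add_neg]
    simp
  have hy : ∀ z : Env k (Plane k), (fun _ => z * (el (y k) 1 - el 1 (y k))) ∈
      LinearMap.range (resD k 0) := fun z => by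
    refine ⟨![0, z], ?_⟩
    funext g
    rw [resD_zero_apply]
    simp
  let S : Submodule k (Plane k) :=
    { carrier := {u | ∀ v, (fun _ => el u v - el 1 (u * v)) ∈ LinearMap.range (resD k 0)}
      zero_mem' := fun v => by
        simp only [zero_el, zero_mul, el_zero, sub_zero]
        exact Submodule.zero_mem _
      add_mem' := fun {a b} ha hb v => by
        convert Submodule.add_mem _ (ha v) (hb v) using 1
        funext g
        simp only [add_el, add_mul, el_add, Pi.add_apply]
        abel
      smul_mem' := fun c a ha v => by
        convert Submodule.smul_mem _ (algebraMap k (Env k (Plane k)) c) (ha v) using 1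
        funext g
        simp only [smul_el, smul_mul_assoc, el_smul, Pi.smul_apply, smul_eq_mul,
          ← Algebra.smul_def, smul_sub] }
  have step : ∀ g : Plane k, (∀ z : Env k (Plane k), (fun _ => z * (el g 1 - el 1 g)) ∈
      LinearMap.range (resD k 0)) → ∀ a ∈ S, g * a ∈ S := by
    intro g hg a ha v
    -- `ga ⊗ v - 1 ⊗ gav = (g ⊗ 1)(a ⊗ v - 1 ⊗ av) + (g ⊗ av - 1 ⊗ gav)`.
    convert Submodule.add_mem _ (Submodule.smul_mem _ (el g 1) (ha v)) (hg (el 1 (a * v))) using 1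
    funext i
    simp only [Pi.add_apply, Pi.smul_apply, smul_eq_mul, mul_sub, el_mul_el, one_mul, mul_one,
      mul_assoc]
    abel
  have hS : ∀ u, u ∈ S := fun u => by
    rw [← mul_one u]
    refine mul_mem_of_generators k S (step _ hx) (step _ hy) u 1 fun v => ?_
    simp only [one_mul, sub_self]
    exact Submodule.zero_mem _
  have key : ∀ z : Env k (Plane k), (fun _ => z - el 1 (envMul k (Plane k) z)) ∈
      LinearMap.range (resD k 0) := by
    intro z
    induction z using TensorProduct.induction_on with
    | zero => simp only [map_zero, el_zero, sub_zero]; exact Submodule.zero_mem _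
    | add a b ha hb =>
      convert Submodule.add_mem _ ha hb using 1
      funext g
      simp only [map_add, el_add, Pi.add_apply]
      abel
    | tmul u v =>
      have := hS u v.unop
      rwa [← envMul_el] at this
  have := key (v ())
  rwa [hv, el_zero, sub_zero] at this

end Exactness

end SuperJordan

namespace Hochschild

/-! ### Exactness of the bar resolution. -/

section Bar

variable {k : Type*} [CommRing k] {A : Type*} [Ring A] [Algebra k A]

theorem innerFace_apply (n : ℕ) (j : Fin n) (a : Fin (n + 1) → A) :
    innerFace k A n j a = PiTensorProduct.tprod k (Fin.contractNth j.castSucc (· * ·) a) := rfl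

theorem boundary_tmul {M : Type*} [AddCommGroup M] [Module k M]
    (ρ lam : A →ₗ[k] Module.End k M) (n : ℕ) (m : M) (a : Fin (n + 1) → A) :
    boundary ρ lam n (m ⊗ₜ PiTensorProduct.tprod k a) =
      ρ (a 0) m ⊗ₜ PiTensorProduct.tprod k (Fin.tail a)
      + ∑ j : Fin n, (-1 : k) ^ (j.val + 1) •
          (m ⊗ₜ PiTensorProduct.tprod k (Fin.contractNth j.castSucc (· * ·) a))
      + (-1 : k) ^ (n + 1) •
          (lam (a (Fin.last n)) m ⊗ₜ PiTensorProduct.tprod k (Fin.init a)) := by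
  simp [boundary, boundaryMultilinear, innerFace_apply]

theorem barD_tmul (n : ℕ) (e : Env k A) (a : Fin (n + 1) → A) :
    barD k A n (e ⊗ₜ PiTensorProduct.tprod k a) =
      (e * (a 0 ⊗ₜ 1)) ⊗ₜ PiTensorProduct.tprod k (Fin.tail a)
      + ∑ j : Fin n, (-1 : k) ^ (j.val + 1) •
          (e ⊗ₜ PiTensorProduct.tprod k (Fin.contractNth j.castSucc (· * ·) a))
      + (-1 : k) ^ (n + 1) • ((e * (1 ⊗ₜ MulOpposite.op (a (Fin.last n)))) ⊗ₜ
          PiTensorProduct.tprod k (Fin.init a)) := by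
  rw [barD, boundary_tmul]
  rfl

theorem chainsD_tmul (n : ℕ) (b : A) (a : Fin (n + 1) → A) :
    chainsD k A n (b ⊗ₜ PiTensorProduct.tprod k a) =
      (b * a 0) ⊗ₜ PiTensorProduct.tprod k (Fin.tail a)
      + ∑ j : Fin n, (-1 : k) ^ (j.val + 1) •
          (b ⊗ₜ PiTensorProduct.tprod k (Fin.contractNth j.castSucc (· * ·) a))
      + (-1 : k) ^ (n + 1) •
          ((a (Fin.last n) * b) ⊗ₜ PiTensorProduct.tprod k (Fin.init a)) := by
  rw [chainsD, boundary_tmul]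
  rfl

theorem bar_induction {n : ℕ} (S : Submodule k (Bar k A n))
    (h : ∀ (u v : A) (a : Fin n → A),
      ((u ⊗ₜ MulOpposite.op v : Env k A) ⊗ₜ PiTensorProduct.tprod k a : Bar k A n) ∈ S)
    (z : Bar k A n) : z ∈ S := by
  induction z using TensorProduct.induction_on with
  | zero => exact S.zero_mem
  | add a b ha hb => exact S.add_mem ha hb
  | tmul e w =>
    induction w using PiTensorProduct.induction_on with
    | add a b ha hb => rw [TensorProduct.tmul_add]; exact S.add_mem ha hb
    | smul_tprod r a =>
      rw [TensorProduct.tmul_smul]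
      refine S.smul_mem r ?_
      induction e using TensorProduct.induction_on with
      | zero => rw [TensorProduct.zero_tmul]; exact S.zero_mem
      | add a b ha hb => rw [TensorProduct.add_tmul]; exact S.add_mem ha hb
      | tmul u v => exact h u v.unop a

theorem bar_ext {n : ℕ} {M : Type*} [AddCommMonoid M] [Module k M] {f g : Bar k A n →ₗ[k] M}
    (h : ∀ (u v : A) (a : Fin n → A),
      f ((u ⊗ₜ MulOpposite.op v : Env k A) ⊗ₜ PiTensorProduct.tprod k a) =
        g ((u ⊗ₜ MulOpposite.op v : Env k A) ⊗ₜ PiTensorProduct.tprod k a))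
    (z : Bar k A n) : f z = g z :=
  bar_induction (LinearMap.eqLocus f g) h z

theorem barD_smul (n : ℕ) (r : Env k A) (z : Bar k A (n + 1)) :
    barD k A n (r • z) = r • barD k A n z := by
  refine bar_ext (f := barD k A n ∘ₗ Algebra.lsmul k k _ r)
    (g := Algebra.lsmul k k _ r ∘ₗ barD k A n) (fun u v a => ?_) z
  have hr : ∀ (n : ℕ) (e : Env k A) (w : ⨂[k]^n A), r • (e ⊗ₜ w : Bar k A n) = (r * e) ⊗ₜ w :=
    fun _ _ _ => rfl
  simp only [LinearMap.comp_apply, Algebra.lsmul_coe, hr, barD_tmul, smul_add, Finset.smul_sum,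
    smul_comm r, mul_assoc]

variable (k A) in
/-- The differential of the bar resolution as a map of bimodules. -/
def barDLinear (n : ℕ) : Bar k A (n + 1) →ₗ[Env k A] Bar k A n :=
  { barD k A n with map_smul' := barD_smul n }

variable (k A) in
/-- Adding an entry in front of an elementary tensor. -/
def consTensor (n : ℕ) : A →ₗ[k] (⨂[k]^n A) →ₗ[k] (⨂[k]^(n + 1) A) :=
  PiTensorProduct.lift.toLinearMap ∘ₗ
    (PiTensorProduct.tprod k (s := fun _ : Fin (n + 1) => A)).curryLeft

theorem consTensor_tprod (n : ℕ) (u : A) (a : Fin n → A) :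
    consTensor k A n u (PiTensorProduct.tprod k a) =
      PiTensorProduct.tprod k (Fin.cons u a : Fin (n + 1) → A) := by
  simp [consTensor]

variable (k A) in
/-- The contracting homotopy `u ⊗ a₁ ⊗ ⋯ ⊗ v ↦ 1 ⊗ u ⊗ a₁ ⊗ ⋯ ⊗ v` of the bar resolution. -/
def barHomotopy (n : ℕ) : Bar k A n →ₗ[k] Bar k A (n + 1) :=
  TensorProduct.map (Algebra.TensorProduct.includeRight : Aᵐᵒᵖ →ₐ[k] Env k A).toLinearMap
      (TensorProduct.lift (consTensor k A n)) ∘ₗ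
    (TensorProduct.assoc k Aᵐᵒᵖ A (⨂[k]^n A)).toLinearMap ∘ₗ
      TensorProduct.map (TensorProduct.comm k A Aᵐᵒᵖ).toLinearMap LinearMap.id

theorem barHomotopy_tmul (n : ℕ) (u : A) (v : Aᵐᵒᵖ) (a : Fin n → A) :
    barHomotopy k A n ((u ⊗ₜ v : Env k A) ⊗ₜ PiTensorProduct.tprod k a) =
      ((1 ⊗ₜ v : Env k A)) ⊗ₜ PiTensorProduct.tprod k (Fin.cons u a : Fin (n + 1) → A) := by
  simp [barHomotopy, consTensor_tprod]

theorem contractNth_zero_cons (n : ℕ) (u : A) (a : Fin (n + 1) → A) :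
    Fin.contractNth 0 (· * ·) (Fin.cons u a : Fin (n + 2) → A) =
      (Fin.cons (u * a 0) (Fin.tail a) : Fin (n + 1) → A) := by
  funext i
  refine Fin.cases ?_ (fun i => ?_) i
  · simp [Fin.contractNth]
  · simp [Fin.contractNth, Fin.tail]

theorem contractNth_succ_cons (n : ℕ) (j : Fin (n + 1)) (u : A) (a : Fin (n + 1) → A) :
    Fin.contractNth j.succ (· * ·) (Fin.cons u a : Fin (n + 2) → A) =
      (Fin.cons u (Fin.contractNth j (· * ·) a) : Fin (n + 1) → A) := by
  funext i
  refine Fin.cases ?_ (fun i => ?_) i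
  · simp [Fin.contractNth]
  · simp only [Fin.contractNth, Fin.val_succ, Fin.cons_succ, add_lt_add_iff_right,
      add_left_inj, ← Fin.succ_castSucc]

/-- The first face of `1 ⊗ u ⊗ a₁ ⊗ ⋯` restores the original tensor. Every other face is the
homotopy applied to a face of the original, shifted by one index and hence with the opposite sign.
-/
theorem barD_barHomotopy (n : ℕ) (z : Bar k A (n + 1)) :
    barD k A (n + 1) (barHomotopy k A (n + 1) z) + barHomotopy k A n (barD k A n z) = z := by
  refine bar_ext (f := barD k A (n + 1) ∘ₗ barHomotopy k A (n + 1) +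
    barHomotopy k A n ∘ₗ barD k A n) (g := LinearMap.id) (fun u v a => ?_) z
  simp only [LinearMap.add_apply, LinearMap.comp_apply, LinearMap.id_apply]
  rw [barHomotopy_tmul, barD_tmul, barD_tmul, Fin.sum_univ_succ]
  simp only [map_add, map_sum, map_smul, Algebra.TensorProduct.tmul_mul_tmul, one_mul, mul_one,
    barHomotopy_tmul, Fin.cons_zero, Fin.tail_cons, Fin.castSucc_zero, contractNth_zero_cons,
    ← Fin.succ_castSucc, contractNth_succ_cons, Fin.val_succ, Fin.val_zero]
  have hl : (Fin.cons u a : Fin (n + 2) → A) (Fin.last (n + 1)) = a (Fin.last n) := by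
    rw [← Fin.succ_last, Fin.cons_succ]
  have hi : Fin.init (Fin.cons u a : Fin (n + 2) → A) = Fin.cons u (Fin.init a) := by
    funext i
    refine Fin.cases ?_ (fun i => ?_) i
    · simp [Fin.init]
    · simp [Fin.init, ← Fin.succ_castSucc]
  have hs : ∀ (m : ℕ) (b : Bar k A (n + 1)), (-1 : k) ^ (m + 1) • b + (-1 : k) ^ m • b = 0 :=
    fun m b => by rw [← add_smul, pow_succ]; simp
  rw [hl, hi]
  set X : Bar k A (n + 1) := (1 ⊗ₜ MulOpposite.op v : Env k A) ⊗ₜ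
    PiTensorProduct.tprod k (Fin.cons (u * a 0) (Fin.tail a) : Fin (n + 1) → A)
  set Y : Fin n → Bar k A (n + 1) := fun j => (1 ⊗ₜ MulOpposite.op v : Env k A) ⊗ₜ
    PiTensorProduct.tprod k (Fin.cons u (Fin.contractNth j.castSucc (· * ·) a) :
      Fin (n + 1) → A)
  set Z : Bar k A (n + 1) :=
    (1 ⊗ₜ (MulOpposite.op v * MulOpposite.op (a (Fin.last n))) : Env k A) ⊗ₜ
      PiTensorProduct.tprod k (Fin.cons u (Fin.init a) : Fin (n + 1) → A)
  set W : Bar k A (n + 1) := (u ⊗ₜ MulOpposite.op v : Env k A) ⊗ₜ PiTensorProduct.tprod k a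
  calc W + ((-1 : k) ^ (0 + 1) • X + ∑ j, (-1 : k) ^ (j.val + 1 + 1) • Y j) +
        (-1 : k) ^ (n + 1 + 1) • Z +
        (X + ∑ j, (-1 : k) ^ (j.val + 1) • Y j + (-1 : k) ^ (n + 1) • Z)
      = W + ((-1 : k) ^ (0 + 1) • X + (-1 : k) ^ 0 • X) +
        ∑ j, ((-1 : k) ^ (j.val + 1 + 1) • Y j + (-1 : k) ^ (j.val + 1) • Y j) +
        ((-1 : k) ^ (n + 1 + 1) • Z + (-1 : k) ^ (n + 1) • Z) := by
          rw [Finset.sum_add_distrib, pow_zero, one_smul]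
          ac_rfl
    _ = W := by simp only [hs, Finset.sum_const_zero, add_zero]

theorem barD_barHomotopy_eq_sub (n : ℕ) (z : Bar k A (n + 1)) :
    barD k A (n + 1) (barHomotopy k A (n + 1) z) = z - barHomotopy k A n (barD k A n z) := by
  rw [eq_sub_iff_add_eq]
  exact barD_barHomotopy n z

variable (k A) in
/-- The bimodule map `A ⊗ A → Bar 0` identifying the augmented modules. -/
def toBarZero : Env k A →ₗ[Env k A] Bar k A 0 :=
  LinearMap.toSpanSingleton (Env k A) (Bar k A 0) (1 ⊗ₜ PiTensorProduct.tprod k Fin.elim0)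

theorem barAug_tmul (e : Env k A) (a : Fin 0 → A) :
    barAug k A (e ⊗ₜ PiTensorProduct.tprod k a) = envMul k A e := by
  simp [barAug]

theorem barAug_toBarZero (e : Env k A) : barAug k A (toBarZero k A e) = envMul k A e := by
  rw [toBarZero, LinearMap.toSpanSingleton_apply, TensorProduct.smul_tmul', smul_eq_mul, mul_one,
    barAug_tmul]

theorem barD_barHomotopy_zero (z : Bar k A 0) :
    barD k A 0 (barHomotopy k A 0 z) +
      toBarZero k A (1 ⊗ₜ MulOpposite.op (barAug k A z)) = z := by
  refine bar_ext (f := barD k A 0 ∘ₗ barHomotopy k A 0 +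
    (toBarZero k A).restrictScalars k ∘ₗ
      (Algebra.TensorProduct.includeRight : Aᵐᵒᵖ →ₐ[k] Env k A).toLinearMap ∘ₗ
      (MulOpposite.opLinearEquiv k : A ≃ₗ[k] Aᵐᵒᵖ).toLinearMap ∘ₗ barAug k A) (g := LinearMap.id)
    (fun u v a => ?_) z
  simp only [LinearMap.add_apply, LinearMap.comp_apply, LinearMap.id_apply,
    LinearMap.restrictScalars_apply, AlgHom.toLinearMap_apply, LinearEquiv.coe_coe,
    MulOpposite.coe_opLinearEquiv, Algebra.TensorProduct.includeRight_apply]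
  have hr : ∀ (e : Env k A) (w : ⨂[k]^0 A), e • (1 ⊗ₜ w : Bar k A 0) = e ⊗ₜ w :=
    fun e w => congrArg (· ⊗ₜ w) (mul_one e)
  rw [barHomotopy_tmul, barD_tmul, barAug_tmul, toBarZero, LinearMap.toSpanSingleton_apply, hr]
  have h0 : (Fin.cons u a : Fin 1 → A) (Fin.last 0) = u := rfl
  have h1 : Fin.init (Fin.cons u a : Fin 1 → A) = a := Subsingleton.elim _ _
  have h2 : (Fin.elim0 : Fin 0 → A) = a := Subsingleton.elim _ _
  have hs : ∀ b : Bar k A 0, (-1 : k) • b + b = 0 := fun b => by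
    nth_rewrite 2 [← one_smul k b]
    rw [← add_smul, neg_add_cancel, zero_smul]
  rw [h0, h1, h2]
  simp [envMul, Algebra.TensorProduct.tmul_mul_tmul, add_assoc, hs]

theorem barAug_barD (z : Bar k A 1) : barAug k A (barD k A 0 z) = 0 := by
  refine bar_ext (f := barAug k A ∘ₗ barD k A 0) (g := 0) (fun u v a => ?_) z
  rw [LinearMap.comp_apply, barD_tmul]
  simp [barAug_tmul, envMul, Algebra.TensorProduct.tmul_mul_tmul, mul_assoc]

/-- No double sum over faces is needed. The image of the homotopy `s` generates the bimodule, and on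
it `d d s z = d z - d s (d z)`; this vanishes by the homotopy identity one degree lower together
with `d d = 0` there, or with the augmentation at the start. -/
theorem barD_barD (n : ℕ) (z : Bar k A (n + 2)) : barD k A n (barD k A (n + 1) z) = 0 := by
  have gen : ∀ (n : ℕ), (∀ z : Bar k A (n + 1),
      barD k A n (barD k A (n + 1) (barHomotopy k A (n + 1) z)) = 0) →
      ∀ z : Bar k A (n + 2), barD k A n (barD k A (n + 1) z) = 0 := by
    intro n h z
    refine bar_ext (f := barD k A n ∘ₗ barD k A (n + 1)) (g := 0) (fun u v a => ?_) z
    rw [LinearMap.comp_apply, LinearMap.zero_apply]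
    have e : ((u ⊗ₜ MulOpposite.op v : Env k A) ⊗ₜ PiTensorProduct.tprod k a : Bar k A (n + 2)) =
        (u ⊗ₜ MulOpposite.op v : Env k A) • barHomotopy k A (n + 1)
          ((a 0 ⊗ₜ 1 : Env k A) ⊗ₜ PiTensorProduct.tprod k (Fin.tail a)) := by
      rw [barHomotopy_tmul, TensorProduct.smul_tmul', Fin.cons_self_tail, smul_eq_mul,
        Algebra.TensorProduct.tmul_mul_tmul, mul_one, mul_one]
    rw [e, barD_smul, barD_smul, h, smul_zero]
  induction n with
  | zero =>
    refine gen 0 (fun z => ?_) z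
    have h1 := barD_barHomotopy_zero (barD k A 0 z)
    rw [barAug_barD, MulOpposite.op_zero, TensorProduct.tmul_zero, map_zero, add_zero] at h1
    rw [barD_barHomotopy_eq_sub, map_sub, h1, sub_self]
  | succ n ih =>
    refine gen (n + 1) (fun z => ?_) z
    have h1 := barD_barHomotopy n (barD k A (n + 1) z)
    rw [ih, map_zero, add_zero] at h1
    rw [barD_barHomotopy_eq_sub, map_sub, h1, sub_self]

theorem ker_barD_le (n : ℕ) (z : Bar k A (n + 1)) (hz : barD k A n z = 0) :
    z ∈ LinearMap.range (barDLinear k A (n + 1)) := by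
  refine ⟨barHomotopy k A (n + 1) z, ?_⟩
  have h := barD_barHomotopy n z
  rwa [hz, map_zero, add_zero] at h

theorem ker_barAug_le (z : Bar k A 0) (hz : barAug k A z = 0) :
    z ∈ LinearMap.range (barDLinear k A 0) := by
  refine ⟨barHomotopy k A 0 z, ?_⟩
  have h := barD_barHomotopy_zero z
  rwa [hz, MulOpposite.op_zero, TensorProduct.tmul_zero, map_zero, add_zero] at h

end Bar

end Hochschild

namespace Cpx

/-! ### Comparison of resolutions. -/

section Comparison

variable {R : Type*} [Ring R] {P Q : ℕ → Type*} [∀ n, AddCommGroup (P n)] [∀ n, Module R (P n)]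
  [∀ n, AddCommGroup (Q n)] [∀ n, Module R (Q n)]

theorem exists_lift_of_mem_range {L M N : Type*} [AddCommGroup L] [Module R L]
    [AddCommGroup M] [Module R M] [AddCommGroup N] [Module R N] [Module.Projective R L]
    (f : L →ₗ[R] N) (d : M →ₗ[R] N) (h : ∀ v, f v ∈ LinearMap.range d) :
    ∃ g : L →ₗ[R] M, ∀ v, d (g v) = f v := by
  obtain ⟨g, hg⟩ := Module.projective_lifting_property d.rangeRestrict
    (f.codRestrict (LinearMap.range d) h) d.surjective_rangeRestrict
  exact ⟨g, fun v => congrArg Subtype.val (LinearMap.congr_fun hg v)⟩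

/-- A map in degree `0` from a complex of projectives to an exact complex extends to a chain
map. -/
theorem exists_chainMap [∀ n, Module.Projective R (P n)] (dP : ∀ n, P (n + 1) →ₗ[R] P n)
    (dQ : ∀ n, Q (n + 1) →ₗ[R] Q n) (hP : ∀ n v, dP n (dP (n + 1) v) = 0)
    (hQ : ∀ n v, dQ n v = 0 → v ∈ LinearMap.range (dQ (n + 1)))
    (f₀ : P 0 →ₗ[R] Q 0) (h₀ : ∀ v, f₀ (dP 0 v) ∈ LinearMap.range (dQ 0)) :
    ∃ f : ∀ n, P n →ₗ[R] Q n, f 0 = f₀ ∧ ∀ n v, dQ n (f (n + 1) v) = f n (dP n v) := by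
  have step : ∀ n (f : {f : P n →ₗ[R] Q n // ∀ v, f (dP n v) ∈ LinearMap.range (dQ n)}),
      ∃ g : {g : P (n + 1) →ₗ[R] Q (n + 1) //
        ∀ v, g (dP (n + 1) v) ∈ LinearMap.range (dQ (n + 1))},
        ∀ v, dQ n (g.1 v) = f.1 (dP n v) := by
    rintro n ⟨f, hf⟩
    obtain ⟨g, hg⟩ := exists_lift_of_mem_range (f ∘ₗ dP n) (dQ n) hf
    refine ⟨⟨g, fun v => hQ n _ ?_⟩, hg⟩
    rw [hg, LinearMap.comp_apply, hP, map_zero]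
  choose next hnext using step
  -- The recursion carries the condition that `f ∘ d` takes values in boundaries, which is exactly
  -- what the next lift requires.
  let F : ∀ n, {f : P n →ₗ[R] Q n // ∀ v, f (dP n v) ∈ LinearMap.range (dQ n)} :=
    fun n => Nat.rec ⟨f₀, h₀⟩ (fun n f => next n f) n
  exact ⟨fun n => (F n).1, rfl, fun n => hnext n (F n)⟩

/-- A chain map from a complex of projectives to an exact complex which is zero on the
augmentations is homotopic to zero. -/
theorem exists_homotopy [∀ n, Module.Projective R (P n)] (dP : ∀ n, P (n + 1) →ₗ[R] P n)
    (dQ : ∀ n, Q (n + 1) →ₗ[R] Q n) (hP : ∀ n v, dP n (dP (n + 1) v) = 0)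
    (hQ : ∀ n v, dQ n v = 0 → v ∈ LinearMap.range (dQ (n + 1)))
    (f : ∀ n, P n →ₗ[R] Q n) (hf : ∀ n v, dQ n (f (n + 1) v) = f n (dP n v))
    (h₀ : ∀ v, f 0 v ∈ LinearMap.range (dQ 0)) :
    ∃ h : ∀ n, P n →ₗ[R] Q (n + 1), (∀ v, dQ 0 (h 0 v) = f 0 v) ∧
      ∀ n v, dQ (n + 1) (h (n + 1) v) = f (n + 1) v - h n (dP n v) := by
  have step : ∀ n (h : {h : P n →ₗ[R] Q (n + 1) //
      ∀ v, f (n + 1) v - h (dP n v) ∈ LinearMap.range (dQ (n + 1))}),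
      ∃ g : {g : P (n + 1) →ₗ[R] Q (n + 2) //
        ∀ v, f (n + 2) v - g (dP (n + 1) v) ∈ LinearMap.range (dQ (n + 2))},
        ∀ v, dQ (n + 1) (g.1 v) = f (n + 1) v - h.1 (dP n v) := by
    rintro n ⟨h, hh⟩
    obtain ⟨g, hg⟩ := exists_lift_of_mem_range (f (n + 1) - h ∘ₗ dP n) (dQ (n + 1)) hh
    refine ⟨⟨g, fun v => hQ _ _ ?_⟩, hg⟩
    rw [map_sub, hg, hf, LinearMap.sub_apply, LinearMap.comp_apply, hP, map_zero, sub_zero,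
      sub_self]
  obtain ⟨g, hg⟩ := exists_lift_of_mem_range (f 0) (dQ 0) h₀
  have hg' : ∀ v, f 1 v - g (dP 0 v) ∈ LinearMap.range (dQ 1) := fun v => by
    refine hQ _ _ ?_
    rw [map_sub, hg, hf, sub_self]
  choose next hnext using step
  let H : ∀ n, {h : P n →ₗ[R] Q (n + 1) //
      ∀ v, f (n + 1) v - h (dP n v) ∈ LinearMap.range (dQ (n + 1))} :=
    fun n => Nat.rec ⟨g, hg'⟩ (fun n h => next n h) n
  exact ⟨fun n => (H n).1, hg, fun n => hnext n (H n)⟩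

end Comparison

/-! ### Maps induced in homology. -/

section HomologyMaps

variable {k : Type*} [CommRing k] {X Y : ℕ → Type*} [∀ n, AddCommGroup (X n)]
  [∀ n, Module k (X n)] [∀ n, AddCommGroup (Y n)] [∀ n, Module k (Y n)]
  {dX : ∀ n, X (n + 1) →ₗ[k] X n} {dY : ∀ n, Y (n + 1) →ₗ[k] Y n}

theorem isClassOf_mk (n : ℕ) (c : X n) (hc : c ∈ cycles dX n) :
    IsClassOf dX n c (Submodule.Quotient.mk ⟨c, hc⟩) := ⟨hc, rfl⟩

theorem mk_eq_mk_iff (n : ℕ) (c c' : cycles dX n) :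
    (Submodule.Quotient.mk c : Homology dX n) = Submodule.Quotient.mk c' ↔
      (c : X n) - c' ∈ boundaries dX n := by
  rw [Submodule.Quotient.eq]
  rfl

/-- Linear maps in degrees `m` and `n` that are mutually inverse up to boundaries on cycles
induce an isomorphism in homology. -/
theorem exists_homology_equiv (m n : ℕ) (f : X m →ₗ[k] Y n) (g : Y n →ₗ[k] X m)
    (hf : ∀ c ∈ cycles dX m, f c ∈ cycles dY n)
    (hf' : ∀ c ∈ boundaries dX m, f c ∈ boundaries dY n)
    (hg : ∀ c ∈ cycles dY n, g c ∈ cycles dX m)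
    (hg' : ∀ c ∈ boundaries dY n, g c ∈ boundaries dX m)
    (hgf : ∀ c ∈ cycles dX m, g (f c) - c ∈ boundaries dX m)
    (hfg : ∀ c ∈ cycles dY n, f (g c) - c ∈ boundaries dY n) :
    ∃ e : Homology dX m ≃ₗ[k] Homology dY n,
      ∀ c h, IsClassOf dX m c h → IsClassOf dY n (f c) (e h) := by
  let F : Homology dX m →ₗ[k] Homology dY n :=
    Submodule.mapQ _ _ (f.restrict hf) (fun c hc => hf' _ hc)
  let G : Homology dY n →ₗ[k] Homology dX m :=
    Submodule.mapQ _ _ (g.restrict hg) (fun c hc => hg' _ hc)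
  refine ⟨LinearEquiv.ofLinearMap F G ?_ ?_, ?_⟩
  · refine LinearMap.ext fun h => ?_
    obtain ⟨c, rfl⟩ := Submodule.Quotient.mk_surjective _ h
    exact (mk_eq_mk_iff n _ _).2 (hfg c c.2)
  · refine LinearMap.ext fun h => ?_
    obtain ⟨c, rfl⟩ := Submodule.Quotient.mk_surjective _ h
    exact (mk_eq_mk_iff m _ _).2 (hgf c c.2)
  · rintro c _ ⟨hc, rfl⟩
    exact ⟨hf c hc, rfl⟩

theorem map_mem_cycles (f : ∀ n, X n →ₗ[k] Y n) (hf : ∀ n v, dY n (f (n + 1) v) = f n (dX n v))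
    (n : ℕ) (c : X n) (hc : c ∈ cycles dX n) : f n c ∈ cycles dY n := by
  rcases n with _ | n
  · trivial
  · change dX n c = 0 at hc
    change dY n (f (n + 1) c) = 0
    rw [hf, hc, map_zero]

theorem map_mem_boundaries (f : ∀ n, X n →ₗ[k] Y n)
    (hf : ∀ n v, dY n (f (n + 1) v) = f n (dX n v))
    (n : ℕ) (c : X n) (hc : c ∈ boundaries dX n) : f n c ∈ boundaries dY n := by
  obtain ⟨v, rfl⟩ := hc
  exact ⟨f (n + 1) v, hf n v⟩

theorem mem_boundaries_of_homotopy (f : ∀ n, X n →ₗ[k] X n) (h : ∀ n, X n →ₗ[k] X (n + 1))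
    (h0 : ∀ v, dX 0 (h 0 v) = f 0 v)
    (hs : ∀ n v, dX (n + 1) (h (n + 1) v) = f (n + 1) v - h n (dX n v))
    (n : ℕ) (c : X n) (hc : c ∈ cycles dX n) : f n c ∈ boundaries dX n := by
  rcases n with _ | n
  · exact ⟨h 0 c, h0 c⟩
  · refine ⟨h (n + 1) c, ?_⟩
    change dX n c = 0 at hc
    rw [hs, hc, map_zero, sub_zero]

end HomologyMaps

end Cpx

namespace Hochschild

universe u

/-! ### Tensoring resolutions over a noncommutative ring. -/

section BalancedTensor

variable {k A R : Type u} [CommRing k] [AddCommGroup A] [Module k A] [Ring R] [Algebra k R]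

/-- The bilinear map `β` exhibits `M'` as the tensor product over `R` of the right module `A`,
on which `R` acts by `act`, and the left module `M`. -/
structure IsBalancedTensor (act : R →ₗ[k] Module.End k A) {M M' : Type u} [AddCommMonoid M]
    [Module k M] [Module R M] [AddCommMonoid M'] [Module k M'] (β : A →ₗ[k] M →ₗ[k] M') :
    Prop where
  balanced : ∀ a (r : R) m, β a (r • m) = β (act r a) m
  existsUnique_desc : ∀ (X : Type u) [AddCommMonoid X] [Module k X] (γ : A →ₗ[k] M →ₗ[k] X),
    (∀ a (r : R) m, γ a (r • m) = γ (act r a) m) → ∃! l : M' →ₗ[k] X, ∀ a m, l (β a m) = γ a m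

variable {act : R →ₗ[k] Module.End k A}
  {M M' : Type u} [AddCommMonoid M] [Module k M] [Module R M]
  [AddCommMonoid M'] [Module k M'] {β : A →ₗ[k] M →ₗ[k] M'}
  {N N' : Type u} [AddCommMonoid N] [Module k N] [Module R N]
  [AddCommMonoid N'] [Module k N'] {β' : A →ₗ[k] N →ₗ[k] N'}

theorem IsBalancedTensor.exists_map [IsScalarTower k R M] [IsScalarTower k R N]
    (hM : IsBalancedTensor act β) (hN : IsBalancedTensor act β')
    (f : M →ₗ[R] N) : ∃ l : M' →ₗ[k] N', ∀ a m, l (β a m) = β' a (f m) := by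
  obtain ⟨l, hl, -⟩ := hM.existsUnique_desc N'
    ((LinearMap.lcomp k N' (f.restrictScalars k)) ∘ₗ β') (fun a r m => by
      simp [hN.balanced])
  exact ⟨l, hl⟩

theorem IsBalancedTensor.ext (hM : IsBalancedTensor act β) {l l' : M' →ₗ[k] N'}
    (h : ∀ a m, l (β a m) = l' (β a m)) : l = l' := by
  obtain ⟨l₀, -, h₀⟩ := hM.existsUnique_desc N' (β.compr₂ l) (fun a r m => by
    simp [hM.balanced])
  rw [h₀ l (fun _ _ => rfl), h₀ l' (fun a m => (h a m).symm)]

end BalancedTensor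

/-- A chain map over the identity between projective resolutions induces an isomorphism in
homology after tensoring. -/
theorem exists_homology_equiv_of_resolutions {k A R : Type u} [CommRing k] [AddCommGroup A]
    [Module k A] [Ring R] [Algebra k R] (act : R →ₗ[k] Module.End k A) {P Q P' Q' : ℕ → Type u}
    [∀ n, AddCommGroup (P n)] [∀ n, Module k (P n)] [∀ n, Module R (P n)]
    [∀ n, IsScalarTower k R (P n)] [∀ n, Module.Projective R (P n)]
    [∀ n, AddCommGroup (Q n)] [∀ n, Module k (Q n)] [∀ n, Module R (Q n)]
    [∀ n, IsScalarTower k R (Q n)] [∀ n, Module.Projective R (Q n)]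
    [∀ n, AddCommGroup (P' n)] [∀ n, Module k (P' n)]
    [∀ n, AddCommGroup (Q' n)] [∀ n, Module k (Q' n)]
    (βP : ∀ n, A →ₗ[k] P n →ₗ[k] P' n) (hβP : ∀ n, IsBalancedTensor act (βP n))
    (βQ : ∀ n, A →ₗ[k] Q n →ₗ[k] Q' n) (hβQ : ∀ n, IsBalancedTensor act (βQ n))
    (dP : ∀ n, P (n + 1) →ₗ[R] P n) (hP : ∀ n v, dP n (dP (n + 1) v) = 0)
    (hP' : ∀ n v, dP n v = 0 → v ∈ LinearMap.range (dP (n + 1)))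
    (dQ : ∀ n, Q (n + 1) →ₗ[R] Q n) (hQ : ∀ n v, dQ n (dQ (n + 1) v) = 0)
    (hQ' : ∀ n v, dQ n v = 0 → v ∈ LinearMap.range (dQ (n + 1)))
    (dP' : ∀ n, P' (n + 1) →ₗ[k] P' n)
    (hdP : ∀ n a m, dP' n (βP (n + 1) a m) = βP n a (dP n m))
    (dQ' : ∀ n, Q' (n + 1) →ₗ[k] Q' n)
    (hdQ : ∀ n a m, dQ' n (βQ (n + 1) a m) = βQ n a (dQ n m))
    (Φ : ∀ n, P n →ₗ[R] Q n) (hΦ : ∀ n v, dQ n (Φ (n + 1) v) = Φ n (dP n v))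
    (Ψ₀ : Q 0 →ₗ[R] P 0) (hΨ₀ : ∀ v, Ψ₀ (dQ 0 v) ∈ LinearMap.range (dP 0))
    (hΨΦ : ∀ v, Ψ₀ (Φ 0 v) - v ∈ LinearMap.range (dP 0))
    (hΦΨ : ∀ v, Φ 0 (Ψ₀ v) - v ∈ LinearMap.range (dQ 0))
    (f : ∀ n, P' n → Q' n)
    (hf : ∀ n (l : P' n →ₗ[k] Q' n), (∀ a m, l (βP n a m) = βQ n a (Φ n m)) → ∀ v, f n v = l v)
    (n : ℕ) :
    ∃ e : Cpx.Homology dP' n ≃ₗ[k] Cpx.Homology dQ' n,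
      ∀ z h, Cpx.IsClassOf dP' n z h → Cpx.IsClassOf dQ' n (f n z) (e h) := by
  -- Extend `Ψ₀` to a chain map backwards. Both composites minus the identity take degree 0 into
  -- boundaries, hence are null-homotopic.
  obtain ⟨Ψ, hΨ0, hΨ⟩ := Cpx.exists_chainMap dQ dP hQ hP' Ψ₀ hΨ₀
  obtain ⟨s, hs0, hs⟩ := Cpx.exists_homotopy dP dP hP hP'
    (fun n => Ψ n ∘ₗ Φ n - LinearMap.id) (fun n v => by
      simp only [LinearMap.sub_apply, LinearMap.comp_apply, LinearMap.id_apply, map_sub, hΨ, hΦ])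
    (fun v => by rw [hΨ0]; exact hΨΦ v)
  obtain ⟨t, ht0, ht⟩ := Cpx.exists_homotopy dQ dQ hQ hQ'
    (fun n => Φ n ∘ₗ Ψ n - LinearMap.id) (fun n v => by
      simp only [LinearMap.sub_apply, LinearMap.comp_apply, LinearMap.id_apply, map_sub, hΨ, hΦ])
    (fun v => by rw [hΨ0]; exact hΦΨ v)
  -- Chain maps and homotopies descend to the tensor products; their identities need checking only
  -- on the elements `β a m`.
  choose p hp using fun n => (hβP n).exists_map (hβQ n) (Φ n)
  choose q hq using fun n => (hβQ n).exists_map (hβP n) (Ψ n)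
  choose s' hs' using fun n => (hβP n).exists_map (hβP (n + 1)) (s n)
  choose t' ht' using fun n => (hβQ n).exists_map (hβQ (n + 1)) (t n)
  have cp : ∀ n v, dQ' n (p (n + 1) v) = p n (dP' n v) := fun n =>
    LinearMap.congr_fun (f := dQ' n ∘ₗ p (n + 1)) (g := p n ∘ₗ dP' n)
      ((hβP (n + 1)).ext fun a m => by simp only [LinearMap.comp_apply, hp, hdQ, hdP, hΦ])
  have cq : ∀ n v, dP' n (q (n + 1) v) = q n (dQ' n v) := fun n =>
    LinearMap.congr_fun (f := dP' n ∘ₗ q (n + 1)) (g := q n ∘ₗ dQ' n)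
      ((hβQ (n + 1)).ext fun a m => by simp only [LinearMap.comp_apply, hq, hdQ, hdP, hΨ])
  have s0 : ∀ v, dP' 0 (s' 0 v) = (q 0 ∘ₗ p 0 - LinearMap.id : P' 0 →ₗ[k] P' 0) v :=
    LinearMap.congr_fun (f := dP' 0 ∘ₗ s' 0) ((hβP 0).ext fun a m => by
      simp only [LinearMap.comp_apply, LinearMap.sub_apply, LinearMap.id_apply, hp, hq, hs', hdP,
        hs0, map_sub])
  have s1 : ∀ n v, dP' (n + 1) (s' (n + 1) v) =
      (q (n + 1) ∘ₗ p (n + 1) - LinearMap.id : P' (n + 1) →ₗ[k] P' (n + 1)) v - s' n (dP' n v) :=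
    fun n => LinearMap.congr_fun (f := dP' (n + 1) ∘ₗ s' (n + 1))
      (g := q (n + 1) ∘ₗ p (n + 1) - LinearMap.id - s' n ∘ₗ dP' n)
      ((hβP (n + 1)).ext fun a m => by
        simp only [LinearMap.comp_apply, LinearMap.sub_apply, LinearMap.id_apply, hp, hq, hs', hdP,
          hs, map_sub])
  have t0 : ∀ v, dQ' 0 (t' 0 v) = (p 0 ∘ₗ q 0 - LinearMap.id : Q' 0 →ₗ[k] Q' 0) v :=
    LinearMap.congr_fun (f := dQ' 0 ∘ₗ t' 0) ((hβQ 0).ext fun a m => by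
      simp only [LinearMap.comp_apply, LinearMap.sub_apply, LinearMap.id_apply, hp, hq, ht', hdQ,
        ht0, map_sub])
  have t1 : ∀ n v, dQ' (n + 1) (t' (n + 1) v) =
      (p (n + 1) ∘ₗ q (n + 1) - LinearMap.id : Q' (n + 1) →ₗ[k] Q' (n + 1)) v - t' n (dQ' n v) :=
    fun n => LinearMap.congr_fun (f := dQ' (n + 1) ∘ₗ t' (n + 1))
      (g := p (n + 1) ∘ₗ q (n + 1) - LinearMap.id - t' n ∘ₗ dQ' n)
      ((hβQ (n + 1)).ext fun a m => by
        simp only [LinearMap.comp_apply, LinearMap.sub_apply, LinearMap.id_apply, hp, hq, ht', hdQ,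
          ht, map_sub])
  obtain ⟨e, he⟩ := Cpx.exists_homology_equiv (dX := dP') (dY := dQ') n n (p n) (q n)
    (Cpx.map_mem_cycles p cp n) (Cpx.map_mem_boundaries p cp n)
    (Cpx.map_mem_cycles q cq n) (Cpx.map_mem_boundaries q cq n)
    (Cpx.mem_boundaries_of_homotopy (fun n => q n ∘ₗ p n - LinearMap.id) s' s0 s1 n)
    (Cpx.mem_boundaries_of_homotopy (fun n => p n ∘ₗ q n - LinearMap.id) t' t0 t1 n)
  refine ⟨e, fun z h hz => ?_⟩
  rw [hf n (p n) (hp n)]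
  exact he z h hz

end Hochschild

namespace Hochschild

universe u

/-! ### The Hochschild chains as a tensor product with the bar resolution. -/

section BarTensor

variable (k : Type u) [CommRing k] (A : Type u) [Ring A] [Algebra k A]

theorem envRightAct_tmul (u v a : A) :
    envRightAct k A (u ⊗ₜ MulOpposite.op v) a = v * a * u := by
  simp [envRightAct, AlgHom.mulLeftRight_apply]

theorem envRightAct_one (a : A) : envRightAct k A 1 a = a := by
  rw [Algebra.TensorProduct.one_def, ← MulOpposite.op_one, envRightAct_tmul, one_mul, mul_one]

theorem envRightAct_mul (r s : Env k A) (a : A) :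
    envRightAct k A (r * s) a = envRightAct k A s (envRightAct k A r a) := by
  induction r using TensorProduct.induction_on with
  | zero => simp
  | add r r' hr hr' => simp only [add_mul, map_add, LinearMap.add_apply, hr, hr']
  | tmul u v =>
    induction s using TensorProduct.induction_on with
    | zero => simp
    | add s s' hs hs' => simp only [mul_add, map_add, LinearMap.add_apply, hs, hs']
    | tmul u' v' =>
      induction v using MulOpposite.rec'
      induction v' using MulOpposite.rec'
      rw [Algebra.TensorProduct.tmul_mul_tmul, ← MulOpposite.op_mul, envRightAct_tmul,
        envRightAct_tmul, envRightAct_tmul]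
      simp only [mul_assoc]

/-- The canonical pairing of `A` with the bar resolution, with values in the Hochschild chains. -/
def barPairing (n : ℕ) : A →ₗ[k] Bar k A n →ₗ[k] Chains k A n :=
  LinearMap.mk₂ k (fun a z => TensorProduct.map ((envRightAct k A).flip a) LinearMap.id z)
    (fun a b z => by rw [map_add, TensorProduct.map_add_left, LinearMap.add_apply])
    (fun c a z => by rw [map_smul, TensorProduct.map_smul_left, LinearMap.smul_apply])
    (fun a z z' => map_add _ z z') (fun c a z => map_smul _ c z)

variable {k A}

theorem barPairing_tmul (n : ℕ) (a : A) (e : Env k A) (w : ⨂[k]^n A) :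
    barPairing k A n a (e ⊗ₜ w) = envRightAct k A e a ⊗ₜ w := rfl

theorem barPairing_smul (n : ℕ) (a : A) (r : Env k A) (z : Bar k A n) :
    barPairing k A n a (r • z) = barPairing k A n (envRightAct k A r a) z := by
  induction z using TensorProduct.induction_on with
  | zero => rw [smul_zero, map_zero, map_zero]
  | add z z' hz hz' => rw [smul_add, map_add, map_add, hz, hz']
  | tmul e w =>
    have hr : r • (e ⊗ₜ w : Bar k A n) = (r * e) ⊗ₜ w := rfl
    rw [hr, barPairing_tmul, barPairing_tmul, envRightAct_mul]

/-- Since `e ⊗ w = e • (1 ⊗ w)`, a balanced pairing is determined by its values on `a` and `1 ⊗ w`,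
and these can be prescribed freely. -/
theorem isBalancedTensor_barPairing (n : ℕ) :
    IsBalancedTensor (envRightAct k A) (barPairing k A n) where
  balanced a r m := barPairing_smul n a r m
  existsUnique_desc X _ _ γ hγ := by
    refine ⟨TensorProduct.lift (γ.compl₂ (TensorProduct.mk k (Env k A) (⨂[k]^n A) 1)),
      fun a m => ?_, fun l hl => ?_⟩
    · induction m using TensorProduct.induction_on with
      | zero => simp only [map_zero]
      | add z z' hz hz' => simp only [map_add, hz, hz']
      | tmul e w =>
        have he : (e ⊗ₜ w : Bar k A n) = e • (1 ⊗ₜ w) := by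
          change _ = (e * 1) ⊗ₜ w
          rw [mul_one]
        rw [barPairing_tmul, he, hγ]
        rfl
    · refine TensorProduct.ext' fun a w => ?_
      have h := hl a (1 ⊗ₜ w)
      rw [barPairing_tmul, envRightAct_one] at h
      rw [h]
      rfl

theorem chainsD_barPairing (n : ℕ) (a : A) (z : Bar k A (n + 1)) :
    chainsD k A n (barPairing k A (n + 1) a z) = barPairing k A n a (barD k A n z) := by
  refine bar_ext (f := chainsD k A n ∘ₗ barPairing k A (n + 1) a)
    (g := barPairing k A n a ∘ₗ barD k A n) (fun u v b => ?_) z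
  simp only [LinearMap.comp_apply, barD_tmul, map_add, map_sum, map_smul, barPairing_tmul,
    chainsD_tmul, Algebra.TensorProduct.tmul_mul_tmul, mul_one, ← MulOpposite.op_mul,
    envRightAct_tmul, mul_assoc]

variable (k A) in
/-- The isomorphism of the augmented bimodule `Bar 0` with `A ⊗ A`. -/
def ofBarZero : Bar k A 0 →ₗ[Env k A] Env k A :=
  (TensorProduct.AlgebraTensorModule.rid k (Env k A) (Env k A)).toLinearMap ∘ₗ
    TensorProduct.AlgebraTensorModule.map LinearMap.id
      (PiTensorProduct.isEmptyEquiv (R := k) (s := fun _ => A) (Fin 0)).toLinearMap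

theorem envMul_ofBarZero (z : Bar k A 0) : envMul k A (ofBarZero k A z) = barAug k A z := by
  refine bar_ext (f := envMul k A ∘ₗ (ofBarZero k A).restrictScalars k) (g := barAug k A)
    (fun u v a => ?_) z
  simp [ofBarZero, barAug_tmul]

end BarTensor

end Hochschild

/-! ### The small complex as a tensor product, and the comparison isomorphism. -/

namespace SuperJordan

open Hochschild

universe u

variable {k : Type u} [Field k]

variable (k) in
/-- The canonical pairing of `A` with the resolution. -/
def resPairing (n : ℕ) : Plane k →ₗ[k] Res k n →ₗ[k] Small k n :=
  LinearMap.mk₂ k (fun a m g => envRightAct k (Plane k) (m g) a)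
    (fun a b m => by funext g; simp) (fun c a m => by funext g; simp)
    (fun a m m' => by funext g; simp) (fun c a m => by funext g; simp)

theorem resPairing_apply (n : ℕ) (a : Plane k) (m : Res k n) (g : Gen n) :
    resPairing k n a m g = envRightAct k (Plane k) (m g) a := rfl

theorem resPairing_single (n : ℕ) (a : Plane k) (g : Gen n) :
    resPairing k n a (Pi.single g 1) = Pi.single g a := by
  funext h
  rw [resPairing_apply]
  by_cases hh : h = g
  · subst hh; rw [Pi.single_eq_same, Pi.single_eq_same, envRightAct_one]
  · rw [Pi.single_eq_of_ne hh, Pi.single_eq_of_ne hh, map_zero, LinearMap.zero_apply]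

theorem eq_sum_resPairing (n : ℕ) (v : Small k n) :
    v = ∑ g, resPairing k n (v g) (Pi.single g 1) := by
  simp only [resPairing_single]
  exact (Finset.univ_sum_single v).symm

theorem isBalancedTensor_resPairing (n : ℕ) :
    IsBalancedTensor (envRightAct k (Plane k)) (resPairing k n) where
  balanced a r m := by
    funext g
    rw [resPairing_apply, resPairing_apply, Pi.smul_apply, smul_eq_mul, envRightAct_mul]
  existsUnique_desc X _ _ γ hγ := by
    refine ⟨∑ g, (γ.flip (Pi.single g 1)) ∘ₗ LinearMap.proj g, fun a m => ?_, fun l hl => ?_⟩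
    · simp only [LinearMap.sum_apply, LinearMap.comp_apply, LinearMap.proj_apply,
        LinearMap.flip_apply, resPairing_apply, ← hγ, ← map_sum]
      congr 1
      conv_rhs => rw [← Finset.univ_sum_single m]
      refine Finset.sum_congr rfl fun g _ => ?_
      rw [← Pi.single_smul, smul_eq_mul, mul_one]
    · refine LinearMap.ext fun v => ?_
      conv_lhs => rw [eq_sum_resPairing n v]
      simp [hl]

theorem smallD_resPairing (n : ℕ) (a : Plane k) (m : Res k (n + 1)) :
    smallD k n (resPairing k (n + 1) a m) = resPairing k n a (resD k n m) := by
  funext h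
  rw [resPairing_apply]
  simp [smallD, resD, envRightAct_mul]
  rfl

/-- Every chain is a sum of pairings with the free generators, so `induced` agrees with any linear
map that descends from `Φ n`. -/
theorem induced_eq (Φ : ∀ n, Res k n →ₗ[Env k (Plane k)] Bar k (Plane k) n) (n : ℕ)
    (l : Small k n →ₗ[k] Chains k (Plane k) n)
    (hl : ∀ a m, l (resPairing k n a m) = barPairing k (Plane k) n a (Φ n m)) (v : Small k n) :
    induced Φ n v = l v := by
  conv_rhs => rw [eq_sum_resPairing n v]
  simp only [map_sum, hl]
  rfl

instance finite_gen : ∀ n, Finite (Gen n)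
  | 0 => inferInstanceAs (Finite Unit)
  | _ + 1 => inferInstanceAs (Finite (Fin 2))

instance projective_res (n : ℕ) : Module.Projective (Env k (Plane k)) (Res k n) :=
  inferInstance

instance projective_bar (n : ℕ) : Module.Projective (Env k (Plane k)) (Bar k (Plane k) n) :=
  inferInstance

theorem resD_mem (v : Res k 1) : envMul k (Plane k) (resD k 0 v ()) = 0 := by
  have hz : ∀ (g : Plane k) (z : Env k (Plane k)),
      envMul k (Plane k) (z * (el g 1 - el 1 g)) = 0 := by
    intro g z
    have : envMul k (Plane k) ∘ₗ LinearMap.mulRight k (el g 1 - el 1 g) = 0 :=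
      ext_el (by simp [mul_sub, el_mul_el, envMul_el, mul_assoc])
        (by simp [mul_sub, el_mul_el, envMul_el, mul_assoc])
    exact LinearMap.congr_fun this z
  have hd : dEnv k (-1) = el (x k) 1 - el 1 (x k) := by
    rw [dEnv, env_neg_smul, one_smul, sub_eq_add_neg]
  rw [resD_zero_apply, map_add, hd, hz, hz, add_zero]

variable (k) in
theorem exists_isComparison :
    ∃ Φ : ∀ n, Res k n →ₗ[Env k (Plane k)] Bar k (Plane k) n, IsComparison k Φ := by
  have hBar' : ∀ n (v : Bar k (Plane k) (n + 1)), barDLinear k (Plane k) n v = 0 →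
      v ∈ LinearMap.range (barDLinear k (Plane k) (n + 1)) := ker_barD_le
  let f₀ : Res k 0 →ₗ[Env k (Plane k)] Bar k (Plane k) 0 :=
    toBarZero k (Plane k) ∘ₗ LinearMap.proj ()
  have h₀ : ∀ v, f₀ (resD k 0 v) ∈ LinearMap.range (barDLinear k (Plane k) 0) := fun v => by
    refine ker_barAug_le _ ?_
    rw [LinearMap.comp_apply, barAug_toBarZero]
    exact resD_mem v
  obtain ⟨Φ, h0, hΦ⟩ := Cpx.exists_chainMap (P := Res k) (Q := Bar k (Plane k)) (resD k)
    (barDLinear k (Plane k))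
    (resD_resD k) hBar' f₀ h₀
  refine ⟨Φ, fun v => ?_, hΦ⟩
  rw [h0]
  exact barAug_toBarZero _

theorem exists_homology_equiv_of_isComparison
    (Φ : ∀ n, Res k n →ₗ[Env k (Plane k)] Bar k (Plane k) n) (hΦ : IsComparison k Φ) (n : ℕ) :
    ∃ e : Cpx.Homology (smallD k) n ≃ₗ[k] HH k (Plane k) n,
      ∀ z h, Cpx.IsClassOf (smallD k) n z h →
        Cpx.IsClassOf (chainsD k (Plane k)) n (induced Φ n z) (e h) := by
  have hBar : ∀ n (v : Bar k (Plane k) (n + 2)),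
      barDLinear k (Plane k) n (barDLinear k (Plane k) (n + 1) v) = 0 := barD_barD
  have hBar' : ∀ n (v : Bar k (Plane k) (n + 1)), barDLinear k (Plane k) n v = 0 →
      v ∈ LinearMap.range (barDLinear k (Plane k) (n + 1)) := ker_barD_le
  let Ψ₀ : Bar k (Plane k) 0 →ₗ[Env k (Plane k)] Res k 0 :=
    LinearMap.pi fun _ => ofBarZero k (Plane k)
  have hΨ₀ : ∀ z, envMul k (Plane k) (Ψ₀ z ()) = barAug k (Plane k) z := envMul_ofBarZero
  refine exists_homology_equiv_of_resolutions (envRightAct k (Plane k)) (P := Res k)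
    (Q := Bar k (Plane k)) (P' := Small k) (Q' := Chains k (Plane k))
    (resPairing k) isBalancedTensor_resPairing
    (barPairing k (Plane k)) isBalancedTensor_barPairing (resD k) (resD_resD k) (ker_resD_le k)
    (barDLinear k (Plane k)) hBar hBar' (smallD k) smallD_resPairing
    (chainsD k (Plane k)) chainsD_barPairing Φ hΦ.comm Ψ₀ (fun v => ?_) (fun v => ?_)
    (fun v => ?_) (induced Φ) (induced_eq Φ) n
  -- In degree 0 an element is a boundary as soon as its augmentation vanishes, so the three
  -- conditions compare augmentations only.
  · refine ker_envMul_le k _ ?_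
    rw [hΨ₀]
    exact barAug_barD v
  · refine ker_envMul_le k _ ?_
    rw [Pi.sub_apply, map_sub, hΨ₀, hΦ.aug, sub_self]
  · refine ker_barAug_le _ ?_
    rw [map_sub, hΦ.aug, hΨ₀, sub_self]

end SuperJordan

namespace SuperJordan

open Hochschild

/-! ### The operators on `A` that make up the small differential. -/

section Operators

variable (k : Type*) [Field k]

/-- The coefficient of `(yx)ⁱ yᶜ`. -/
def cf₀ (i c : ℕ) : Plane k →ₗ[k] k := (pbw k).coord (Sum.inl (i, c))

/-- The coefficient of `x (yx)ⁱ yᶜ`. -/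
def cf₁ (i c : ℕ) : Plane k →ₗ[k] k := (pbw k).coord (Sum.inr (i, c))

variable {k}

@[simp] theorem cf₀_mon (i c j d : ℕ) :
    cf₀ k i c (mon k j d) = if j = i ∧ d = c then 1 else 0 := by
  rw [cf₀, Module.Basis.coord_apply, repr_mon, Finsupp.single_apply]
  simp

@[simp] theorem cf₁_mon (i c j d : ℕ) : cf₁ k i c (mon k j d) = 0 := by
  rw [cf₁, Module.Basis.coord_apply, repr_mon, Finsupp.single_apply]
  simp

@[simp] theorem cf₀_x_mul_mon (i c j d : ℕ) : cf₀ k i c (x k * mon k j d) = 0 := by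
  rw [cf₀, Module.Basis.coord_apply, repr_x_mul_mon, Finsupp.single_apply]
  simp

@[simp] theorem cf₁_x_mul_mon (i c j d : ℕ) :
    cf₁ k i c (x k * mon k j d) = if j = i ∧ d = c then 1 else 0 := by
  rw [cf₁, Module.Basis.coord_apply, repr_x_mul_mon, Finsupp.single_apply]
  simp

/-- Right multiplication by `x` behaves differently on even and odd powers of `y`, because `y²ᵐ x =
x wₘ`; hence the case split by parity. -/
theorem mem_of_parity (S : Submodule k (Plane k)) (h0 : ∀ i m, mon k i (2 * m) ∈ S)
    (h1 : ∀ i m, mon k i (2 * m + 1) ∈ S) (h2 : ∀ i m, x k * mon k i (2 * m) ∈ S)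
    (h3 : ∀ i m, x k * mon k i (2 * m + 1) ∈ S) (a : Plane k) : a ∈ S := by
  refine mem_of_monomials S (fun i c => ?_) (fun i c => ?_) a <;>
  obtain ⟨m, rfl | rfl⟩ := Nat.even_or_odd' c
  exacts [h0 i m, h1 i m, h2 i m, h3 i m]

theorem ext_parity {M : Type*} [AddCommGroup M] [Module k M] {f g : Plane k →ₗ[k] M}
    (h0 : ∀ i m, f (mon k i (2 * m)) = g (mon k i (2 * m)))
    (h1 : ∀ i m, f (mon k i (2 * m + 1)) = g (mon k i (2 * m + 1)))
    (h2 : ∀ i m, f (x k * mon k i (2 * m)) = g (x k * mon k i (2 * m)))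
    (h3 : ∀ i m, f (x k * mon k i (2 * m + 1)) = g (x k * mon k i (2 * m + 1)))
    (a : Plane k) : f a = g a :=
  mem_of_parity (LinearMap.eqLocus f g) h0 h1 h2 h3 a

theorem cf₁_eq_cf₀_divX (a : Plane k) (i c : ℕ) : cf₁ k i c a = cf₀ k i c (divX k a) := by
  have : cf₁ k i c = cf₀ k i c ∘ₗ divX k :=
    ext_monomials (by simp [divX]) (by simp [divX])
  rw [this]; rfl

variable (k) in
/-- `a ↦ a x + ε x a`. -/
def dAct (ε : k) : Plane k →ₗ[k] Plane k := envRightAct k (Plane k) (dEnv k ε)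

variable (k) in
/-- `b ↦ b (y² - xy) - (y² + yx) b`. -/
def cAct : Plane k →ₗ[k] Plane k := envRightAct k (Plane k) (cEnv k)

variable (k) in
/-- `b ↦ x b y + y x b - b x y - y b x - x b x`. -/
def fAct : Plane k →ₗ[k] Plane k := envRightAct k (Plane k) (fEnv k)

variable (k) in
/-- `b ↦ b y - y b`. -/
def adY : Plane k →ₗ[k] Plane k := envRightAct k (Plane k) (el (y k) 1 - el 1 (y k))

theorem envRightAct_el (u v a : Plane k) : envRightAct k (Plane k) (el u v) a = v * a * u :=
  envRightAct_tmul k _ u v a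

theorem dAct_apply (ε : k) (a : Plane k) : dAct k ε a = a * x k + ε • (x k * a) := by
  rw [dAct, dEnv, map_add, map_smul, LinearMap.add_apply, LinearMap.smul_apply, envRightAct_el,
    envRightAct_el, one_mul, mul_one]

theorem cAct_apply (b : Plane k) : cAct k b =
    b * (y k * y k) - y k * (y k * b) - b * (x k * y k) - y k * (x k * b) := by
  simp only [cAct, cEnv, map_sub, LinearMap.sub_apply, envRightAct_el, one_mul, mul_one, mul_assoc]

theorem fAct_apply (b : Plane k) : fAct k b =
    x k * b * y k + y k * (x k * b) - b * x k * y k - y k * (b * x k) - x k * (b * x k) := by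
  simp only [fAct, fEnv, map_sub, map_add, LinearMap.sub_apply, LinearMap.add_apply,
    envRightAct_el, one_mul, mul_one, mul_assoc]

theorem adY_apply (b : Plane k) : adY k b = b * y k - y k * b := by
  simp only [adY, map_sub, LinearMap.sub_apply, envRightAct_el, one_mul, mul_one]

theorem dAct_dAct (ε : k) (a : Plane k) : dAct k (-ε) (dAct k ε a) = 0 := by
  rw [dAct, dAct, ← envRightAct_mul, dEnv_mul_dEnv, map_zero, LinearMap.zero_apply]

theorem dAct_neg_dAct (ε : k) (a : Plane k) : dAct k ε (dAct k (-ε) a) = 0 := by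
  rw [dAct, dAct, ← envRightAct_mul, dEnv_neg_mul_dEnv, map_zero, LinearMap.zero_apply]

theorem cAct_dAct (ε : k) (a : Plane k) : cAct k (dAct k ε a) = dAct k ε (cAct k a) := by
  rw [dAct, cAct, ← envRightAct_mul, ← envRightAct_mul, cEnv_mul_dEnv]

theorem fAct_dAct (a : Plane k) : fAct k (dAct k 1 a) = 0 := by
  rw [dAct, fAct, ← envRightAct_mul, dEnv_mul_fEnv, map_zero, LinearMap.zero_apply]

theorem dAct_cAct_add (a : Plane k) : dAct k (-1) (cAct k a) + adY k (fAct k a) = 0 := by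
  rw [dAct, cAct, adY, fAct, ← envRightAct_mul, ← envRightAct_mul, ← LinearMap.add_apply,
    ← map_add, cEnv_mul_add_fEnv_mul, map_zero, LinearMap.zero_apply]

/-- `fAct` factors through `dAct k (-1)`, so it vanishes on the kernel of the latter. The converse
is `dAct_eq_zero_of_fAct_eq_zero`. -/
theorem fAct_eq (b : Plane k) : fAct k b =
    -(y k * dAct k (-1) b + dAct k (-1) b * y k + x k * dAct k (-1) b) := by
  rw [fAct_apply, dAct_apply, neg_smul, one_smul]
  simp only [mul_add, add_mul, mul_neg, neg_mul, x_mul_x_mul', mul_assoc]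
  abel

theorem smallD_zero_apply (v : Small k 1) (g : Gen 0) :
    smallD k 0 v g = dAct k (-1) (v 0) + adY k (v 1) := by
  have h : smallD k 0 v g = ∑ i : Fin 2, envRightAct k (Plane k)
      ((![el (x k) 1 - el 1 (x k), el (y k) 1 - el 1 (y k)] : Fin 2 → _) i) (v i) := by
    simp [smallD, coeff]
  rw [h, Fin.sum_univ_two, dAct, dEnv, env_neg_smul, one_smul, ← sub_eq_add_neg]
  rfl

theorem smallD_one_apply (v : Small k 2) :
    smallD k 1 v = ![dAct k 1 (v 0) + cAct k (v 1), fAct k (v 1)] := by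
  funext g
  fin_cases g
  · simp [smallD, coeff, dAct, dEnv, cAct, cEnv]
  · simp [smallD, coeff, fAct, fEnv]

theorem smallD_apply (n : ℕ) (v : Small k (n + 3)) : smallD k (n + 2) v =
    ![dAct k ((-1) ^ (n + 3)) (v 0) + cAct k (v 1), -dAct k (-(-1) ^ (n + 3)) (v 1)] := by
  have h0 : cEnv k = el (y k * y k) 1 - el (x k * y k) 1 - el 1 (y k * y k) - el 1 (y k * x k) := by
    rw [cEnv]; abel
  have h1 : -dEnv k (-(-1) ^ (n + 3)) = (-1 : k) ^ (n + 3) • el 1 (x k) - el (x k) 1 := by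
    rw [dEnv, env_neg_smul]; abel
  have h2 : -dAct k (-(-1) ^ (n + 3)) (v 1) = envRightAct k (Plane k)
      ((-1 : k) ^ (n + 3) • el 1 (x k) - el (x k) 1) (v 1) := by
    rw [← h1, dAct, ← LinearMap.neg_apply]
    exact congrFun (congrArg DFunLike.coe (map_neg (envRightAct k (Plane k)) _).symm) _
  funext g
  rw [h2, dAct, dEnv, cAct, h0]
  fin_cases g
  · simp [smallD, coeff]
  · simp [smallD, coeff]

end Operators

/-! ### Powers of `y² + yx` and right multiplication by `x`. -/

section Powers

variable (k : Type*) [Field k]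

/-- The elements `(yx)ⁱ wₘ`. -/
def tw (i m : ℕ) : Plane k := (y k * x k) ^ i * w k m

variable {k}

theorem tw_eq_sum (i m : ℕ) : tw k i m = ∑ j ∈ Finset.range (m + 1),
    ((m ! : k) / (j ! : k)) • mon k (i + (m - j)) (2 * j) := by
  rw [tw, w, Finset.mul_sum]
  refine Finset.sum_congr rfl fun j _ => ?_
  rw [mul_smul_comm, mon, pow_add, mul_assoc]

theorem tw_zero (m : ℕ) : tw k 0 m = w k m := by simp [tw]

theorem w_eq_sum (m : ℕ) : w k m = ∑ j ∈ Finset.range (m + 1),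
    ((m ! : k) / (j ! : k)) • mon k (m - j) (2 * j) := rfl

theorem cf₁_tw (i c j m : ℕ) : cf₁ k i c (tw k j m) = 0 := by
  simp [tw_eq_sum]

theorem cf₀_x_mul (i c : ℕ) (a : Plane k) : cf₀ k i c (x k * a) = 0 := by
  have : cf₀ k i c ∘ₗ LinearMap.mulLeft k (x k) = 0 :=
    ext_monomials (by simp) (by simp [x_mul_x_mul'])
  exact LinearMap.congr_fun this a

theorem divX_tw (i m : ℕ) : divX k (tw k i m) = 0 := by
  simp [tw_eq_sum, divX]

theorem divX_x_mul_tw (i m : ℕ) : divX k (x k * tw k i m) = tw k i m := by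
  simp [tw_eq_sum, divX, Finset.mul_sum]

theorem cf₁_x_mul_tw (i c j m : ℕ) : cf₁ k i c (x k * tw k j m) = cf₀ k i c (tw k j m) := by
  rw [cf₁_eq_cf₀_divX, divX_x_mul_tw]

theorem cf₀_odd_tw (i c j m : ℕ) : cf₀ k i (2 * c + 1) (tw k j m) = 0 := by
  rw [tw_eq_sum, map_sum]
  refine Finset.sum_eq_zero fun l _ => ?_
  rw [map_smul, cf₀_mon, if_neg (by omega), smul_zero]

theorem cf₀_even_tw (i l j m : ℕ) : cf₀ k i (2 * l) (tw k j m) =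
    if l ≤ m ∧ i = j + (m - l) then (m ! : k) / (l ! : k) else 0 := by
  rw [tw_eq_sum, map_sum]
  by_cases h : l ≤ m
  · rw [Finset.sum_eq_single_of_mem l (by simpa using Nat.lt_succ_of_le h)]
    · by_cases h' : i = j + (m - l)
      · simp [h, h']
      · simp [h', eq_comm]
    · intro b _ hb
      rw [map_smul, cf₀_mon, if_neg (by omega), smul_zero]
  · rw [if_neg (by omega)]
    refine Finset.sum_eq_zero fun b hb => ?_
    have : b < m + 1 := by simpa using hb
    rw [map_smul, cf₀_mon, if_neg (by omega), smul_zero]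

theorem cf₀_zero_even_w [CharZero k] (l m : ℕ) : cf₀ k 0 (2 * l) (w k m) = if l = m then 1 else 0 := by
  rw [← tw_zero, cf₀_even_tw]
  by_cases h : l = m
  · subst h
    rw [if_pos (by omega), if_pos rfl, div_self (Nat.cast_ne_zero.2 (Nat.factorial_ne_zero _))]
  · rw [if_neg (by omega), if_neg h]

variable (k) in
/-- The element `y² + yx`. -/
def q : Plane k := y k * y k + y k * x k

/-- As `x² = 0`, the second relation says exactly that `q` commutes with `x`. -/
theorem q_mul_x : q k * x k = x k * q k := by
  simp only [q, add_mul, mul_add, mul_assoc, y_mul_y_mul_x', x_mul_x, mul_zero, add_zero]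

theorem q_mul_mon (i c : ℕ) :
    q k * mon k i c = mon k i (c + 2) + ((i : k) + 1) • mon k (i + 1) c := by
  have h1 : y k * (y k * mon k i c) = mon k i (c + 2) + (i : k) • mon k (i + 1) c := by
    have := congrArg (· * y k ^ c) (y_sq_mul_t_pow k i)
    simp only [add_mul, smul_mul_assoc, mul_assoc, ← pow_add] at this
    rw [mon, this, mon, mon, add_comm 2 c]
  rw [q, add_mul, mul_assoc, mul_assoc, h1, y_mul_x_mul_mon, add_smul, one_smul, add_assoc]

variable [CharZero k]

theorem q_mul_w (m : ℕ) : q k * w k m = w k (m + 1) := by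
  have hf : ∀ i : ℕ, (i ! : k) ≠ 0 := fun i => Nat.cast_ne_zero.2 (Nat.factorial_ne_zero _)
  rw [w_eq_sum, Finset.mul_sum]
  simp only [mul_smul_comm, q_mul_mon, smul_add, Finset.sum_add_distrib, smul_smul]
  -- Both sums are brought to the range `m + 2`, where the added term has coefficient zero. The
  -- coefficients then add up by `j + (m + 1 - j) = m + 1`.
  have e1 : ∑ j ∈ Finset.range (m + 1), ((m ! : k) / (j ! : k)) • mon k (m - j) (2 * j + 2) =
      ∑ j ∈ Finset.range (m + 2),
        ((m ! : k) / (j ! : k) * j) • mon k (m + 1 - j) (2 * j) := by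
    rw [Finset.sum_range_succ' _ (m + 1)]
    simp only [Nat.cast_zero, mul_zero, zero_smul, add_zero, Nat.add_sub_add_right]
    refine Finset.sum_congr rfl fun j _ => ?_
    congr 1
    rw [Nat.factorial_succ]
    push_cast
    have : (j : k) + 1 ≠ 0 := Nat.cast_add_one_ne_zero j
    field_simp [hf j]
  have e2 : ∑ j ∈ Finset.range (m + 1),
      ((m ! : k) / (j ! : k) * (((m - j : ℕ) : k) + 1)) • mon k (m - j + 1) (2 * j) =
      ∑ j ∈ Finset.range (m + 2),
        ((m ! : k) / (j ! : k) * (m + 1 - j)) • mon k (m + 1 - j) (2 * j) := by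
    rw [Finset.sum_range_succ _ (m + 1)]
    simp only [Nat.cast_add, Nat.cast_one, sub_self, mul_zero, zero_smul, add_zero]
    refine Finset.sum_congr rfl fun j hj => ?_
    have hj' : j ≤ m := by have := Finset.mem_range.1 hj; omega
    rw [Nat.cast_sub hj', show m - j + 1 = m + 1 - j by omega]
    congr 2
    ring
  rw [e1, e2, ← Finset.sum_add_distrib, w_eq_sum]
  refine Finset.sum_congr rfl fun j _ => ?_
  rw [← add_smul, Nat.factorial_succ]
  congr 1
  push_cast
  ring

theorem w_eq_q_pow (m : ℕ) : w k m = q k ^ m := by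
  induction m with
  | zero => simp [w]
  | succ m ih => rw [← q_mul_w, ih, pow_succ']

theorem w_mul_q (m : ℕ) : w k m * q k = w k (m + 1) := by
  rw [w_eq_q_pow, w_eq_q_pow, pow_succ]

theorem w_mul_x (m : ℕ) : w k m * x k = x k * w k m := by
  rw [w_eq_q_pow]
  exact (Commute.pow_left (q_mul_x (k := k)) m)

/-- Each `y²` that passes `x` becomes `q`, since `y² x = x q`. -/
theorem y_pow_mul_x (m : ℕ) : y k ^ (2 * m) * x k = x k * w k m := by
  induction m with
  | zero => simp [w]
  | succ m ih =>
    rw [show 2 * (m + 1) = 2 + 2 * m by ring, pow_add, mul_assoc, ih, ← q_mul_w, pow_two,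
      ← mul_assoc, ← mul_assoc]
    congr 1
    simp only [q, mul_add, mul_assoc, y_mul_y_mul_x']

theorem mon_zero_even_mul_x (m : ℕ) : mon k 0 (2 * m) * x k = x k * w k m := by
  rw [mon, pow_zero, one_mul, y_pow_mul_x]

theorem mon_succ_even_mul_x (i m : ℕ) : mon k (i + 1) (2 * m) * x k = 0 := by
  rw [mon, mul_assoc, y_pow_mul_x, pow_succ]
  simp only [mul_assoc, x_mul_x_mul', mul_zero]

theorem mon_odd_mul_x (i m : ℕ) : mon k i (2 * m + 1) * x k = tw k (i + 1) m := by
  rw [mon, mul_assoc, pow_succ', mul_assoc, y_pow_mul_x, tw, pow_succ]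
  simp only [mul_assoc]

theorem y_mul_tw (i m : ℕ) : y k * tw k (i + 1) m =
    x k * tw k i (m + 1) + (i : k) • (x k * tw k (i + 1) m) := by
  have h1 : y k * (y k * x k) ^ (i + 1) =
      x k * ((y k * x k) ^ i * (y k * y k)) + ((i : k) + 1) • (x k * (y k * x k) ^ (i + 1)) := by
    have := y_mul_mon_succ k i 0
    simpa [mon, pow_two] using this
  have h2 : y k * y k * w k m = w k (m + 1) - y k * x k * w k m := by
    rw [← q_mul_w, q, add_mul, add_sub_cancel_right]
  rw [tw, ← mul_assoc, h1, add_mul, smul_mul_assoc, mul_assoc, mul_assoc ((y k * x k) ^ i), h2,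
    mul_sub, mul_sub, tw, add_smul, one_smul, pow_succ]
  simp only [mul_assoc]
  abel

end Powers

end SuperJordan

/-! ### Independence by triangular systems of functionals. -/

theorem Finsupp.eq_zero_of_dual {k M ι : Type*} [Field k] [AddCommGroup M] [Module k M]
    {v : ι → M} {f : M →ₗ[k] k} {g : ι →₀ k} {q : ι}
    (h : ∀ p ∈ g.support, p ≠ q → f (v p) = 0) (hd : f (v q) ≠ 0)
    (hg : f (Finsupp.linearCombination k v g) = 0) : g q = 0 := by
  by_contra hq
  rw [Finsupp.linearCombination_apply, Finsupp.sum, map_sum, Finset.sum_eq_single_of_mem q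
    (Finsupp.mem_support_iff.2 hq) (fun p hp hpq => by rw [map_smul, h p hp hpq, smul_zero]),
    map_smul, smul_eq_mul, mul_eq_zero] at hg
  exact hg.elim hq hd

/-- At an index of maximal `μ` in the support, its functional sees no other term of the combination.
-/
theorem Finsupp.eq_zero_of_triangular {k M ι : Type*} [Field k] [AddCommGroup M] [Module k M]
    (μ : ι → ℕ) (v : ι → M) (f : ι → M →ₗ[k] k) (h : ∀ p q, p ≠ q → μ p ≤ μ q → f q (v p) = 0)
    (hd : ∀ p, f p (v p) ≠ 0) (g : ι →₀ k)
    (hg : ∀ q, f q (Finsupp.linearCombination k v g) = 0) : g = 0 := by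
  by_contra hne
  obtain ⟨p, hp, hmax⟩ := Finset.exists_max_image g.support μ (Finsupp.support_nonempty_iff.2 hne)
  exact Finsupp.mem_support_iff.1 hp
    (Finsupp.eq_zero_of_dual (fun q hq hqp => h q p hqp (hmax q hq)) (hd p) (hg p))

/-! ### The operators `a ↦ a x ± x a`: values, kernels, vanishing functionals. -/

namespace SuperJordan

open Hochschild

variable {k : Type*} [Field k]

@[simp] theorem divX_x_mul_mon (i c : ℕ) : divX k (x k * mon k i c) = mon k i c := by simp [divX]

theorem divX_x_mul_w (m : ℕ) : divX k (x k * w k m) = w k m := by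
  rw [← tw_zero, divX_x_mul_tw]

variable (k) in
/-- The projection onto the span of the monomials `(yx)ⁱ yᶜ`. -/
def lowProj : Plane k →ₗ[k] Plane k := onMonomials (mon k) 0

variable (k) in
/-- The map that sends `y²ᵐ` to `wₘ` and the other monomials to zero. -/
def lowW : Plane k →ₗ[k] Plane k :=
  onMonomials (fun i c => if i = 0 ∧ Even c then w k (c / 2) else 0) 0

theorem lowW_mon_zero (m : ℕ) : lowW k (mon k 0 (2 * m)) = w k m := by simp [lowW]

theorem lowW_mon_succ (i c : ℕ) : lowW k (mon k (i + 1) c) = 0 := by simp [lowW]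

theorem lowW_mon_odd (i m : ℕ) : lowW k (mon k i (2 * m + 1)) = 0 := by simp [lowW]

theorem lowW_x_mul (i c : ℕ) : lowW k (x k * mon k i c) = 0 := by simp [lowW]

theorem mon_mem_range_lowProj (i c : ℕ) : mon k i c ∈ LinearMap.range (lowProj k) :=
  ⟨mon k i c, by simp [lowProj]⟩

theorem cf₀_zero_tw_succ (c i m : ℕ) : cf₀ k 0 c (tw k (i + 1) m) = 0 := by
  simp [tw_eq_sum]

theorem lowW_lowProj (a : Plane k) : lowW k (lowProj k a) = lowW k a := by
  refine LinearMap.congr_fun (f := lowW k ∘ₗ lowProj k) (ext_monomials ?_ ?_) a <;>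
  simp [lowProj, lowW_x_mul]

theorem lowW_mem (a : Plane k) : lowW k a ∈ Submodule.span k (Set.range (w k)) := by
  refine mem_of_monomials ((Submodule.span k (Set.range (w k))).comap (lowW k)) ?_ ?_ a <;>
    intro i c
  · rw [Submodule.mem_comap, lowW, onMonomials_mon]
    split_ifs
    exacts [Submodule.subset_span ⟨_, rfl⟩, zero_mem _]
  · rw [Submodule.mem_comap, lowW_x_mul]
    exact zero_mem _

variable [CharZero k]

theorem x_mul_mul_x_of_even (i m : ℕ) : x k * mon k i (2 * m) * x k = 0 := by
  rw [mul_assoc]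
  cases i with
  | zero => rw [mon_zero_even_mul_x, x_mul_x_mul']
  | succ i => rw [mon_succ_even_mul_x, mul_zero]

section DAct

variable (ε : k)

theorem dAct_mon_zero_even (m : ℕ) :
    dAct k ε (mon k 0 (2 * m)) = x k * w k m + ε • (x k * mon k 0 (2 * m)) := by
  rw [dAct_apply, mon_zero_even_mul_x]

theorem dAct_mon_succ_even (i m : ℕ) :
    dAct k ε (mon k (i + 1) (2 * m)) = ε • (x k * mon k (i + 1) (2 * m)) := by
  rw [dAct_apply, mon_succ_even_mul_x, zero_add]

theorem dAct_mon_odd (i m : ℕ) : dAct k ε (mon k i (2 * m + 1)) =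
    tw k (i + 1) m + ε • (x k * mon k i (2 * m + 1)) := by
  rw [dAct_apply, mon_odd_mul_x]

theorem dAct_x_mul_mon_even (i m : ℕ) : dAct k ε (x k * mon k i (2 * m)) = 0 := by
  rw [dAct_apply, x_mul_mul_x_of_even, x_mul_x_mul', smul_zero, add_zero]

theorem dAct_x_mul_mon_odd (i m : ℕ) :
    dAct k ε (x k * mon k i (2 * m + 1)) = x k * tw k (i + 1) m := by
  rw [dAct_apply, mul_assoc, mon_odd_mul_x, x_mul_x_mul', smul_zero, add_zero]

end DAct

theorem dAct_neg_one_w (m : ℕ) : dAct k (-1) (w k m) = 0 := by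
  rw [dAct_apply, w_mul_x, neg_one_smul, add_neg_cancel]

theorem fAct_w (m : ℕ) : fAct k (w k m) = 0 := by
  rw [fAct_eq, dAct_neg_one_w]; simp

/-- `wₘ` is a power of `q`, so it commutes with `q` and with `x`. The identity makes `(wₘ y, wₘ)` a
cycle in even degrees. -/
theorem cAct_w (m : ℕ) : cAct k (w k m) = -dAct k 1 (w k m * y k) := by
  have h : w k m * (y k * y k) + w k m * (y k * x k) = y k * (y k * w k m) + y k * (x k * w k m) := by
    rw [← mul_add, ← mul_assoc (y k), ← mul_assoc (y k), ← add_mul]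
    exact (w_mul_q m).trans (q_mul_w m).symm
  rw [cAct_apply, dAct_apply, one_smul, ← mul_assoc (w k m) (x k), w_mul_x,
    ← mul_assoc (x k), mul_assoc (w k m), eq_sub_of_add_eq h]
  abel

/-- This identity makes `(-t y²ᵐ, x y²ᵐ)` a cycle in odd degrees from 3 on. -/
theorem cAct_x_mul_mon_zero (m : ℕ) :
    cAct k (x k * mon k 0 (2 * m)) = dAct k (-1) (mon k 1 (2 * m)) := by
  have h1 : x k * mon k 0 (2 * m) * (x k * y k) = 0 := by
    rw [← mul_assoc, x_mul_mul_x_of_even, zero_mul]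
  have h2 : x k * mon k 0 (2 * m) * (y k * y k) = x k * mon k 0 (2 * m + 2) := by
    rw [mul_assoc, ← mul_assoc (mon k _ _), mon_mul_y, mon_mul_y]
  rw [cAct_apply, h1, h2, y_mul_x_mul_mon, y_mul_mon_succ, x_mul_x_mul', mul_zero,
    dAct_mon_succ_even, Nat.cast_zero, zero_add, one_smul, neg_one_smul, zero_add]
  abel

/-! ### The kernels of `a ↦ a x ± x a` -/

theorem w_eq_add (m : ℕ) : w k m = ∑ j ∈ Finset.range m,
    ((m ! : k) / (j ! : k)) • mon k (m - 1 - j + 1) (2 * j) + mon k 0 (2 * m) := by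
  rw [w_eq_sum, Finset.sum_range_succ, Nat.sub_self,
    div_self (Nat.cast_ne_zero.2 (Nat.factorial_ne_zero _)), one_smul]
  congr 1
  refine Finset.sum_congr rfl fun j hj => ?_
  rw [show m - 1 - j + 1 = m - j by have := Finset.mem_range.1 hj; omega]

theorem lowW_w (m : ℕ) : lowW k (w k m) = w k m := by
  conv_lhs => rw [w_eq_add]
  simp [lowW_mon_succ, lowW_mon_zero]

theorem lowW_lowW (a : Plane k) : lowW k (lowW k a) = lowW k a := by
  refine ext_parity (f := lowW k ∘ₗ lowW k) ?_ ?_ ?_ ?_ a <;> intro i m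
  · cases i <;> simp [lowW_mon_zero, lowW_mon_succ, lowW_w]
  all_goals simp [lowW_mon_odd, lowW_x_mul]

/-- On the span of the `tⁱ yᶜ`, division by `x` recovers `ε a` from `ε x a`. The summand `a x` is
seen only through `y²ᵐ x = x wₘ`: for the other monomials it is zero or again lies in that span. -/
theorem divX_dAct_lowProj (ε : k) (a : Plane k) :
    divX k (dAct k ε (lowProj k a)) = lowW k a + ε • lowProj k a := by
  refine ext_parity (f := divX k ∘ₗ dAct k ε ∘ₗ lowProj k) (g := lowW k + ε • lowProj k)
    ?_ ?_ ?_ ?_ a <;> intro i m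
  · cases i
    · simp [lowProj, dAct_mon_zero_even, lowW_mon_zero, divX_x_mul_w]
    · simp [lowProj, dAct_mon_succ_even, lowW_mon_succ]
  · simp [lowProj, dAct_mon_odd, lowW_mon_odd, divX_tw]
  all_goals simp [lowProj, lowW_x_mul]

/-- Modulo the `tⁱ yᶜ`, the values of `dAct` at `tⁱ⁺¹ y²ᵐ` and `tⁱ y²ᵐ⁺¹` are `ε` times `x tⁱ⁺¹ y²ᵐ`
and `x tⁱ y²ᵐ⁺¹`. Only the `x y²ᵐ` have to be supplied by hypothesis. -/
theorem mem_range_dAct_sup (ε : k) (hε : ε * ε = 1) (S : Submodule k (Plane k))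
    (h0 : ∀ i c, mon k i c ∈ S) (h1 : ∀ m, x k * mon k 0 (2 * m) ∈ LinearMap.range (dAct k ε) ⊔ S)
    (a : Plane k) : a ∈ LinearMap.range (dAct k ε) ⊔ S := by
  have hS : ∀ s ∈ S, s ∈ LinearMap.range (dAct k ε) ⊔ S := fun s hs => Submodule.mem_sup_right hs
  have hD : ∀ b, dAct k ε b ∈ LinearMap.range (dAct k ε) ⊔ S :=
    fun b => Submodule.mem_sup_left ⟨b, rfl⟩
  refine mem_of_parity _ (fun i m => hS _ (h0 _ _)) (fun i m => hS _ (h0 _ _)) (fun i m => ?_)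
    (fun i m => ?_) a
  · cases i with
    | zero => exact h1 m
    | succ i =>
      have := Submodule.smul_mem _ ε (hD (mon k (i + 1) (2 * m)))
      rwa [dAct_mon_succ_even, smul_smul, hε, one_smul] at this
  · have ht : tw k (i + 1) m ∈ S := by
      rw [tw_eq_sum]
      exact sum_mem fun j _ => S.smul_mem _ (h0 _ _)
    have := Submodule.smul_mem _ ε (sub_mem (hD (mon k i (2 * m + 1))) (hS _ ht))
    rwa [dAct_mon_odd, add_sub_cancel_left, smul_smul, hε, one_smul] at this

/-- `x wₘ + x y²ᵐ`, the image of `y²ᵐ`, contains `x y²ᵐ` twice, and 2 is invertible. For `ε = -1`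
the two copies cancel, which is why `x y²ᵐ` survives there. -/
theorem mem_range_dAct_one_sup (a : Plane k) :
    a ∈ LinearMap.range (dAct k 1) ⊔ LinearMap.range (lowProj k) := by
  refine mem_range_dAct_sup 1 (one_mul 1) _ mon_mem_range_lowProj (fun m => ?_) a
  set T := LinearMap.range (dAct k 1) ⊔ LinearMap.range (lowProj k)
  have h1 : dAct k 1 (mon k 0 (2 * m)) ∈ T := Submodule.mem_sup_left ⟨_, rfl⟩
  have h2 : ∑ j ∈ Finset.range m,
      ((m ! : k) / (j ! : k)) • (x k * mon k (m - 1 - j + 1) (2 * j)) ∈ T :=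
    sum_mem fun j _ => T.smul_mem _ (Submodule.mem_sup_left
      ⟨mon k (m - 1 - j + 1) (2 * j), by rw [dAct_mon_succ_even, one_smul]⟩)
  have h3 := T.smul_mem (2⁻¹ : k) (sub_mem h1 h2)
  rw [dAct_mon_zero_even, w_eq_add, mul_add, Finset.mul_sum] at h3
  simp only [mul_smul_comm] at h3
  rwa [one_smul, add_assoc, add_sub_cancel_left, ← two_smul k, smul_smul,
    inv_mul_cancel₀ two_ne_zero, one_smul] at h3

/-- The kernel of `a ↦ a x - x a`. -/
theorem mem_of_dAct_neg_one_eq_zero {a : Plane k} (ha : dAct k (-1) a = 0) :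
    a ∈ Submodule.span k (Set.range (w k)) ⊔ LinearMap.range (dAct k 1) := by
  obtain ⟨_, ⟨r, rfl⟩, _, ⟨c, rfl⟩, rfl⟩ := Submodule.mem_sup.1 (mem_range_dAct_one_sup a)
  rw [map_add, dAct_dAct, zero_add] at ha
  -- Division by `x` turns the vanishing into `lowProj c = lowW c`, an element of the span of the
  -- `wₘ`.
  have h := divX_dAct_lowProj (-1) c
  rw [ha, map_zero, neg_one_smul, ← sub_eq_add_neg, eq_comm, sub_eq_zero] at h
  rw [← h, add_comm]
  exact Submodule.add_mem_sup (lowW_mem c) ⟨r, rfl⟩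

/-- The kernel of `a ↦ a x + x a`. -/
theorem mem_of_dAct_one_eq_zero {a : Plane k} (ha : dAct k 1 a = 0) :
    a ∈ Submodule.span k (Set.range fun m => x k * y k ^ (2 * m)) ⊔
      LinearMap.range (dAct k (-1)) := by
  set U := Submodule.span k (Set.range fun m => x k * y k ^ (2 * m))
  have hmem : a ∈ LinearMap.range (dAct k (-1)) ⊔ (U ⊔ LinearMap.range (lowProj k)) := by
    refine mem_range_dAct_sup (-1) (by simp) _
      (fun i c => Submodule.mem_sup_right (mon_mem_range_lowProj i c)) (fun m => ?_) a
    refine Submodule.mem_sup_right (Submodule.mem_sup_left (Submodule.subset_span ⟨m, ?_⟩))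
    simp [mon]
  obtain ⟨_, ⟨r, rfl⟩, _, hb, rfl⟩ := Submodule.mem_sup.1 hmem
  obtain ⟨u, hu, _, ⟨c, rfl⟩, rfl⟩ := Submodule.mem_sup.1 hb
  have hu0 : dAct k 1 u = 0 := by
    have : U ≤ LinearMap.ker (dAct k 1) := by
      rw [Submodule.span_le]
      rintro _ ⟨m, rfl⟩
      have := dAct_x_mul_mon_even (k := k) 1 0 m
      simpa [mon] using this
    exact this hu
  rw [map_add, map_add, hu0, zero_add, dAct_neg_dAct, zero_add] at ha
  have h := divX_dAct_lowProj 1 c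
  rw [ha, map_zero, one_smul] at h
  -- `lowW` is idempotent and ignores `lowProj`, so applying it gives `2 lowW c = 0`; then `lowProj
  -- c` vanishes too.
  have h2 := congrArg (lowW k) h
  rw [map_zero, map_add, lowW_lowW, lowW_lowProj, ← two_smul k, eq_comm,
    smul_eq_zero_iff_right two_ne_zero] at h2
  rw [h2, zero_add] at h
  rw [← h, add_zero, add_comm]
  exact Submodule.add_mem_sup hu ⟨r, rfl⟩

/-! ### Functionals -/

theorem cf₀_zero_dAct (ε : k) (c : ℕ) (a : Plane k) : cf₀ k 0 c (dAct k ε a) = 0 := by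
  refine ext_parity (f := cf₀ k 0 c ∘ₗ dAct k ε) (g := 0) ?_ ?_ ?_ ?_ a <;> intro i m
  · cases i <;> simp [dAct_mon_zero_even, dAct_mon_succ_even, cf₀_x_mul]
  · simp [dAct_mon_odd, tw_eq_sum]
  · simp [dAct_x_mul_mon_even]
  · simp [dAct_x_mul_mon_odd, cf₀_x_mul]

theorem cf₀_odd_dAct (ε : k) (i c : ℕ) (a : Plane k) :
    cf₀ k i (2 * c + 1) (dAct k ε a) = 0 := by
  refine ext_parity (f := cf₀ k i (2 * c + 1) ∘ₗ dAct k ε) (g := 0) ?_ ?_ ?_ ?_ a <;> intro i m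
  · cases i <;> simp [dAct_mon_zero_even, dAct_mon_succ_even, cf₀_x_mul]
  · simp [dAct_mon_odd, cf₀_odd_tw]
  · simp [dAct_x_mul_mon_even]
  · simp [dAct_x_mul_mon_odd, cf₀_x_mul]

theorem cf₁_x_mul_w (c m : ℕ) : cf₁ k 0 c (x k * w k m) = if 2 * m = c then 1 else 0 := by
  rw [← tw_zero, cf₁_x_mul_tw]
  obtain ⟨l, rfl | rfl⟩ := Nat.even_or_odd' c
  · rw [tw_zero, cf₀_zero_even_w]
    congr 1
    simp [eq_comm]
  · rw [cf₀_odd_tw, if_neg (by omega)]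

/-- The only values that could contribute are `x wₘ - x y²ᵐ`, and there `x y²ᵐ` cancels. -/
theorem cf₁_zero_even_dAct (l : ℕ) (a : Plane k) : cf₁ k 0 (2 * l) (dAct k (-1) a) = 0 := by
  refine ext_parity (f := cf₁ k 0 (2 * l) ∘ₗ dAct k (-1)) (g := 0) ?_ ?_ ?_ ?_ a <;> intro i m
  · cases i <;> simp [dAct_mon_zero_even, dAct_mon_succ_even, cf₁_x_mul_w]
  · simp [dAct_mon_odd, cf₁_tw]
    omega
  · simp [dAct_x_mul_mon_even]
  · simp [dAct_x_mul_mon_odd, cf₁_x_mul_tw, cf₀_zero_tw_succ]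

/-- `cAct` maps `ker D_{-1}` into `im D_1`, because it does so on each `wₘ` and commutes with `D_1`.
-/
theorem cf₀_zero_cAct (c : ℕ) {b : Plane k} (hb : dAct k (-1) b = 0) :
    cf₀ k 0 c (cAct k b) = 0 := by
  have h : Submodule.span k (Set.range (w k)) ⊔ LinearMap.range (dAct k 1) ≤
      LinearMap.ker (cf₀ k 0 c ∘ₗ cAct k) := by
    rw [sup_le_iff, Submodule.span_le]
    constructor
    · rintro _ ⟨m, rfl⟩
      simp [cAct_w, cf₀_zero_dAct]
    · rintro _ ⟨r, rfl⟩
      simp [cAct_dAct, cf₀_zero_dAct]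
  exact h (mem_of_dAct_neg_one_eq_zero hb)

theorem cf₁_zero_even_cAct (l : ℕ) {b : Plane k} (hb : dAct k 1 b = 0) :
    cf₁ k 0 (2 * l) (cAct k b) = 0 := by
  have h : Submodule.span k (Set.range fun m => x k * y k ^ (2 * m)) ⊔
      LinearMap.range (dAct k (-1)) ≤ LinearMap.ker (cf₁ k 0 (2 * l) ∘ₗ cAct k) := by
    rw [sup_le_iff, Submodule.span_le]
    constructor
    · rintro _ ⟨m, rfl⟩
      have := cf₁_zero_even_dAct l (mon k 1 (2 * m))
      rw [← cAct_x_mul_mon_zero] at this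
      simpa [mon] using this
    · rintro _ ⟨r, rfl⟩
      simp [cAct_dAct, cf₁_zero_even_dAct]
  exact h (mem_of_dAct_one_eq_zero hb)

end SuperJordan

/-! ### The map `fAct`: values, vanishing functionals, kernel. -/

namespace SuperJordan

open Hochschild

variable {k : Type*} [Field k]

theorem y_mul_x_mul_tw (i m : ℕ) : y k * (x k * tw k i m) = tw k (i + 1) m := by
  simp only [tw, pow_succ', mul_assoc]

theorem tw_mul_y (i m : ℕ) : tw k i m * y k = ∑ j ∈ Finset.range (m + 1),
    ((m ! : k) / (j ! : k)) • mon k (i + (m - j)) (2 * j + 1) := by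
  simp only [tw_eq_sum, Finset.sum_mul, smul_mul_assoc, mon_mul_y]

theorem cf₁_tw_mul_y (i c j m : ℕ) : cf₁ k i c (tw k j m * y k) = 0 := by
  simp [tw_mul_y]

theorem cf₀_zero_tw_succ_mul_y (c i m : ℕ) : cf₀ k 0 c (tw k (i + 1) m * y k) = 0 := by
  simp [tw_mul_y]

theorem cf₀_even_tw_mul_y (i c j m : ℕ) : cf₀ k i (2 * c) (tw k j m * y k) = 0 := by
  rw [tw_mul_y, map_sum]
  refine Finset.sum_eq_zero fun l _ => ?_
  rw [map_smul, cf₀_mon, if_neg (by omega), smul_zero]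

theorem divX_tw_mul_y (i m : ℕ) : divX k (x k * (tw k i m * y k)) = tw k i m * y k := by
  simp [tw_mul_y, Finset.mul_sum]

theorem cf₁_x_mul_tw_mul_y (i c j m : ℕ) :
    cf₁ k i c (x k * (tw k j m * y k)) = cf₀ k i c (tw k j m * y k) := by
  rw [cf₁_eq_cf₀_divX, divX_tw_mul_y]

variable [CharZero k]

/-! ### The map `fAct` on monomials -/

theorem fAct_mon_succ_even (i m : ℕ) : fAct k (mon k (i + 1) (2 * m)) =
    x k * mon k (i + 1) (2 * m + 1) + mon k (i + 2) (2 * m) := by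
  rw [fAct_eq, dAct_mon_succ_even, neg_one_smul, mul_neg, neg_mul, mul_neg, y_mul_x_mul_mon,
    x_mul_x_mul', mul_assoc, mon_mul_y]
  abel

theorem fAct_x_mul_mon_odd (i m : ℕ) : fAct k (x k * mon k i (2 * m + 1)) =
    -(tw k (i + 2) m + x k * (tw k (i + 1) m * y k)) := by
  rw [fAct_eq, dAct_x_mul_mon_odd, x_mul_x_mul', add_zero, mul_assoc, y_mul_x_mul_tw]

theorem fAct_mon_odd (i m : ℕ) : fAct k (mon k i (2 * m + 1)) =
    x k * mon k i (2 * m + 2) + mon k (i + 1) (2 * m + 1) - x k * tw k i (m + 1) -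
      ((i : k) + 1) • (x k * tw k (i + 1) m) - tw k (i + 1) m * y k := by
  rw [fAct_eq, dAct_mon_odd, neg_one_smul]
  simp only [mul_add, mul_neg, add_mul, neg_mul, x_mul_x_mul', y_mul_x_mul_mon, mul_assoc,
    mon_mul_y, y_mul_tw, add_smul, one_smul]
  abel

theorem fAct_x_mul_mon_even (i m : ℕ) : fAct k (x k * mon k i (2 * m)) = 0 := by
  rw [fAct_eq, dAct_x_mul_mon_even]
  simp

/-- A subspace contains the range of `fAct` if it contains the values on the monomials other than
`y²ᵐ` and `x (yx)ⁱ y²ᵐ`. -/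
theorem fAct_mem (S : Submodule k (Plane k)) (h0 : ∀ i m, fAct k (mon k (i + 1) (2 * m)) ∈ S)
    (h1 : ∀ i m, fAct k (mon k i (2 * m + 1)) ∈ S)
    (h2 : ∀ i m, fAct k (x k * mon k i (2 * m + 1)) ∈ S) (b : Plane k) : fAct k b ∈ S := by
  refine mem_of_parity (S.comap (fAct k)) (fun i m => ?_) h1 (fun i m => ?_) h2 b
  · cases i with
    | zero =>
      -- `fAct` kills `wₘ`, whose last term is `y²ᵐ`; its value at `y²ᵐ` is thus minus that at the
      -- other terms.
      have h := fAct_w (k := k) m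
      rw [w_eq_add, map_add, map_sum] at h
      rw [Submodule.mem_comap, eq_neg_of_add_eq_zero_right h]
      refine neg_mem (sum_mem fun j _ => ?_)
      rw [map_smul]
      exact S.smul_mem _ (h0 _ _)
    | succ i => exact h0 i m
  · rw [Submodule.mem_comap, fAct_x_mul_mon_even]
    exact zero_mem _

theorem cf₀_zero_fAct (c : ℕ) (b : Plane k) : cf₀ k 0 c (fAct k b) = 0 := by
  refine fAct_mem (LinearMap.ker (cf₀ k 0 c)) (fun i m => ?_) (fun i m => ?_) (fun i m => ?_) b <;>
    rw [LinearMap.mem_ker]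
  · simp [fAct_mon_succ_even]
  · simp [fAct_mon_odd, cf₀_zero_tw_succ_mul_y, cf₀_x_mul]
  · simp [fAct_x_mul_mon_odd, cf₀_x_mul, cf₀_zero_tw_succ]

/-- In the value at `y²ᵐ⁺¹` the monomial `x y²ᵐ⁺²` cancels against the last term of `x wₘ₊₁`. -/
theorem cf₁_zero_fAct (c : ℕ) (b : Plane k) : cf₁ k 0 c (fAct k b) = 0 := by
  refine fAct_mem (LinearMap.ker (cf₁ k 0 c)) (fun i m => ?_) (fun i m => ?_) (fun i m => ?_) b <;>
    rw [LinearMap.mem_ker]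
  · simp [fAct_mon_succ_even]
  · cases i
    · simp [fAct_mon_odd, cf₁_tw_mul_y, cf₁_x_mul_tw, cf₀_zero_tw_succ, tw_zero,
        cf₁_x_mul_w, mul_add]
    · simp [fAct_mon_odd, cf₁_tw_mul_y, cf₁_x_mul_tw, cf₀_zero_tw_succ]
  · simp [fAct_x_mul_mon_odd, cf₁_tw, cf₁_x_mul_tw_mul_y, cf₀_zero_tw_succ_mul_y]

/-! ### The kernel of `fAct` -/

/-- The same expression governs `fAct` at `tⁱ y²ᵐ⁺¹` (`s = 0`) and, after `twist`, `adY` at `tⁱ⁺¹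
y²ᵐ⁺¹` (`s = 1`). Its first monomial cancels the last term of `wₘ₊₁`, so only powers of `y` up to
`y²ᵐ` remain. At `y²ᵐ` the coefficient is `-(m + 1) - (i + 1)`, nonzero in characteristic zero. -/
theorem cf₀_upper {i j m l : ℕ} (hle : m ≤ l) (hne : ¬ (i = j ∧ m = l)) (s : ℕ) :
    cf₀ k (j + 1 + s) (2 * l) (mon k (i + s) (2 * m + 2) - tw k (i + s) (m + 1) -
      ((i : k) + 1) • tw k (i + 1 + s) m) = 0 := by
  have h3 : ¬ (l ≤ m ∧ j + 1 + s = i + 1 + s + (m - l)) := by omega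
  simp only [map_sub, map_smul, cf₀_mon, cf₀_even_tw, if_neg h3, smul_zero, sub_zero]
  by_cases h1 : i = j + 1 ∧ l = m + 1
  · obtain ⟨rfl, rfl⟩ := h1
    rw [if_pos (by omega), if_pos (by omega),
      div_self (Nat.cast_ne_zero.2 (Nat.factorial_ne_zero _)), sub_self]
  · rw [if_neg (by omega), if_neg (by omega), sub_zero]

theorem cf₀_diag_ne_zero (i m s : ℕ) :
    cf₀ k (i + 1 + s) (2 * m) (mon k (i + s) (2 * m + 2) - tw k (i + s) (m + 1) -
      ((i : k) + 1) • tw k (i + 1 + s) m) ≠ 0 := by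
  have hm : (m ! : k) ≠ 0 := Nat.cast_ne_zero.2 (Nat.factorial_ne_zero _)
  simp only [map_sub, map_smul, cf₀_mon, cf₀_even_tw]
  rw [if_neg (by omega), if_pos (by omega), if_pos (by omega), div_self hm, Nat.factorial_succ,
    Nat.cast_mul, mul_div_assoc, div_self hm, mul_one, smul_eq_mul, mul_one, zero_sub, ← neg_add',
    neg_ne_zero]
  exact_mod_cast (by omega : m + 1 + (i + 1) ≠ 0)

variable (k) in
/-- The monomials `(yx)ⁱ⁺¹ y²ᵐ` and `(yx)ⁱ y²ᵐ⁺¹`. -/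
def lowMon : (ℕ × ℕ) ⊕ (ℕ × ℕ) → Plane k :=
  Sum.elim (fun p => mon k (p.1 + 1) (2 * p.2)) (fun p => mon k p.1 (2 * p.2 + 1))

theorem lowProj_sub_lowW_mem (a : Plane k) :
    lowProj k a - lowW k a ∈ Submodule.span k (Set.range (lowMon k)) := by
  have h0 : ∀ i m, mon k (i + 1) (2 * m) ∈ Submodule.span k (Set.range (lowMon k)) :=
    fun i m => Submodule.subset_span ⟨Sum.inl (i, m), rfl⟩
  refine mem_of_parity ((Submodule.span k (Set.range (lowMon k))).comap (lowProj k - lowW k))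
    (fun i m => ?_) (fun i m => ?_) (fun i m => ?_) (fun i m => ?_) a <;>
    rw [Submodule.mem_comap, LinearMap.sub_apply]
  · cases i with
    | zero =>
      rw [lowW_mon_zero, lowProj, onMonomials_mon, w_eq_add, sub_add_cancel_right]
      exact neg_mem (sum_mem fun j _ => Submodule.smul_mem _ _ (h0 _ _))
    | succ i =>
      rw [lowW_mon_succ, lowProj, onMonomials_mon, sub_zero]
      exact h0 _ _
  · rw [lowW_mon_odd, lowProj, onMonomials_mon, sub_zero]
    exact Submodule.subset_span ⟨Sum.inr (i, m), rfl⟩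
  all_goals
    rw [lowW_x_mul, lowProj, onMonomials_x_mul_mon, sub_zero]
    exact zero_mem _

/-- The system is triangular for the exponent `m`. The two families of monomials do not interfere,
because the functionals of one meet the values of the other at powers of `y` of the wrong parity. -/
theorem eq_zero_of_fAct_lowMon (g : (ℕ × ℕ) ⊕ (ℕ × ℕ) →₀ k)
    (hg : fAct k (Finsupp.linearCombination k (lowMon k) g) = 0) : g = 0 := by
  refine Finsupp.eq_zero_of_triangular (Sum.elim Prod.snd Prod.snd) (fun p => fAct k (lowMon k p))
    (Sum.elim (fun p => cf₀ k (p.1 + 2) (2 * p.2)) (fun p => cf₁ k (p.1 + 1) (2 * p.2))) ?_ ?_ g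
    (fun q => ?_)
  · rintro (⟨i, m⟩ | ⟨i, m⟩) (⟨j, l⟩ | ⟨j, l⟩) hne hle
    · have : ¬ (i = j ∧ m = l) := by simpa using hne
      simpa [lowMon, fAct_mon_succ_even, cf₀_x_mul] using this
    · simp [lowMon, fAct_mon_succ_even]
      omega
    · simp [lowMon, fAct_mon_odd, cf₀_x_mul, cf₀_even_tw_mul_y]
      omega
    · have : ¬ (i = j ∧ m = l) := by simpa using hne
      rw [← cf₀_upper hle this 0]
      simp [lowMon, fAct_mon_odd, cf₁_tw_mul_y, cf₁_x_mul_tw]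
  · rintro (⟨i, m⟩ | ⟨i, m⟩)
    · simp [lowMon, fAct_mon_succ_even, cf₀_x_mul]
    · refine ne_of_eq_of_ne ?_ (cf₀_diag_ne_zero i m 0)
      simp [lowMon, fAct_mon_odd, cf₁_tw_mul_y, cf₁_x_mul_tw]
  · have : Finsupp.linearCombination k (fun p => fAct k (lowMon k p)) g = 0 := by
      rw [← hg, Finsupp.apply_linearCombination]; rfl
    rw [this, map_zero]

/-- Modulo `im D_1`, which both maps kill, `b` may be taken in the span of the `tⁱ yᶜ`. Subtracting
a combination of the `wₘ`, also killed by both, leaves a combination of `lowMon`, where `fAct` is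
injective. -/
theorem dAct_eq_zero_of_fAct_eq_zero {b : Plane k} (hb : fAct k b = 0) : dAct k (-1) b = 0 := by
  obtain ⟨_, ⟨r, rfl⟩, _, ⟨c, rfl⟩, rfl⟩ := Submodule.mem_sup.1 (mem_range_dAct_one_sup b)
  have hw : Submodule.span k (Set.range (w k)) ≤
      LinearMap.ker (fAct k) ⊓ LinearMap.ker (dAct k (-1)) := by
    rw [Submodule.span_le]
    rintro _ ⟨m, rfl⟩
    exact ⟨fAct_w m, dAct_neg_one_w m⟩
  obtain ⟨h1, h2⟩ := hw (lowW_mem c)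
  obtain ⟨g, hg⟩ := Finsupp.mem_span_range_iff_exists_finsupp.1 (lowProj_sub_lowW_mem c)
  replace h1 : fAct k (lowW k c) = 0 := h1
  replace h2 : dAct k (-1) (lowW k c) = 0 := h2
  rw [map_add, fAct_dAct, zero_add] at hb
  have h3 := eq_zero_of_fAct_lowMon g (by
    rw [Finsupp.linearCombination_apply, hg, map_sub, hb, h1, sub_zero])
  rw [h3, Finsupp.sum_zero_index, eq_comm, sub_eq_zero] at hg
  rw [map_add, dAct_dAct, hg, h2, zero_add]

end SuperJordan

/-! ### Degrees zero and one: commutators with `y`. -/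

namespace SuperJordan

open Hochschild

variable {k : Type*} [Field k]

/-! ### The commutator with `y` on monomials -/

theorem adY_mon_zero (c : ℕ) : adY k (mon k 0 c) = 0 := by
  rw [adY_apply, mon_mul_y, y_mul_mon_zero, sub_self]

theorem adY_mon_succ (i c : ℕ) : adY k (mon k (i + 1) c) =
    mon k (i + 1) (c + 1) - x k * mon k i (c + 2) - ((i : k) + 1) • (x k * mon k (i + 1) c) := by
  rw [adY_apply, mon_mul_y, y_mul_mon_succ, sub_sub]

theorem adY_x_mul_mon (i c : ℕ) :
    adY k (x k * mon k i c) = x k * mon k i (c + 1) - mon k (i + 1) c := by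
  rw [adY_apply, mul_assoc, mon_mul_y, y_mul_x_mul_mon]

/-! ### Degree zero -/

variable (k) in
/-- A functional which vanishes on commutators and is dual to `x yⁿ`. -/
def traceX : ℕ → Plane k →ₗ[k] k
  | 0 => cf₁ k 0 0
  | n + 1 => cf₁ k 0 (n + 1) + cf₀ k 1 n

theorem traceX_mon (n i c : ℕ) :
    traceX k n (mon k i c) = if i = 1 ∧ c + 1 = n then 1 else 0 := by
  cases n <;> simp [traceX]

theorem traceX_x_mul_mon (n i c : ℕ) :
    traceX k n (x k * mon k i c) = if i = 0 ∧ c = n then 1 else 0 := by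
  cases n <;> simp [traceX]

theorem traceX_adY (n : ℕ) (a : Plane k) : traceX k n (adY k a) = 0 := by
  refine LinearMap.congr_fun (f := traceX k n ∘ₗ adY k) (g := 0)
    (ext_monomials (fun i c => ?_) (fun i c => ?_)) a
  · cases i
    · simp [adY_mon_zero]
    · simp [adY_mon_succ, traceX_mon, traceX_x_mul_mon]
  · simp [adY_x_mul_mon, traceX_mon, traceX_x_mul_mon]

theorem cf₀_zero_adY (n : ℕ) (a : Plane k) : cf₀ k 0 n (adY k a) = 0 := by
  refine LinearMap.congr_fun (f := cf₀ k 0 n ∘ₗ adY k) (g := 0)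
    (ext_monomials (fun i c => ?_) (fun i c => ?_)) a
  · cases i
    · simp [adY_mon_zero]
    · simp [adY_mon_succ]
  · simp [adY_x_mul_mon]

variable (k) in
/-- The monomials `(yx)ⁱ⁺¹ yᶜ`, separated by the parity of `c`. -/
def commMon : (ℕ × ℕ) ⊕ (ℕ × ℕ) → Plane k :=
  Sum.elim (fun p => mon k (p.1 + 1) (2 * p.2)) (fun p => mon k (p.1 + 1) (2 * p.2 + 1))

variable (k) in
/-- A map that vanishes on the commutators with `x`. -/
def twist : Plane k →ₗ[k] Plane k :=
  onMonomials (fun i c => if Even c then mon k i c else 0)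
    (fun i c => if Even c then 0 else tw k (i + 1) (c / 2))

theorem twist_mon_even (i m : ℕ) : twist k (mon k i (2 * m)) = mon k i (2 * m) := by simp [twist]

theorem twist_mon_odd (i m : ℕ) : twist k (mon k i (2 * m + 1)) = 0 := by simp [twist]

theorem twist_x_mul_mon_even (i m : ℕ) : twist k (x k * mon k i (2 * m)) = 0 := by simp [twist]

theorem twist_x_mul_mon_odd (i m : ℕ) :
    twist k (x k * mon k i (2 * m + 1)) = tw k (i + 1) m := by
  simp [twist, show (2 * m + 1) / 2 = m by omega]

theorem twist_tw (i m : ℕ) : twist k (tw k i m) = tw k i m := by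
  simp [tw_eq_sum, twist_mon_even]

theorem twist_x_mul_tw (i m : ℕ) : twist k (x k * tw k i m) = 0 := by
  simp [tw_eq_sum, Finset.mul_sum, twist_x_mul_mon_even]

theorem adY_fAct_mem (b : Plane k) : adY k (fAct k b) ∈ LinearMap.range (dAct k (-1)) :=
  ⟨-cAct k b, by rw [map_neg]; exact neg_eq_of_add_eq_zero_right (dAct_cAct_add b)⟩

theorem twist_x_mul_w (m : ℕ) : twist k (x k * w k m) = 0 := by
  rw [← tw_zero, twist_x_mul_tw]

variable [CharZero k]

theorem traceX_dAct (n : ℕ) (a : Plane k) : traceX k n (dAct k (-1) a) = 0 := by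
  have h1 : ∀ m, traceX k n (x k * w k m) = if 2 * m = n then 1 else 0 := by
    intro m
    cases n <;> simp [traceX, cf₁_x_mul_w, cf₀_x_mul]
  have h2 : ∀ i m, traceX k n (x k * tw k (i + 1) m) = 0 := by
    intro i m
    cases n <;> simp [traceX, cf₁_x_mul_tw, cf₀_x_mul, cf₀_zero_tw_succ]
  have h3 : ∀ i m, traceX k n (tw k (i + 1) m) = if i = 0 ∧ 2 * m + 1 = n then 1 else 0 := by
    intro i m
    rcases n with _ | n
    · simp [traceX, cf₁_tw]
    · obtain ⟨l, rfl | rfl⟩ := Nat.even_or_odd' n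
      · simp only [traceX, LinearMap.add_apply, cf₁_tw, cf₀_even_tw, zero_add]
        by_cases h : i = 0 ∧ m = l
        · rw [if_pos (by omega), if_pos (by omega), h.2,
            div_self (Nat.cast_ne_zero.2 (Nat.factorial_ne_zero _))]
        · rw [if_neg (by omega), if_neg (by omega)]
      · rw [if_neg (by omega)]
        simp [traceX, cf₁_tw, cf₀_odd_tw]
  refine ext_parity (f := traceX k n ∘ₗ dAct k (-1)) (g := 0) ?_ ?_ ?_ ?_ a <;> intro i m
  · cases i <;> simp [dAct_mon_zero_even, dAct_mon_succ_even, h1, traceX_x_mul_mon]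
  · simp [dAct_mon_odd, h3, traceX_x_mul_mon]
  · simp [dAct_x_mul_mon_even]
  · simp [dAct_x_mul_mon_odd, h2]

/-- The monomials `x yⁿ` and `yⁿ` span the plane modulo commutators. -/
theorem mem_of_commutators_mem (S : Submodule k (Plane k)) (h0 : ∀ n, x k * y k ^ n ∈ S)
    (h1 : ∀ n, y k ^ n ∈ S) (h2 : ∀ b, adY k b ∈ S) (a : Plane k) : a ∈ S := by
  have h3 : ∀ i c, x k * mon k i c ∈ S := by
    intro i c
    cases i with
    | zero => simpa [mon] using h0 c
    | succ i =>
      -- These two commutators add up to `-(i + 1) x tⁱ⁺¹ yᶜ`.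
      have h := add_mem (h2 (mon k (i + 1) c)) (h2 (x k * mon k i (c + 1)))
      rw [adY_mon_succ, adY_x_mul_mon] at h
      have hi : -((i : k) + 1) ≠ 0 := neg_ne_zero.2 (Nat.cast_add_one_ne_zero i)
      refine (S.smul_mem_iff hi).1 ?_
      convert h using 1
      module
  refine mem_of_monomials S (fun i c => ?_) h3 a
  cases i with
  | zero => simpa [mon] using h1 c
  | succ i =>
    have h := sub_mem (h3 i (c + 1)) (h2 (x k * mon k i c))
    rwa [adY_x_mul_mon, sub_sub_cancel] at h

/-! ### Degree one -/

theorem dAct_add_adY_y_pow (m : ℕ) :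
    dAct k (-1) (-(y k * x k * y k ^ (2 * m))) +
      adY k (x k * y k ^ (2 * m + 1) + y k * x k * y k ^ (2 * m)) = 0 := by
  have e1 : y k * x k * y k ^ (2 * m) = mon k 1 (2 * m) := by simp [mon]
  have e2 : x k * y k ^ (2 * m + 1) = x k * mon k 0 (2 * m + 1) := by simp [mon]
  rw [e1, e2, map_neg, dAct_mon_succ_even, map_add, adY_x_mul_mon, adY_mon_succ]
  simp only [Nat.cast_zero, zero_add, one_smul, neg_one_smul, neg_neg]
  abel

variable (k) in
/-- The second components of the cycles in degree one. -/
def cycleSnd : ℕ ⊕ (ℕ ⊕ ℕ) → Plane k :=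
  Sum.elim (cycle₁Aux k) (Sum.elim (fun n => y k ^ n)
    (fun n => x k * y k ^ (2 * n + 1) + y k * x k * y k ^ (2 * n)))

/-- This isolates `x y²ⁿ`, with coefficient `n + 1`; all other terms contain a positive power of
`t`. -/
theorem cycle₁Aux_eq (n : ℕ) : cycle₁Aux k n =
    ∑ i ∈ Finset.range n, ((n ! : k) / (i ! : k) * ((n + 1 : k) / ((n : k) - i + 1))) •
      (x k * mon k (n - 1 - i + 1) (2 * i)) + ((n : k) + 1) • (x k * mon k 0 (2 * n)) +
    ∑ i ∈ Finset.range n, ((n ! : k) / (i ! : k) * (1 / ((n : k) - i))) •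
      mon k (n - 1 - i + 1) (2 * i + 1) := by
  have hn : (n ! : k) ≠ 0 := Nat.cast_ne_zero.2 (Nat.factorial_ne_zero _)
  rw [cycle₁Aux, Finset.sum_range_succ, Nat.sub_self, div_self hn, sub_self, zero_add, div_one,
    one_mul, pow_zero, mul_one, mon, pow_zero, one_mul]
  congr 1
  · congr 1
    refine Finset.sum_congr rfl fun i hi => ?_
    rw [show n - 1 - i + 1 = n - i by have := Finset.mem_range.1 hi; omega, mon, mul_assoc]
  · refine Finset.sum_congr rfl fun i hi => ?_
    rw [show n - 1 - i + 1 = n - i by have := Finset.mem_range.1 hi; omega, mon]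

/-- Given the `tⁱ⁺¹ yᶜ`, the values of `fAct` supply `x tⁱ⁺¹ yᶜ`: directly for odd `c`, and for `c =
2m` by induction on `m`. The pure monomials `yᶜ` and `x yᶜ` then come from the cycles. -/
theorem mem_of_fAct_mem (S : Submodule k (Plane k)) (h0 : ∀ j, cycleSnd k j ∈ S)
    (h1 : ∀ i c, mon k (i + 1) c ∈ S) (h2 : ∀ b, fAct k b ∈ S) (a : Plane k) : a ∈ S := by
  have hodd : ∀ i m, x k * mon k i (2 * m + 1) ∈ S := by
    intro i m
    cases i with
    | zero =>
      have h := sub_mem (h0 (Sum.inr (Sum.inr m))) (h1 0 (2 * m))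
      simpa [cycleSnd, mon] using h
    | succ i =>
      have h := sub_mem (h2 (mon k (i + 1) (2 * m))) (h1 (i + 1) (2 * m))
      rwa [fAct_mon_succ_even, add_sub_cancel_right] at h
  have heven : ∀ m i, x k * mon k (i + 1) (2 * m) ∈ S := by
    intro m
    induction m using Nat.strong_induction_on with
    | _ m ih =>
    intro i
    have hm : (m ! : k) ≠ 0 := Nat.cast_ne_zero.2 (Nat.factorial_ne_zero _)
    have ht : tw k (i + 1) m * y k ∈ S := by
      rw [tw_mul_y]
      refine sum_mem fun j _ => S.smul_mem _ ?_
      rw [show i + 1 + (m - j) = i + (m - j) + 1 by omega]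
      exact h1 _ _
    -- The last term of `wₘ₊₁` cancels and the last but one has coefficient `m + 1`; the earlier
    -- ones are covered by induction. With `e2`, the value at `tⁱ y²ᵐ⁺¹` determines `x tⁱ⁺¹ y²ᵐ` up
    -- to the factor `m + 1 + (i + 1)`.
    have e1 : x k * mon k i (2 * m + 2) - x k * tw k i (m + 1) +
        ((m : k) + 1) • (x k * mon k (i + 1) (2 * m)) ∈ S := by
      rw [tw_eq_sum, Finset.sum_range_succ, Finset.sum_range_succ, Nat.factorial_succ]
      have : ((m + 1 : ℕ) * m ! : ℕ) / (m ! : k) = (m : k) + 1 := by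
        push_cast
        field_simp
      rw [this, ← Nat.factorial_succ, div_self (Nat.cast_ne_zero.2 (Nat.factorial_ne_zero _)),
        one_smul, mul_add, mul_add, mul_smul_comm, Nat.sub_self, add_zero,
        show m + 1 - m = 1 by omega, show 2 * (m + 1) = 2 * m + 2 by ring]
      have hs : x k * ∑ j ∈ Finset.range m, (((m + 1)! : ℕ) / (j ! : k)) •
          mon k (i + (m + 1 - j)) (2 * j) ∈ S := by
        rw [Finset.mul_sum]
        refine sum_mem fun j hj => ?_
        have hj' := Finset.mem_range.1 hj
        rw [mul_smul_comm, show i + (m + 1 - j) = i + (m - j) + 1 by omega]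
        exact S.smul_mem _ (ih j hj' _)
      convert neg_mem hs using 1
      abel
    have e2 : x k * tw k (i + 1) m - x k * mon k (i + 1) (2 * m) ∈ S := by
      rw [tw_eq_sum, Finset.sum_range_succ, div_self hm, one_smul, Nat.sub_self, add_zero, mul_add,
        add_sub_cancel_right, Finset.mul_sum]
      refine sum_mem fun j hj => ?_
      rw [mul_smul_comm, show i + 1 + (m - j) = i + (m - j) + 1 by omega]
      exact S.smul_mem _ (ih j (Finset.mem_range.1 hj) _)
    have h := h2 (mon k i (2 * m + 1))
    rw [fAct_mon_odd] at h
    have hc : (m : k) + 1 + (i + 1) ≠ 0 := by exact_mod_cast (by omega : m + 1 + (i + 1) ≠ 0)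
    refine (S.smul_mem_iff hc).1 ?_
    have h' := sub_mem (sub_mem (add_mem (sub_mem e1 h) (h1 i (2 * m + 1)))
      (S.smul_mem ((i : k) + 1) e2)) ht
    convert h' using 1
    module
  refine mem_of_parity S (fun i m => ?_) (fun i m => ?_) (fun i m => ?_) hodd a
  · cases i with
    | zero => simpa [cycleSnd, mon] using h0 (Sum.inr (Sum.inl (2 * m)))
    | succ i => exact h1 _ _
  · cases i with
    | zero => simpa [cycleSnd, mon] using h0 (Sum.inr (Sum.inl (2 * m + 1)))
    | succ i => exact h1 _ _
  · cases i with
    | zero =>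
      have h := h0 (Sum.inl m)
      rw [cycleSnd, Sum.elim_inl, cycle₁Aux_eq] at h
      have hs1 := sum_mem (t := Finset.range m) fun j _ => S.smul_mem
        ((m ! : k) / (j ! : k) * ((m + 1 : k) / ((m : k) - j + 1))) (heven j (m - 1 - j))
      have hs2 := sum_mem (t := Finset.range m) fun j _ => S.smul_mem
        ((m ! : k) / (j ! : k) * (1 / ((m : k) - j))) (h1 (m - 1 - j) (2 * j + 1))
      have h' := sub_mem (sub_mem h hs2) hs1
      rw [add_sub_cancel_right, add_sub_cancel_left] at h'
      exact (S.smul_mem_iff (Nat.cast_add_one_ne_zero m)).1 h'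
    | succ i => exact heven m i

variable (k) in
/-- Functionals dual to the second components of the cycles in degree one. -/
def dualSnd : ℕ ⊕ (ℕ ⊕ ℕ) → Plane k →ₗ[k] k :=
  -- The factor normalizes the coefficient `n + 1` of `x y²ⁿ` in `cycle₁Aux k n`.
  Sum.elim (fun n => ((n : k) + 1)⁻¹ • cf₁ k 0 (2 * n))
    (Sum.elim (fun n => cf₀ k 0 n) (fun n => cf₁ k 0 (2 * n + 1)))

theorem dualSnd_fAct (j : ℕ ⊕ (ℕ ⊕ ℕ)) (b : Plane k) : dualSnd k j (fAct k b) = 0 := by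
  rcases j with n | n | n <;> simp [dualSnd, cf₀_zero_fAct, cf₁_zero_fAct]

theorem dualSnd_cycleSnd (i j : ℕ ⊕ (ℕ ⊕ ℕ)) :
    dualSnd k j (cycleSnd k i) = if i = j then 1 else 0 := by
  have e1 : ∀ n, y k ^ n = mon k 0 n := fun n => by simp [mon]
  have e2 : ∀ n, y k * x k * y k ^ (2 * n) = mon k 1 (2 * n) := fun n => by simp [mon]
  have e3 : ∀ n, y k * x k * mon k 0 (2 * n) = mon k 1 (2 * n) := fun n => by simp [mon]
  have hl : ∀ l : ℕ, (l : k) + 1 ≠ 0 := Nat.cast_add_one_ne_zero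
  rcases i with n | n | n <;> rcases j with l | l | l <;>
    simp [cycleSnd, dualSnd, cycle₁Aux_eq, e1, e3, cf₀_x_mul]
  · split_ifs with h
    · rw [h, inv_mul_cancel₀ (hl l)]
    · rfl
  all_goals omega

/-- With `Xᵢ = x tⁿ⁻ⁱ y²ⁱ⁺¹` and `Yᵢ = tⁿ⁻ⁱ⁺¹ y²ⁱ`, the commutators of the two kinds of terms are
`Xᵢ - Yᵢ` and `Yᵢ₊₁ - Xᵢ₊₁ - (n - i) Xᵢ`. After an index shift the rational coefficients combine by
`(n + 1) - i = n - i + 1`, and the sum collapses. -/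
theorem dAct_add_adY_cycle₁Aux (n : ℕ) :
    dAct k (-1) (y k ^ (2 * n + 1)) + adY k (cycle₁Aux k n) = 0 := by
  have hf : ∀ i : ℕ, (i ! : k) ≠ 0 := fun i => Nat.cast_ne_zero.2 (Nat.factorial_ne_zero _)
  have hsub : ∀ i ∈ Finset.range n, (n : k) - i ≠ 0 := fun i hi =>
    sub_ne_zero.2 (Nat.cast_injective.ne (Finset.mem_range.1 hi).ne')
  set X : ℕ → Plane k := fun i => x k * mon k (n - i) (2 * i + 1)
  set Y : ℕ → Plane k := fun i => mon k (n - i + 1) (2 * i)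
  have e0 : dAct k (-1) (y k ^ (2 * n + 1)) =
      ∑ i ∈ Finset.range (n + 1), ((n ! : k) / (i ! : k)) • Y i - X n := by
    have : y k ^ (2 * n + 1) = mon k 0 (2 * n + 1) := by simp [mon]
    rw [this, dAct_mon_odd, neg_one_smul, tw_eq_sum, ← sub_eq_add_neg]
    simp only [X, Y, Nat.sub_self, zero_add, add_comm 1]
  have e1 : adY k (cycle₁Aux k n) = ∑ i ∈ Finset.range (n + 1),
      ((n ! : k) / (i ! : k) * ((n + 1 : k) / ((n : k) - i + 1))) • (X i - Y i) +
      ∑ i ∈ Finset.range n, ((n ! : k) / (i ! : k) * (1 / ((n : k) - i))) • (Y (i + 1) - X (i + 1))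
      - ∑ i ∈ Finset.range n, ((n ! : k) / (i ! : k)) • X i := by
    rw [cycle₁Aux, map_add, map_sum, map_sum, add_sub_assoc, ← Finset.sum_sub_distrib]
    congr 1
    · refine Finset.sum_congr rfl fun i _ => ?_
      rw [map_smul, mul_assoc, ← mon, adY_x_mul_mon]
    · refine Finset.sum_congr rfl fun i hi => ?_
      have hi' := Finset.mem_range.1 hi
      obtain ⟨l, hl⟩ : ∃ l, n - i = l + 1 := ⟨n - i - 1, by omega⟩
      have hl' : (n : k) - i = l + 1 := by
        rw [← Nat.cast_sub hi'.le, hl, Nat.cast_succ]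
      have hl0 : (l : k) + 1 ≠ 0 := Nat.cast_add_one_ne_zero l
      rw [map_smul, ← mon]
      simp only [X, Y, hl, hl', show n - (i + 1) = l by omega]
      rw [adY_mon_succ, smul_sub, smul_smul, mul_assoc, one_div, inv_mul_cancel₀ hl0, mul_one]
      rfl
  have e2 : ∑ i ∈ Finset.range n,
      ((n ! : k) / (i ! : k) * (1 / ((n : k) - i))) • (Y (i + 1) - X (i + 1)) =
      ∑ i ∈ Finset.range (n + 1), ((n ! : k) / (i ! : k) * (i / ((n : k) - i + 1))) •
        (Y i - X i) := by
    rw [Finset.sum_range_succ' _ n]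
    simp only [Nat.cast_zero, zero_div, mul_zero, zero_smul, add_zero]
    refine Finset.sum_congr rfl fun i hi => ?_
    congr 1
    have := Nat.cast_add_one_ne_zero (R := k) i
    have h1 : (n : k) - (i + 1) + 1 = n - i := by ring
    rw [Nat.factorial_succ]
    push_cast
    rw [h1]
    field_simp [hf i, hsub i hi]
  have e3 : ∑ i ∈ Finset.range n, ((n ! : k) / (i ! : k)) • X i =
      ∑ i ∈ Finset.range (n + 1), ((n ! : k) / (i ! : k)) • X i - X n := by
    rw [Finset.sum_range_succ, div_self (hf n), one_smul, add_sub_cancel_right]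
  have e4 : ∑ i ∈ Finset.range (n + 1),
      ((n ! : k) / (i ! : k) * ((n + 1 : k) / ((n : k) - i + 1))) • (X i - Y i) =
      ∑ i ∈ Finset.range (n + 1), ((n ! : k) / (i ! : k)) • (X i - Y i) -
      ∑ i ∈ Finset.range (n + 1), ((n ! : k) / (i ! : k) * (i / ((n : k) - i + 1))) •
        (Y i - X i) := by
    rw [← Finset.sum_sub_distrib]
    refine Finset.sum_congr rfl fun i hi => ?_
    have h1 : (n : k) - i + 1 ≠ 0 := by
      rw [← Nat.cast_sub (Nat.lt_succ_iff.1 (Finset.mem_range.1 hi))]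
      exact Nat.cast_add_one_ne_zero _
    have h2 : (n + 1 : k) / ((n : k) - i + 1) = 1 + i / ((n : k) - i + 1) := by
      field_simp
      ring
    rw [h2]
    module
  rw [e0, e1, e2, e3, e4]
  simp only [smul_sub, Finset.sum_sub_distrib]
  abel

theorem twist_dAct (a : Plane k) : twist k (dAct k (-1) a) = 0 := by
  suffices h : (twist k ∘ₗ dAct k (-1)) a = (0 : Plane k →ₗ[k] Plane k) a from
    h.trans (LinearMap.zero_apply a)
  refine ext_parity ?_ ?_ ?_ ?_ a <;> intro i m
  · cases i <;> simp [dAct_mon_zero_even, dAct_mon_succ_even, twist_x_mul_mon_even, twist_x_mul_w]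
  · simp [dAct_mon_odd, twist_tw, twist_x_mul_mon_odd]
  · simp [dAct_x_mul_mon_even]
  · simp [dAct_x_mul_mon_odd, twist_x_mul_tw]

/-- Modulo `im D_{-1}` one has `x tⁱ y²ᵐ⁺¹ ≡ tⁱ⁺¹ wₘ`; `twist` performs this replacement. The
functionals thus descend to the quotient, and the system is triangular in `m`. -/
theorem eq_zero_of_adY_commMon (g : (ℕ × ℕ) ⊕ (ℕ × ℕ) →₀ k)
    (hg : adY k (Finsupp.linearCombination k (commMon k) g) ∈ LinearMap.range (dAct k (-1))) :
    g = 0 := by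
  refine Finsupp.eq_zero_of_triangular (Sum.elim Prod.snd Prod.snd) (fun p => adY k (commMon k p))
    (Sum.elim (fun p => cf₀ k (p.1 + 1) (2 * p.2 + 1))
      (fun p => cf₀ k (p.1 + 1 + 1) (2 * p.2) ∘ₗ twist k)) ?_ ?_ g (fun q => ?_)
  · rintro (⟨i, m⟩ | ⟨i, m⟩) (⟨j, l⟩ | ⟨j, l⟩) hne hle
    · have : ¬ (i = j ∧ m = l) := by simpa using hne
      simpa [commMon, adY_mon_succ, cf₀_x_mul] using this
    · simp [commMon, adY_mon_succ, twist_mon_odd, twist_x_mul_mon_even,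
        show 2 * m + 2 = 2 * (m + 1) by ring]
    · simp [commMon, adY_mon_succ, cf₀_x_mul]
      omega
    · have : ¬ (i = j ∧ m = l) := by simpa using hne
      rw [← cf₀_upper hle this 1]
      simp [commMon, adY_mon_succ, twist_mon_even, twist_x_mul_mon_odd,
        show 2 * m + 1 + 1 = 2 * (m + 1) by ring, show 2 * m + 1 + 2 = 2 * (m + 1) + 1 by ring,
        show 2 * m + 2 = 2 * (m + 1) by ring]
  · rintro (⟨i, m⟩ | ⟨i, m⟩)
    · simp [commMon, adY_mon_succ, cf₀_x_mul]
    · refine ne_of_eq_of_ne ?_ (cf₀_diag_ne_zero i m 1)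
      simp [commMon, adY_mon_succ, twist_mon_even, twist_x_mul_mon_odd,
        show 2 * m + 1 + 1 = 2 * (m + 1) by ring, show 2 * m + 1 + 2 = 2 * (m + 1) + 1 by ring,
        show 2 * m + 2 = 2 * (m + 1) by ring]
  · have : Finsupp.linearCombination k (fun p => adY k (commMon k p)) g =
        adY k (Finsupp.linearCombination k (commMon k) g) := by
      rw [Finsupp.apply_linearCombination]; rfl
    obtain ⟨a, ha⟩ := hg
    rw [this, ← ha]
    rcases q with q | q
    · simp [cf₀_odd_dAct]
    · simp [twist_dAct]

theorem adY_cycleSnd_mem (j : ℕ ⊕ (ℕ ⊕ ℕ)) :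
    adY k (cycleSnd k j) ∈ LinearMap.range (dAct k (-1)) := by
  rcases j with n | n | n
  · exact ⟨-y k ^ (2 * n + 1), by
      rw [map_neg]; exact neg_eq_of_add_eq_zero_right (dAct_add_adY_cycle₁Aux n)⟩
  · refine ⟨0, ?_⟩
    have := adY_mon_zero (k := k) n
    simpa [cycleSnd, mon, eq_comm] using this
  · exact ⟨- -(y k * x k * y k ^ (2 * n)), by
      rw [map_neg]; exact neg_eq_of_add_eq_zero_right (dAct_add_adY_y_pow n)⟩

/-- The second components of the cycles, `im f` and the monomials `tⁱ⁺¹ yᶜ` span `A`. The first two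
satisfy the condition, and on the span of the third `adY` is injective modulo `im D_{-1}`. -/
theorem mem_of_adY_mem {b : Plane k} (hb : adY k b ∈ LinearMap.range (dAct k (-1))) :
    b ∈ Submodule.span k (Set.range (cycleSnd k)) ⊔ LinearMap.range (fAct k) := by
  set T := Submodule.span k (Set.range (cycleSnd k)) ⊔ LinearMap.range (fAct k)
  have hT : T ≤ (LinearMap.range (dAct k (-1))).comap (adY k) := by
    rw [sup_le_iff, Submodule.span_le]
    constructor
    · rintro _ ⟨j, rfl⟩
      exact adY_cycleSnd_mem j
    · rintro _ ⟨b, rfl⟩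
      exact adY_fAct_mem b
  have hmem : b ∈ T ⊔ Submodule.span k (Set.range (commMon k)) := by
    refine mem_of_fAct_mem (T ⊔ Submodule.span k (Set.range (commMon k)))
      (fun j => Submodule.mem_sup_left (Submodule.mem_sup_left (Submodule.subset_span ⟨j, rfl⟩)))
      (fun i c => Submodule.mem_sup_right (Submodule.subset_span ?_))
      (fun b => Submodule.mem_sup_left (Submodule.mem_sup_right ⟨b, rfl⟩)) b
    obtain ⟨m, rfl | rfl⟩ := Nat.even_or_odd' c
    exacts [⟨Sum.inl (i, m), rfl⟩, ⟨Sum.inr (i, m), rfl⟩]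
  obtain ⟨t, ht, n, hn, rfl⟩ := Submodule.mem_sup.1 hmem
  obtain ⟨g, rfl⟩ := (Finsupp.mem_span_range_iff_exists_finsupp).1 hn
  have h := eq_zero_of_adY_commMon g
    ((Submodule.add_mem_iff_right ((LinearMap.range (dAct k (-1))).comap (adY k)) (hT ht)).1 hb)
  rwa [h, Finsupp.sum_zero_index, add_zero]

end SuperJordan

/-! ### Criteria for a basis of homology. -/

namespace Cpx

theorem exists_basis_homology {k : Type*} [CommRing k] {X : ℕ → Type*} [∀ n, AddCommGroup (X n)]
    [∀ n, Module k (X n)] {dX : ∀ n, X (n + 1) →ₗ[k] X n} {ι : Type*} (n : ℕ) (z : ι → X n)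
    (hz : ∀ i, z i ∈ cycles dX n)
    (hs : ∀ c ∈ cycles dX n, c ∈ Submodule.span k (Set.range z) ⊔ boundaries dX n)
    (hi : ∀ f : ι →₀ k, Finsupp.linearCombination k z f ∈ boundaries dX n → f = 0) :
    ∃ B : Module.Basis ι k (Homology dX n), ∀ i, IsClassOf dX n (z i) (B i) := by
  let z' : ι → cycles dX n := fun i => ⟨z i, hz i⟩
  have hz' : ∀ f : ι →₀ k, (Finsupp.linearCombination k z' f : X n) =
      Finsupp.linearCombination k z f := by
    intro f
    rw [← Submodule.subtype_apply, Finsupp.apply_linearCombination]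
    rfl
  let v : ι → Homology dX n := fun i => Submodule.Quotient.mk (z' i)
  have hv : ∀ f : ι →₀ k, Finsupp.linearCombination k v f =
      Submodule.Quotient.mk (Finsupp.linearCombination k z' f) := by
    intro f
    rw [← Submodule.mkQ_apply, Finsupp.apply_linearCombination]
    rfl
  have hli : LinearIndependent k v := by
    rw [linearIndependent_iff]
    intro f hf
    refine hi f ?_
    rw [hv, ← Submodule.Quotient.mk_zero, mk_eq_mk_iff, hz', Submodule.coe_zero, sub_zero] at hf
    exact hf
  have hsp : ⊤ ≤ Submodule.span k (Set.range v) := by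
    rintro h -
    obtain ⟨c, rfl⟩ := Submodule.Quotient.mk_surjective _ h
    obtain ⟨s, hs, b, hb, hsb⟩ := Submodule.mem_sup.1 (hs c c.2)
    obtain ⟨f, hf⟩ := (Finsupp.mem_span_range_iff_exists_finsupp).1 hs
    rw [← Finsupp.linearCombination_apply, ← hz'] at hf
    have : (Submodule.Quotient.mk c : Homology dX n) =
        Submodule.Quotient.mk (Finsupp.linearCombination k z' f) := by
      rw [mk_eq_mk_iff, hf, ← hsb, add_sub_cancel_left]
      exact hb
    rw [this, ← hv, ← Finsupp.range_linearCombination]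
    exact ⟨f, rfl⟩
  refine ⟨Module.Basis.mk hli hsp, fun i => ?_⟩
  rw [Module.Basis.mk_apply]
  exact ⟨hz i, rfl⟩

end Cpx

namespace SuperJordan

open Hochschild

section Filtered

variable {k : Type*} [Field k]

theorem smallD_smallD (n : ℕ) (a : Small k (n + 2)) : smallD k n (smallD k (n + 1) a) = 0 := by
  have : smallD k n ∘ₗ smallD k (n + 1) = 0 := by
    refine (isBalancedTensor_resPairing (n + 2)).ext fun a m => ?_
    rw [LinearMap.comp_apply, smallD_resPairing, smallD_resPairing, resD_resD, map_zero,
      LinearMap.zero_apply]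
  exact LinearMap.congr_fun this a

/-- Elements with zero second component form a filtration step. Homology is assembled from cycles in
the first component modulo `im D`, and from second components of cycles modulo `im E`. The
functionals `f` have to kill `C b` only when `E b = 0`, because independence is tested on second
components before first ones. -/
theorem exists_basis_of_filtration {ι κ : Type*} (n : ℕ) (D C E : Plane k →ₗ[k] Plane k)
    (u : ι → Plane k) (v v' : κ → Plane k) (f : ι → Plane k →ₗ[k] k) (g : κ → Plane k →ₗ[k] k)
    (hd : ∀ a : Small k (n + 2), smallD k (n + 1) a = ![D (a 0) + C (a 1), E (a 1)])
    (hu : ∀ i, smallD k n ![u i, 0] = 0) (hv : ∀ j, smallD k n ![v' j, v j] = 0)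
    (hu' : ∀ a, smallD k n ![a, 0] = 0 → a ∈ Submodule.span k (Set.range u) ⊔ LinearMap.range D)
    (hv' : ∀ a : Small k (n + 1), smallD k n a = 0 →
      a 1 ∈ Submodule.span k (Set.range v) ⊔ LinearMap.range E)
    (hfD : ∀ i a, f i (D a) = 0) (hfC : ∀ i b, E b = 0 → f i (C b) = 0)
    (hfu : ∀ i j, f j (u i) = 0 ↔ i ≠ j)
    (hgE : ∀ i b, g i (E b) = 0) (hgv : ∀ i j, g j (v i) = 0 ↔ i ≠ j) :
    ∃ B : Module.Basis (ι ⊕ κ) k (Cpx.Homology (smallD k) (n + 1)), ∀ i,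
      Cpx.IsClassOf (smallD k) (n + 1)
        ((Sum.elim (fun i => ![u i, 0]) (fun j => ![v' j, v j]) : ι ⊕ κ → Fin 2 → Plane k) i)
        (B i) := by
  set z : ι ⊕ κ → Small k (n + 1) := Sum.elim (fun i => ![u i, 0]) (fun j => ![v' j, v j])
  set T : Submodule k (Small k (n + 1)) :=
    Submodule.span k (Set.range z) ⊔ Cpx.boundaries (smallD k) (n + 1)
  have hz : ∀ i, z i ∈ T := fun i => Submodule.mem_sup_left (Submodule.subset_span ⟨i, rfl⟩)
  have hb : ∀ a, smallD k (n + 1) a ∈ T := fun a => Submodule.mem_sup_right ⟨a, rfl⟩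
  have hz0 : ∀ i, smallD k n (z i) = 0 := by
    rintro (i | j)
    exacts [hu i, hv j]
  have hzs : ∀ s ∈ Submodule.span k (Set.range v),
      ∃ a ∈ T, smallD k n a = 0 ∧ a 1 = s := by
    intro s hs
    induction hs using Submodule.span_induction with
    | mem _ h =>
      obtain ⟨j, rfl⟩ := h
      exact ⟨z (Sum.inr j), hz _, hz0 _, rfl⟩
    | zero => exact ⟨0, zero_mem _, map_zero _, rfl⟩
    | add _ _ _ _ h1 h2 =>
      obtain ⟨a, ha, ha0, rfl⟩ := h1
      obtain ⟨b, hb, hb0, rfl⟩ := h2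
      exact ⟨a + b, add_mem ha hb, by rw [map_add, ha0, hb0, add_zero], rfl⟩
    | smul c _ _ h =>
      obtain ⟨a, ha, ha0, rfl⟩ := h
      exact ⟨c • a, T.smul_mem c ha, by rw [map_smul, ha0, smul_zero], rfl⟩
  have hfst : ∀ a, smallD k n ![a, 0] = 0 → (![a, 0] : Small k (n + 1)) ∈ T := by
    intro a ha
    let incl : Plane k →ₗ[k] Small k (n + 1) := LinearMap.single k (fun _ => Plane k) (0 : Fin 2)
    have hincl : ∀ a, incl a = ![a, 0] := by
      intro a
      funext j
      fin_cases j
      · rfl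
      · rfl
    have h : Submodule.span k (Set.range u) ⊔ LinearMap.range D ≤ T.comap incl := by
      rw [sup_le_iff, Submodule.span_le]
      constructor
      · rintro _ ⟨i, rfl⟩
        change incl (u i) ∈ T
        rw [hincl]
        exact hz (Sum.inl i)
      · rintro _ ⟨b, rfl⟩
        change incl (D b) ∈ T
        have := hb ![b, 0]
        rw [hd] at this
        rw [hincl]
        simpa using this
    have := h (hu' a ha)
    rwa [Submodule.mem_comap, hincl] at this
  refine Cpx.exists_basis_homology (n + 1) z hz0 (fun c hc => ?_) (fun l hl => ?_)
  · obtain ⟨s, hs, _, ⟨b, rfl⟩, hsb⟩ := Submodule.mem_sup.1 (hv' c hc)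
    obtain ⟨a, haT, ha0, rfl⟩ := hzs s hs
    -- Removing a combination of the lifted cycles and a boundary leaves a cycle in the first
    -- component alone.
    set r : Small k (n + 1) := c - a - smallD k (n + 1) ![0, b] with hr
    have hr0 : smallD k n r = 0 := by
      have hc0 : smallD k n c = 0 := hc
      rw [hr, map_sub, map_sub, hc0, ha0, smallD_smallD, sub_zero, sub_zero]
    have hr1 : r 1 = 0 := by
      rw [hr, hd]
      simp [← hsb]
    have hr2 : r = ![r 0, 0] := by
      funext j
      fin_cases j
      · rfl
      · exact hr1
    have hrT : r ∈ T := by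
      rw [hr2]
      refine hfst _ ?_
      rw [← hr2, hr0]
    have : c = r + a + smallD k (n + 1) ![0, b] := by
      rw [hr]
      abel
    rw [this]
    exact add_mem (add_mem hrT haT) (hb _)
  · obtain ⟨a, ha⟩ := hl
    rw [hd] at ha
    let p₀ : Small k (n + 1) →ₗ[k] Plane k := LinearMap.proj (0 : Fin 2)
    let p₁ : Small k (n + 1) →ₗ[k] Plane k := LinearMap.proj (1 : Fin 2)
    have hr : ∀ j, l (Sum.inr j) = 0 := by
      intro j
      refine Finsupp.eq_zero_of_dual (v := z)
        (f := g j ∘ₗ p₁) ?_ ?_ ?_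
      · rintro (i | i) - hne
        · exact map_zero (g j)
        · exact (hgv i j).2 fun h => hne (by rw [h])
      · exact fun h => (hgv j j).1 h rfl
      · rw [← ha]
        exact hgE j (a 1)
    have hE : E (a 1) = 0 := by
      have h1 : p₁ (Finsupp.linearCombination k z l) = 0 := by
        rw [Finsupp.linearCombination_apply, Finsupp.sum, map_sum]
        refine Finset.sum_eq_zero fun p _ => ?_
        rw [map_smul]
        rcases p with i | j
        · exact smul_zero _
        · rw [hr, zero_smul]
      rw [← ha] at h1
      exact h1
    have hl : ∀ i, l (Sum.inl i) = 0 := by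
      intro i
      refine Finsupp.eq_zero_of_dual (v := z)
        (f := f i ∘ₗ p₀) ?_ ?_ ?_
      · rintro (j | j) hp hne
        · exact (hfu j i).2 fun h => hne (by rw [h])
        · exact absurd (hr j) (Finsupp.mem_support_iff.1 hp)
      · exact fun h => (hfu i i).1 h rfl
      · rw [← ha]
        change f i (D (a 0) + C (a 1)) = 0
        rw [map_add, hfD, hfC i _ hE, add_zero]
    ext (i | j)
    exacts [hl i, hr j]

end Filtered

/-! ### Bases of the homology of the small complex. -/

section Bases

variable {k : Type*} [Field k]

theorem cycleEven_eq : cycleEven k =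
    Sum.elim (fun i => ![x k * y k ^ (2 * i), 0]) (fun j => ![w k j * y k, w k j]) := by
  have h : ∀ n, ∑ i ∈ Finset.range (n + 1),
      ((n ! : k) / (i ! : k)) • ((y k * x k) ^ (n - i) * y k ^ (2 * i + 1)) = w k n * y k := by
    intro n
    rw [w, Finset.sum_mul]
    refine Finset.sum_congr rfl fun i _ => ?_
    rw [smul_mul_assoc, mul_assoc, ← pow_succ]
  rw [cycleEven]
  simp only [h]

theorem pair_eq_zero_iff (a b : Plane k) : (![a, b] : Fin 2 → Plane k) = 0 ↔ a = 0 ∧ b = 0 := by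
  simp

theorem smallD_even_apply (n : ℕ) (a : Small k (2 * n + 3)) : smallD k (2 * n + 2) a =
    ![dAct k (-1) (a 0) + cAct k (a 1), -dAct k 1 (a 1)] := by
  have h : (-1 : k) ^ (2 * n + 3) = -1 := Odd.neg_one_pow ⟨n + 1, by ring⟩
  have := smallD_apply (2 * n) a
  rwa [h, neg_neg] at this

theorem smallD_odd_apply (n : ℕ) (a : Small k (2 * n + 4)) : smallD k (2 * n + 3) a =
    ![dAct k 1 (a 0) + cAct k (a 1), -dAct k (-1) (a 1)] := by
  have h : (-1 : k) ^ (2 * n + 1 + 3) = 1 := Even.neg_one_pow ⟨n + 2, by ring⟩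
  have := smallD_apply (2 * n + 1) a
  rwa [h] at this

variable [CharZero k]

theorem cf₀_zero_even_w_eq_zero_iff (i j : ℕ) : cf₀ k 0 (2 * j) (w k i) = 0 ↔ i ≠ j := by
  rw [cf₀_zero_even_w]
  simp [eq_comm]

theorem cf₁_zero_even_eq_zero_iff (i j : ℕ) :
    cf₁ k 0 (2 * j) (x k * y k ^ (2 * i)) = 0 ↔ i ≠ j := by
  have : x k * y k ^ (2 * i) = x k * mon k 0 (2 * i) := by simp [mon]
  rw [this, cf₁_x_mul_mon]
  simp

theorem dAct_one_x_mul_y_pow (m : ℕ) : dAct k 1 (x k * y k ^ (2 * m)) = 0 := by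
  have := dAct_x_mul_mon_even (k := k) 1 0 m
  simpa [mon] using this

theorem dAct_neg_one_add_cAct (m : ℕ) :
    dAct k (-1) (-(y k * x k * y k ^ (2 * m))) + cAct k (x k * y k ^ (2 * m)) = 0 := by
  have h1 : x k * y k ^ (2 * m) = x k * mon k 0 (2 * m) := by simp [mon]
  have h2 : y k * x k * y k ^ (2 * m) = mon k 1 (2 * m) := by simp [mon]
  rw [h1, h2, cAct_x_mul_mon_zero, map_neg, neg_add_cancel]

theorem dAct_one_add_cAct (m : ℕ) : dAct k 1 (w k m * y k) + cAct k (w k m) = 0 := by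
  rw [cAct_w, add_neg_cancel]

theorem fAct_eq_zero_iff (b : Plane k) : fAct k b = 0 ↔ dAct k (-1) b = 0 := by
  refine ⟨dAct_eq_zero_of_fAct_eq_zero, fun h => ?_⟩
  rw [fAct_eq, h, mul_zero, zero_mul, mul_zero, add_zero, add_zero, neg_zero]

/-- The incoming differential is used only through its kernel. Degree 2, where `fAct` stands in
place of `D_{-1}`, is therefore treated together with degrees 4, 6, …. -/
theorem exists_basis_cycleEven (n : ℕ)
    (hn : ∀ a : Small k (n + 1), smallD k n a = 0 ↔
      dAct k 1 (a 0) + cAct k (a 1) = 0 ∧ dAct k (-1) (a 1) = 0)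
    (hn' : ∀ a : Small k (n + 2), smallD k (n + 1) a =
      ![dAct k (-1) (a 0) + cAct k (a 1), -dAct k 1 (a 1)]) :
    ∃ B : Module.Basis (ℕ ⊕ ℕ) k (Cpx.Homology (smallD k) (n + 1)), ∀ i,
      Cpx.IsClassOf (smallD k) (n + 1) (cycleEven k i) (B i) := by
  rw [cycleEven_eq]
  refine exists_basis_of_filtration n (dAct k (-1)) (cAct k) (-dAct k 1) _ _ _
    (fun i => cf₁ k 0 (2 * i)) (fun i => cf₀ k 0 (2 * i)) hn' (fun i => ?_) (fun j => ?_)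
    (fun a ha => ?_) (fun a ha => ?_) (fun i a => cf₁_zero_even_dAct i a)
    (fun i b hb => cf₁_zero_even_cAct i (neg_eq_zero.1 hb)) cf₁_zero_even_eq_zero_iff
    (fun i b => ?_) cf₀_zero_even_w_eq_zero_iff
  · rw [hn]
    exact ⟨by simp [dAct_one_x_mul_y_pow], by simp⟩
  · rw [hn]
    exact ⟨dAct_one_add_cAct j, dAct_neg_one_w j⟩
  · have := ((hn _).1 ha).1
    exact mem_of_dAct_one_eq_zero (by simpa using this)
  · rw [LinearMap.range_neg]
    exact mem_of_dAct_neg_one_eq_zero ((hn _).1 ha).2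
  · rw [LinearMap.neg_apply, map_neg, cf₀_zero_dAct, neg_zero]

theorem exists_basis_cycleOdd (n : ℕ)
    (hn : ∀ a : Small k (n + 1), smallD k n a = 0 ↔
      dAct k (-1) (a 0) + cAct k (a 1) = 0 ∧ dAct k 1 (a 1) = 0)
    (hn' : ∀ a : Small k (n + 2), smallD k (n + 1) a =
      ![dAct k 1 (a 0) + cAct k (a 1), -dAct k (-1) (a 1)]) :
    ∃ B : Module.Basis (ℕ ⊕ ℕ) k (Cpx.Homology (smallD k) (n + 1)), ∀ i,
      Cpx.IsClassOf (smallD k) (n + 1) (cycleOdd k i) (B i) := by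
  refine exists_basis_of_filtration n (dAct k 1) (cAct k) (-dAct k (-1)) _ _ _
    (fun i => cf₀ k 0 (2 * i)) (fun i => cf₁ k 0 (2 * i)) hn' (fun i => ?_) (fun j => ?_)
    (fun a ha => ?_) (fun a ha => ?_) (fun i a => cf₀_zero_dAct 1 _ a)
    (fun i b hb => cf₀_zero_cAct _ (neg_eq_zero.1 hb)) cf₀_zero_even_w_eq_zero_iff
    (fun i b => ?_) cf₁_zero_even_eq_zero_iff
  · rw [hn]
    exact ⟨by simp [dAct_neg_one_w], by simp⟩
  · rw [hn]
    exact ⟨dAct_neg_one_add_cAct j, dAct_one_x_mul_y_pow j⟩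
  · have := ((hn _).1 ha).1
    exact mem_of_dAct_neg_one_eq_zero (by simpa using this)
  · rw [LinearMap.range_neg]
    exact mem_of_dAct_one_eq_zero ((hn _).1 ha).2
  · rw [LinearMap.neg_apply, map_neg, cf₁_zero_even_dAct, neg_zero]

theorem smallD_one_eq_zero_iff (a : Small k 2) : smallD k 1 a = 0 ↔
    dAct k 1 (a 0) + cAct k (a 1) = 0 ∧ dAct k (-1) (a 1) = 0 := by
  rw [smallD_one_apply, ← fAct_eq_zero_iff]
  exact pair_eq_zero_iff _ _

theorem exists_basis_zero : ∃ B : Module.Basis (ℕ ⊕ ℕ) k (Cpx.Homology (smallD k) 0), ∀ i,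
    Cpx.IsClassOf (smallD k) 0 (cycle₀ k i) (B i) := by
  set T : Submodule k (Small k 0) :=
    Submodule.span k (Set.range (cycle₀ k)) ⊔ Cpx.boundaries (smallD k) 0
  refine Cpx.exists_basis_homology 0 (cycle₀ k) (fun _ => trivial) (fun c _ => ?_) (fun l hl => ?_)
  · let incl : Plane k →ₗ[k] Small k 0 := LinearMap.pi fun _ => LinearMap.id
    have hz : ∀ i, cycle₀ k i ∈ T :=
      fun i => Submodule.mem_sup_left (Submodule.subset_span ⟨i, rfl⟩)
    have hb : ∀ b, incl (adY k b) ∈ T := by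
      intro b
      refine Submodule.mem_sup_right ⟨![0, b], ?_⟩
      funext g
      rw [smallD_zero_apply]
      change dAct k (-1) 0 + adY k b = adY k b
      rw [map_zero, zero_add]
    exact mem_of_commutators_mem (T.comap incl) (fun n => hz (Sum.inl n)) (fun n => hz (Sum.inr n))
      hb (c ())
  · obtain ⟨a, ha⟩ := hl
    let p : Small k 0 →ₗ[k] Plane k := LinearMap.proj ()
    have hp : p (Finsupp.linearCombination k (cycle₀ k) l) =
        dAct k (-1) (a 0) + adY k (a 1) := by
      rw [← ha]
      exact smallD_zero_apply a ()
    have h0 : ∀ n, y k ^ n = mon k 0 n := fun n => by simp [mon]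
    refine Finsupp.eq_zero_of_triangular (fun _ => 0) (cycle₀ k)
      (Sum.elim (fun n => traceX k n ∘ₗ p) (fun n => cf₀ k 0 n ∘ₗ p)) ?_ ?_ l ?_
    · rintro (n | n) (m | m) hne - <;>
        simp [p, cycle₀, h0, traceX_mon, traceX_x_mul_mon] at hne ⊢ <;> exact hne
    · rintro (n | n) <;> simp [p, cycle₀, h0, traceX_mon, traceX_x_mul_mon]
    · rintro (n | n)
      · rw [Sum.elim_inl, LinearMap.comp_apply, hp, map_add, traceX_dAct, traceX_adY, add_zero]
      · rw [Sum.elim_inr, LinearMap.comp_apply, hp, map_add, cf₀_zero_dAct, cf₀_zero_adY, add_zero]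

theorem exists_basis_one :
    ∃ B : Module.Basis ((ℕ ⊕ ℕ) ⊕ (ℕ ⊕ ℕ)) k (Cpx.Homology (smallD k) 1), ∀ i,
      Cpx.IsClassOf (smallD k) 1 (cycle₁ k i) (B i) := by
  have hn : ∀ a : Small k 1, smallD k 0 a = 0 ↔ dAct k (-1) (a 0) + adY k (a 1) = 0 := by
    intro a
    rw [← smallD_zero_apply a ()]
    exact ⟨fun h => congrFun h (), fun h => funext fun _ => h⟩
  have hv : ∀ i j, dualSnd k j (cycleSnd k i) = 0 ↔ i ≠ j := by
    intro i j
    rw [dualSnd_cycleSnd]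
    simp
  set v : ℕ ⊕ (ℕ ⊕ ℕ) → Plane k := Sum.elim (fun n => y k ^ (2 * n + 1))
    (Sum.elim (fun _ => 0) (fun n => -(y k * x k * y k ^ (2 * n))))
  obtain ⟨B, hB⟩ : ∃ B : Module.Basis (ℕ ⊕ (ℕ ⊕ (ℕ ⊕ ℕ))) k (Cpx.Homology (smallD k) 1), ∀ i,
      Cpx.IsClassOf (smallD k) 1 ((Sum.elim (fun i => ![w k i, 0])
        (fun j => ![v j, cycleSnd k j]) : _ → Fin 2 → Plane k) i) (B i) := by
    refine exists_basis_of_filtration 0 (dAct k 1) (cAct k) (fAct k) (w k) (cycleSnd k) v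
      (fun i => cf₀ k 0 (2 * i)) (dualSnd k) smallD_one_apply (fun i => ?_) (fun j => ?_)
      (fun a ha => ?_) (fun a ha => ?_) (fun i a => cf₀_zero_dAct 1 _ a)
      (fun i b hb => cf₀_zero_cAct _ (dAct_eq_zero_of_fAct_eq_zero hb)) cf₀_zero_even_w_eq_zero_iff
      dualSnd_fAct hv
    · rw [hn]
      simp [dAct_neg_one_w]
    · rw [hn]
      rcases j with n | n | n
      · exact dAct_add_adY_cycle₁Aux n
      · have := adY_mon_zero (k := k) n
        simpa [cycleSnd, mon, v] using this
      · exact dAct_add_adY_y_pow n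
    · rw [hn] at ha
      exact mem_of_dAct_neg_one_eq_zero (by simpa using ha)
    · rw [hn] at ha
      refine mem_of_adY_mem ⟨-a 0, ?_⟩
      rw [map_neg]
      exact neg_eq_of_add_eq_zero_right ha
  -- The filtration lists the family `(wₙ, 0)` first, while `cycle₁` lists it second.
  let e : ℕ ⊕ (ℕ ⊕ (ℕ ⊕ ℕ)) ≃ (ℕ ⊕ ℕ) ⊕ (ℕ ⊕ ℕ) :=
    (Equiv.sumAssoc ℕ ℕ (ℕ ⊕ ℕ)).symm.trans ((Equiv.sumComm ℕ ℕ).sumCongr (Equiv.refl _))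
  refine ⟨B.reindex e, fun i => ?_⟩
  obtain ⟨j, rfl⟩ := e.surjective i
  rw [Module.Basis.reindex_apply, Equiv.symm_apply_apply]
  rcases j with n | n | n | n
  exacts [hB (Sum.inl n), hB (Sum.inr (Sum.inl n)), hB (Sum.inr (Sum.inr (Sum.inl n))),
    hB (Sum.inr (Sum.inr (Sum.inr n)))]

theorem exists_basis_two : ∃ B : Module.Basis (ℕ ⊕ ℕ) k (Cpx.Homology (smallD k) 2), ∀ i,
    Cpx.IsClassOf (smallD k) 2 (cycleEven k i) (B i) :=
  exists_basis_cycleEven 1 smallD_one_eq_zero_iff (smallD_even_apply 0)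

theorem exists_basis_odd (p : ℕ) :
    ∃ B : Module.Basis (ℕ ⊕ ℕ) k (Cpx.Homology (smallD k) (2 * p + 3)), ∀ i,
      Cpx.IsClassOf (smallD k) (2 * p + 3) (cycleOdd k i) (B i) :=
  exists_basis_cycleOdd (2 * p + 2) (fun a => by
    rw [smallD_even_apply]
    exact (pair_eq_zero_iff _ _).trans (and_congr_right fun _ => neg_eq_zero)) (smallD_odd_apply p)

theorem exists_basis_even (p : ℕ) :
    ∃ B : Module.Basis (ℕ ⊕ ℕ) k (Cpx.Homology (smallD k) (2 * p + 4)), ∀ i,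
      Cpx.IsClassOf (smallD k) (2 * p + 4) (cycleEven k i) (B i) :=
  exists_basis_cycleEven (2 * p + 3) (fun a => by
    rw [smallD_odd_apply]
    exact (pair_eq_zero_iff _ _).trans (and_congr_right fun _ => neg_eq_zero))
    (smallD_even_apply (p + 1))

end Bases

end SuperJordan

/-! ### Transport to Hochschild homology, and periodicity. -/

namespace SuperJordan

open Hochschild

section Transport

variable {k : Type*} [Field k] {Φ : ∀ n, Res k n →ₗ[Env k (Plane k)] Bar k (Plane k) n}

theorem classesFormBasis_of_exists (hΦ : IsComparison k Φ) {ι : Type} (n : ℕ) (z : ι → Small k n)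
    (h : ∃ B : Module.Basis ι k (Cpx.Homology (smallD k) n), ∀ i,
      Cpx.IsClassOf (smallD k) n (z i) (B i)) : ClassesFormBasis Φ n z := by
  obtain ⟨B, hB⟩ := h
  obtain ⟨e, he⟩ := exists_homology_equiv_of_isComparison Φ hΦ n
  refine ⟨fun i => (hB i).1, B.map e, fun i => ?_⟩
  rw [Module.Basis.map_apply]
  exact he _ _ (hB i)

theorem ClassesFormBasis.not_finite {ι : Type} [Infinite ι] {n : ℕ} {z : ι → Small k n}
    (h : ClassesFormBasis Φ n z) : ¬ Module.Finite k (HH k (Plane k) n) := by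
  obtain ⟨-, B, -⟩ := h
  intro hfin
  exact not_finite_iff_infinite.2 ‹Infinite ι› (Module.Finite.finite_basis B)

/-- From degree 3 on, the degree enters the differential only through a sign depending on its
parity. All positive degrees share the space `Fin 2 → Plane k`, so the identity map realizes the
periodicity. -/
theorem smallD_periodic (m : ℕ) (v : Fin 2 → Plane k) :
    (smallD k (m + 2) v : Fin 2 → Plane k) = smallD k (m + 4) v := by
  have h : (-1 : k) ^ (m + 2 + 3) = (-1) ^ (m + 3) := by
    rw [show m + 2 + 3 = m + 3 + 2 by ring, pow_add]
    simp
  have h1 := smallD_apply m v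
  have h2 := smallD_apply (m + 2) v
  rw [h] at h2
  exact h1.trans h2.symm

theorem exists_periodicity (m : ℕ) :
    ∃ s : Cpx.Homology (smallD k) (m + 3) ≃ₗ[k] Cpx.Homology (smallD k) (m + 3 + 2),
      ∀ (z : Fin 2 → Plane k) h, Cpx.IsClassOf (smallD k) (m + 3) z h →
        Cpx.IsClassOf (smallD k) (m + 3 + 2) z (s h) := by
  refine Cpx.exists_homology_equiv (dX := smallD k) (dY := smallD k) (m + 3) (m + 3 + 2)
    (LinearMap.id : (Fin 2 → Plane k) →ₗ[k] (Fin 2 → Plane k))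
    (LinearMap.id : (Fin 2 → Plane k) →ₗ[k] (Fin 2 → Plane k)) ?_ ?_ ?_ ?_ ?_ ?_
  · exact fun c hc => (smallD_periodic m c).symm.trans hc
  · rintro _ ⟨v, rfl⟩
    exact ⟨v, (smallD_periodic (m + 1) v).symm⟩
  · exact fun c hc => (smallD_periodic m c).trans hc
  · rintro _ ⟨v, rfl⟩
    exact ⟨v, smallD_periodic (m + 1) v⟩
  · intro c _
    change c - c ∈ _
    rw [sub_self]
    exact zero_mem _
  · intro c _
    change c - c ∈ _
    rw [sub_self]
    exact zero_mem _

end Transport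

end SuperJordan

end

theorem mainTheorem10 (k : Type*) [Field k] [CharZero k] :
    (∃ Φ : ∀ n, SuperJordan.Res k n →ₗ[Hochschild.Env k (SuperJordan.Plane k)]
        Hochschild.Bar k (SuperJordan.Plane k) n, SuperJordan.IsComparison k Φ) ∧
    ∀ Φ : ∀ n, SuperJordan.Res k n →ₗ[Hochschild.Env k (SuperJordan.Plane k)]
        Hochschild.Bar k (SuperJordan.Plane k) n, SuperJordan.IsComparison k Φ →
      (∀ n, ∃ e : Cpx.Homology (SuperJordan.smallD k) n ≃ₗ[k]
            Hochschild.HH k (SuperJordan.Plane k) n,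
        ∀ z h, Cpx.IsClassOf (SuperJordan.smallD k) n z h →
          Cpx.IsClassOf (Hochschild.chainsD k (SuperJordan.Plane k)) n
            (SuperJordan.induced Φ n z) (e h)) ∧
      SuperJordan.ClassesFormBasis Φ 0 (SuperJordan.cycle₀ k) ∧
      SuperJordan.ClassesFormBasis Φ 1 (SuperJordan.cycle₁ k) ∧
      SuperJordan.ClassesFormBasis Φ 2 (SuperJordan.cycleEven k) ∧
      (∀ p : ℕ, 1 ≤ p →
        SuperJordan.ClassesFormBasis Φ (2 * p + 1) (SuperJordan.cycleOdd k)) ∧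
      (∀ p : ℕ, 1 ≤ p →
        SuperJordan.ClassesFormBasis Φ (2 * p + 2) (SuperJordan.cycleEven k)) ∧
      (∀ n, ¬ Module.Finite k (Hochschild.HH k (SuperJordan.Plane k) n)) ∧
      (∀ m : ℕ, ∃ s : Hochschild.HH k (SuperJordan.Plane k) (m + 3) ≃ₗ[k]
            Hochschild.HH k (SuperJordan.Plane k) (m + 3 + 2),
        ∀ (z : Fin 2 → SuperJordan.Plane k) (h : Hochschild.HH k (SuperJordan.Plane k) (m + 3)),
          z ∈ Cpx.cycles (SuperJordan.smallD k) (m + 3) →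
          Cpx.IsClassOf (Hochschild.chainsD k (SuperJordan.Plane k)) (m + 3)
            (SuperJordan.induced Φ (m + 3) z) h →
          Cpx.IsClassOf (Hochschild.chainsD k (SuperJordan.Plane k)) (m + 3 + 2)
            (SuperJordan.induced Φ (m + 3 + 2) z) (s h)) := by
  open SuperJordan in
  refine ⟨exists_isComparison k, fun Φ hΦ => ?_⟩
  have h0 : ClassesFormBasis Φ 0 (cycle₀ k) := classesFormBasis_of_exists hΦ _ _ exists_basis_zero
  have h1 : ClassesFormBasis Φ 1 (cycle₁ k) := classesFormBasis_of_exists hΦ _ _ exists_basis_one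
  have h2 : ClassesFormBasis Φ 2 (cycleEven k) :=
    classesFormBasis_of_exists hΦ _ _ exists_basis_two
  have hodd : ∀ p : ℕ, ClassesFormBasis Φ (2 * p + 3) (cycleOdd k) :=
    fun p => classesFormBasis_of_exists hΦ _ _ (exists_basis_odd p)
  have heven : ∀ p : ℕ, ClassesFormBasis Φ (2 * p + 4) (cycleEven k) :=
    fun p => classesFormBasis_of_exists hΦ _ _ (exists_basis_even p)
  refine ⟨exists_homology_equiv_of_isComparison Φ hΦ, h0, h1, h2, fun p hp => ?_, fun p hp => ?_,
    fun n => ?_, fun m => ?_⟩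
  · obtain ⟨p, rfl⟩ := Nat.exists_eq_add_of_le' hp
    exact hodd p
  · obtain ⟨p, rfl⟩ := Nat.exists_eq_add_of_le' hp
    exact heven p
  · match n with
    | 0 => exact h0.not_finite
    | 1 => exact h1.not_finite
    | 2 => exact h2.not_finite
    | n + 3 =>
      obtain ⟨p, rfl | rfl⟩ := Nat.even_or_odd' n
      exacts [(hodd p).not_finite, (heven p).not_finite]
  · obtain ⟨e, he⟩ := exists_homology_equiv_of_isComparison Φ hΦ (m + 3)
    obtain ⟨e', he'⟩ := exists_homology_equiv_of_isComparison Φ hΦ (m + 3 + 2)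
    obtain ⟨s, hs⟩ := exists_periodicity (k := k) m
    -- Conjugate the periodicity of the small complex by the comparison isomorphisms; `h` is
    -- recovered as the image under `e` of the class of `z`.
    refine ⟨e.symm.trans (s.trans e'), fun z h hz hzh => ?_⟩
    have hc := Cpx.isClassOf_mk (dX := smallD k) (m + 3) z hz
    obtain ⟨_, rfl⟩ := hzh
    obtain ⟨_, heq⟩ := he _ _ hc
    rw [heq, LinearEquiv.trans_apply, LinearEquiv.symm_apply_apply, LinearEquiv.trans_apply]
    exact he' _ _ (hs _ _ hc)
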